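/- Let $\mathbb K=\mathbb R$ or $\mathbb C$, $1\le p<\infty$, $1\le r\le\infty$, $1/p+1/p'=1/r+1/r'=1$. Let $KT(p,r)$ be the set of all sequences $x=(x_n)_{n\ge1}\in c_0$ over $\mathbb K$ with $$|||x|||:=\max\Big\{\Big(\sum_{j\ge1}\frac{(j^{1/p}x_j^*)^r}{j}\Big)^{1/r},\ \sup_{N\ge1}\Big|\sum_{n=1}^N\frac{x_n}{n^{1/p'}}\Big|\Big\}<\infty ,$$ where $(x_j^*)$ is the non-increasing rearrangement of $(|x_n|)$ and the first term is $\sup_j j^{1/p}x_j^*$ if $r=\infty$. ($|||\cdot|||$ is a quasi-norm.) Let $\mathcal B=(e_n)$ be the canonical basis and let $\mathbb X$ be either $KT(p,r)$ or the closed linear span of $\mathcal B$ in it. Let $e_n^*(x)=x_n$, let $\|f\|_*=\sup_{|||x|||\le1}|f(x)|$ be the dual norm, and let $\widehat{\mathbb X}$ be the closed linear span of $\mathcal B^*=(e_n^*)$ in $\mathbb X^*$, with coordinate functionals $f\mapsto f(e_n)$. For a space $\mathbb X$ with quasi-norm $\|\cdot\|$, a system $(e_n)$ and coordinate functionals $(e_n^*)$,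 and a finite set $A\subset\mathbb N$, put $P_Ax=\sum_{n\in A}e_n^*(x)e_n$. A greedy operator of order $N$ is a map $G_Nx=P_{A_x}x$ with $|A_x|=N$ and $|e_n^*(x)|\ge|e_m^*(x)|$ for all $n\in A_x$, $m\notin A_x$. Put $\sigma_N(x)=\inf\{\|x-\sum_{n\in A}c_ne_n\|:c_n\in\mathbb K,\ |A|\le N\}$ and $\widetilde\sigma_N(x)=\inf\{\|x-P_Ax\|:|A|\le N\}$. Let $L_N$ (resp. $\widetilde L_N$) be the smallest constant with $\|x-G_Nx\|\le L_N\sigma_N(x)$ (resp. $\|x-G_Nx\|\le\widetilde L_N\widetilde\sigma_N(x)$) for all $x$ and all greedy operators $G_N$ of order $N$. Let $$K_N=\sup_{|A|\le N}\|P_A\|,\qquad g_N=\sup_{n\le N}\ \sup_{G_n}\|G_n\| .$$ Let $D(N)$ and $d(N)$ be the supremum and infimum of $\|\sum_{n\in A}\varepsilon_ne_n\|$ over $|A|=N$, $|\varepsilon_n|=1$, and $\mu_N=\sup_{1\le n\le N}D(n)/d(n)$. A superscript $*$ on any of these quantities denotes the same quantity for $\mathcal B^*$ in $\widehat{\mathbb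 X}$. Put $$\overline T_N(D,D^*)=\min\Big\{\sum_{j=1}^N\frac{D(j)}j\,\Delta D^*(j),\ \sum_{j=1}^N\frac{D^*(j)}j\,\Delta D(j)\Big\},\qquad \Delta\eta(j)=\eta(j)-\eta(j-1),\ \eta(0)=0 .$$ The system is quasi-greedy if $\sup_Ng_N<\infty$, superdemocratic if $\sup_N\mu_N<\infty$, and bidemocratic if $D(N)D^*(N)\le cN$ for all $N\ge1$ and some constant $c$. Finally, $a_N\approx b_N$ means $c\,b_N\le a_N\le C\,b_N$ for all $N\ge1$, with $0<c\le C<\infty$ independent of $N$. (i) If $1<p<\infty$, then $(\mathbb X,\mathcal B)$ is quasi-greedy and bidemocratic, and $$L_N\approx L_N^*\approx K_N\approx[\ln(N+1)]^{1/r'},\qquad \widetilde L_N\approx\widetilde L_N^*\approx1 .$$ (ii) If $p=1$, then $(\mathbb X,\mathcal B)$ is superdemocratic, and $$\overline T_N(D,D^*)\approx L_N\approx\widetilde L_N\approx L_N^*\approx\widetilde L_N^*\approx K_N\approx g_N\approx\mu_N^*\approx[\ln(N+1)]^{1/r'} .$$ -/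

import Mathlib

open scoped ENNReal NNReal Topology

/-! ## Biorthogonal systems in quasi-normed spaces -/

/-- A quasi-normed space `E` over `𝕜` (the quasi-norm takes finite values, written in `ℝ≥0∞`)
together with a biorthogonal system: vectors `vec n` and bounded coordinate functionals
`coord n`, indexed by `n = 0, 1, 2, …`. -/
structure BiorthSystem (𝕜 : Type*) [RCLike 𝕜] (E : Type*) [AddCommGroup E] [Module 𝕜 E] where
  /-- the quasi-norm -/
  nrm : E → ℝ≥0∞
  nrm_lt_top : ∀ x, nrm x < ⊤
  eq_zero_of_nrm : ∀ x, nrm x = 0 → x = 0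
  nrm_smul : ∀ (c : 𝕜) (x : E), nrm (c • x) = ‖c‖ₑ * nrm x
  nrm_add : ∃ C : ℝ≥0, ∀ x y, nrm (x + y) ≤ C * (nrm x + nrm y)
  /-- the system `e_n` -/
  vec : ℕ → E
  /-- the biorthogonal functionals `e_n^*` -/
  coord : ℕ → E →ₗ[𝕜] 𝕜
  coord_bdd : ∀ n, ∃ C : ℝ≥0, ∀ x, ‖coord n x‖ₑ ≤ C * nrm x
  biorth : ∀ n m, coord n (vec m) = if n = m then 1 else 0

/-- The closure of a subspace `V` with respect to an extended quasi-seminorm `q`. -/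
def qClosure {𝕜 : Type*} [RCLike 𝕜] {E : Type*} [AddCommGroup E] [Module 𝕜 E]
    (q : E → ℝ≥0∞) (hsmul : ∀ (c : 𝕜) (x : E), q (c • x) = ‖c‖ₑ * q x)
    (hadd : ∃ C : ℝ≥0, ∀ x y, q (x + y) ≤ C * (q x + q y)) (V : Submodule 𝕜 E) :
    Submodule 𝕜 E where
  carrier := {x | ∀ ε : ℝ≥0∞, 0 < ε → ∃ y ∈ V, q (x - y) ≤ ε}
  zero_mem' := by
    intro ε _
    refine ⟨0, V.zero_mem, ?_⟩
    have h := hsmul 0 0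
    simp only [zero_smul, enorm_zero, zero_mul] at h
    simp [h]
  add_mem' := by
    intro a b ha hb ε hε
    obtain ⟨C, hC⟩ := hadd
    have hk : (2 * (C + 1) : ℝ≥0∞) ≠ ⊤ := by finiteness
    have hk0 : (2 * (C + 1) : ℝ≥0∞) ≠ 0 := by simp
    have hδ : 0 < ε / (2 * (C + 1)) := ENNReal.div_pos hε.ne' hk
    obtain ⟨y, hy, hy'⟩ := ha _ hδ
    obtain ⟨z, hz, hz'⟩ := hb _ hδ
    refine ⟨y + z, V.add_mem hy hz, ?_⟩
    have e : a + b - (y + z) = (a - y) + (b - z) := by abel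
    rw [e]
    calc q ((a - y) + (b - z)) ≤ C * (q (a - y) + q (b - z)) := hC _ _
      _ ≤ (C + 1) * (ε / (2 * (C + 1)) + ε / (2 * (C + 1))) := by
          gcongr
          exact le_self_add
      _ = (2 * (C + 1)) * (ε / (2 * (C + 1))) := by ring
      _ = ε := ENNReal.mul_div_cancel hk0 hk
  smul_mem' := by
    intro c x hx ε hε
    have hk : (‖c‖ₑ + 1 : ℝ≥0∞) ≠ ⊤ := by finiteness
    have hk0 : (‖c‖ₑ + 1 : ℝ≥0∞) ≠ 0 := by simp
    obtain ⟨y, hy, hy'⟩ := hx _ (ENNReal.div_pos hε.ne' hk)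
    refine ⟨c • y, V.smul_mem c hy, ?_⟩
    rw [← smul_sub, hsmul]
    calc ‖c‖ₑ * q (x - y) ≤ (‖c‖ₑ + 1) * (ε / (‖c‖ₑ + 1)) := by
          gcongr
          exact le_self_add
      _ = ε := ENNReal.mul_div_cancel hk0 hk

theorem subset_qClosure {𝕜 : Type*} [RCLike 𝕜] {E : Type*} [AddCommGroup E] [Module 𝕜 E]
    (q : E → ℝ≥0∞) (hsmul : ∀ (c : 𝕜) (x : E), q (c • x) = ‖c‖ₑ * q x)
    (hadd : ∃ C : ℝ≥0, ∀ x y, q (x + y) ≤ C * (q x + q y)) (V : Submodule 𝕜 E) :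
    V ≤ qClosure q hsmul hadd V := by
  intro x hx ε _
  refine ⟨x, hx, ?_⟩
  have h := hsmul 0 0
  simp only [zero_smul, enorm_zero, zero_mul] at h
  simp [h]

namespace BiorthSystem

variable {𝕜 : Type*} [RCLike 𝕜] {E : Type*} [AddCommGroup E] [Module 𝕜 E]

/-- The closed linear span of the vectors `e_n`. -/
def closedSpan (S : BiorthSystem 𝕜 E) : Submodule 𝕜 E :=
  qClosure S.nrm S.nrm_smul S.nrm_add (Submodule.span 𝕜 (Set.range S.vec))

/-- The same system, viewed in the closed linear span of its vectors. -/
def restrict (S : BiorthSystem 𝕜 E) : BiorthSystem 𝕜 S.closedSpan where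
  nrm x := S.nrm x
  nrm_lt_top x := S.nrm_lt_top x
  eq_zero_of_nrm x hx := Subtype.ext (S.eq_zero_of_nrm x hx)
  nrm_smul c x := S.nrm_smul c x
  nrm_add := by
    obtain ⟨C, hC⟩ := S.nrm_add
    exact ⟨C, fun x y => hC x y⟩
  vec n := ⟨S.vec n, subset_qClosure _ _ _ _ (Submodule.subset_span ⟨n, rfl⟩)⟩
  coord n := (S.coord n).comp S.closedSpan.subtype
  coord_bdd n := by
    obtain ⟨C, hC⟩ := S.coord_bdd n
    exact ⟨C, fun x => hC x⟩
  biorth n m := S.biorth n m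

/-- The dual norm `‖f‖_* = sup {|f(x)| : ‖x‖ ≤ 1}`, with value `⊤` on unbounded functionals. -/
noncomputable def dualNrm (S : BiorthSystem 𝕜 E) (f : E →ₗ[𝕜] 𝕜) : ℝ≥0∞ :=
  ⨆ (x : E) (_ : S.nrm x ≤ 1), ‖f x‖ₑ

theorem dualNrm_smul (S : BiorthSystem 𝕜 E) (c : 𝕜) (f : E →ₗ[𝕜] 𝕜) :
    S.dualNrm (c • f) = ‖c‖ₑ * S.dualNrm f := by
  simp only [dualNrm, LinearMap.smul_apply, enorm_smul, ENNReal.mul_iSup]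

theorem dualNrm_add (S : BiorthSystem 𝕜 E) (f g : E →ₗ[𝕜] 𝕜) :
    S.dualNrm (f + g) ≤ S.dualNrm f + S.dualNrm g := by
  refine iSup₂_le fun x hx => ?_
  rw [LinearMap.add_apply]
  refine (enorm_add_le _ _).trans (add_le_add ?_ ?_)
  · exact le_iSup₂ (f := fun (x : E) (_ : S.nrm x ≤ 1) => ‖f x‖ₑ) x hx
  · exact le_iSup₂ (f := fun (x : E) (_ : S.nrm x ≤ 1) => ‖g x‖ₑ) x hx

theorem dualNrm_quasi (S : BiorthSystem 𝕜 E) :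
    ∃ C : ℝ≥0, ∀ f g, S.dualNrm (f + g) ≤ C * (S.dualNrm f + S.dualNrm g) :=
  ⟨1, fun f g => by simpa using S.dualNrm_add f g⟩

theorem enorm_apply_le (S : BiorthSystem 𝕜 E) (f : E →ₗ[𝕜] 𝕜) (x : E) :
    ‖f x‖ₑ ≤ S.dualNrm f * S.nrm x := by
  by_cases hx : x = 0
  · simp [hx]
  have h0 : S.nrm x ≠ 0 := fun h => hx (S.eq_zero_of_nrm x h)
  have ht : S.nrm x ≠ ⊤ := (S.nrm_lt_top x).ne
  set t : ℝ := (S.nrm x).toReal with ht_def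
  have htpos : 0 < t := ENNReal.toReal_pos h0 ht
  have hc : ‖((t⁻¹ : ℝ) : 𝕜)‖ₑ = (S.nrm x)⁻¹ := by
    rw [← ofReal_norm, RCLike.norm_ofReal, abs_of_pos (inv_pos.2 htpos),
      ENNReal.ofReal_inv_of_pos htpos, ENNReal.ofReal_toReal ht]
  have h1 : S.nrm (((t⁻¹ : ℝ) : 𝕜) • x) ≤ 1 := by
    rw [S.nrm_smul, hc, ENNReal.inv_mul_cancel h0 ht]
  have h2 := le_iSup₂ (f := fun (x : E) (_ : S.nrm x ≤ 1) => ‖f x‖ₑ) _ h1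
  rw [map_smul, enorm_smul, hc, mul_comm, ← div_eq_mul_inv] at h2
  exact (ENNReal.div_le_iff h0 ht).1 h2

/-- The space `X̂`: the closed linear span of the functionals `e_n^*` in the dual space. -/
noncomputable def dualSpan (S : BiorthSystem 𝕜 E) : Submodule 𝕜 (E →ₗ[𝕜] 𝕜) :=
  qClosure S.dualNrm S.dualNrm_smul S.dualNrm_quasi (Submodule.span 𝕜 (Set.range S.coord))

theorem dualNrm_coord_lt_top (S : BiorthSystem 𝕜 E) (n : ℕ) : S.dualNrm (S.coord n) < ⊤ := by
  obtain ⟨C, hC⟩ := S.coord_bdd n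
  refine lt_of_le_of_lt (iSup₂_le fun x hx => (hC x).trans ?_) (ENNReal.coe_lt_top (r := C))
  calc (C : ℝ≥0∞) * S.nrm x ≤ C * 1 := by gcongr
    _ = C := mul_one _

theorem dualNrm_lt_top (S : BiorthSystem 𝕜 E) (f : E →ₗ[𝕜] 𝕜) (hf : f ∈ S.dualSpan) :
    S.dualNrm f < ⊤ := by
  obtain ⟨g, hg, hfg⟩ := hf 1 one_pos
  have hgt : S.dualNrm g < ⊤ := by
    clear hfg
    induction hg using Submodule.span_induction with
    | mem x hx => obtain ⟨n, rfl⟩ := hx; exact S.dualNrm_coord_lt_top n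
    | zero => simp [dualNrm]
    | add x y _ _ hx hy => exact (S.dualNrm_add x y).trans_lt (ENNReal.add_lt_top.2 ⟨hx, hy⟩)
    | smul c x _ hx => rw [S.dualNrm_smul]; exact ENNReal.mul_lt_top (by finiteness) hx
  have h := S.dualNrm_add (f - g) g
  rw [sub_add_cancel] at h
  exact h.trans_lt (ENNReal.add_lt_top.2 ⟨hfg.trans_lt ENNReal.one_lt_top, hgt⟩)

/-- The dual system `B^* = {e_n^*}` in `X̂`, whose coordinate functionals are `f ↦ f(e_n)`. -/
noncomputable def dual (S : BiorthSystem 𝕜 E) : BiorthSystem 𝕜 S.dualSpan where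
  nrm f := S.dualNrm f
  nrm_lt_top f := S.dualNrm_lt_top f f.2
  eq_zero_of_nrm f hf := by
    refine Subtype.ext (LinearMap.ext fun x => ?_)
    have h := S.enorm_apply_le (f : E →ₗ[𝕜] 𝕜) x
    rw [hf, zero_mul] at h
    simpa using h
  nrm_smul c f := S.dualNrm_smul c f
  nrm_add := by
    obtain ⟨C, hC⟩ := S.dualNrm_quasi
    exact ⟨C, fun f g => hC f g⟩
  vec n := ⟨S.coord n, subset_qClosure _ _ _ _ (Submodule.subset_span ⟨n, rfl⟩)⟩
  coord n := (LinearMap.applyₗ (S.vec n)).comp S.dualSpan.subtype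
  coord_bdd n := by
    refine ⟨(S.nrm (S.vec n)).toNNReal, fun f => ?_⟩
    rw [ENNReal.coe_toNNReal (S.nrm_lt_top _).ne, mul_comm]
    exact S.enorm_apply_le (f : E →ₗ[𝕜] 𝕜) (S.vec n)
  biorth n m := by
    have h := S.biorth m n
    simp only [LinearMap.comp_apply, Submodule.subtype_apply, LinearMap.applyₗ_apply_apply, h,
      eq_comm]

/-! ### Greedy approximation -/

/-- The projection `P_A x = ∑_{n ∈ A} e_n^*(x) e_n`. -/
noncomputable def proj (S : BiorthSystem 𝕜 E) (A : Finset ℕ) (x : E) : E :=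
  ∑ n ∈ A, S.coord n x • S.vec n

/-- `A` is a greedy set for `x` of order `N`; the values `P_A x` over such `A` are exactly the
values `G_N x` of the greedy operators of order `N`. -/
def IsGreedySet (S : BiorthSystem 𝕜 E) (x : E) (N : ℕ) (A : Finset ℕ) : Prop :=
  A.card = N ∧ ∀ n ∈ A, ∀ m ∉ A, ‖S.coord m x‖ ≤ ‖S.coord n x‖

/-- The error `σ_N(x)` of `N`-term approximation. -/
noncomputable def sigma (S : BiorthSystem 𝕜 E) (N : ℕ) (x : E) : ℝ≥0∞ :=
  ⨅ (A : Finset ℕ) (_ : A.card ≤ N) (c : ℕ → 𝕜), S.nrm (x - ∑ n ∈ A, c n • S.vec n)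

/-- The error `σ̃_N(x)` of expansional `N`-term approximation. -/
noncomputable def sigmaExp (S : BiorthSystem 𝕜 E) (N : ℕ) (x : E) : ℝ≥0∞ :=
  ⨅ (A : Finset ℕ) (_ : A.card ≤ N), S.nrm (x - S.proj A x)

/-- `L_N`: the smallest `C` with `‖x - G_N x‖ ≤ C σ_N(x)` for all `x` and all `G_N`. -/
noncomputable def lebesgue (S : BiorthSystem 𝕜 E) (N : ℕ) : ℝ≥0∞ :=
  sInf {C | ∀ (x : E) (A : Finset ℕ), S.IsGreedySet x N A →
    S.nrm (x - S.proj A x) ≤ C * S.sigma N x}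

/-- `L̃_N`: the smallest `C` with `‖x - G_N x‖ ≤ C σ̃_N(x)` for all `x` and all `G_N`. -/
noncomputable def lebesgueExp (S : BiorthSystem 𝕜 E) (N : ℕ) : ℝ≥0∞ :=
  sInf {C | ∀ (x : E) (A : Finset ℕ), S.IsGreedySet x N A →
    S.nrm (x - S.proj A x) ≤ C * S.sigmaExp N x}

/-- The conditionality constants `K_N = sup {‖P_A‖ : |A| ≤ N}`. -/
noncomputable def condConst (S : BiorthSystem 𝕜 E) (N : ℕ) : ℝ≥0∞ :=
  ⨆ (A : Finset ℕ) (_ : A.card ≤ N) (x : E) (_ : S.nrm x ≤ 1), S.nrm (S.proj A x)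

/-- The quasi-greedy constants `g_N = sup_{n ≤ N} ‖G_n‖`. -/
noncomputable def quasiGreedyConst (S : BiorthSystem 𝕜 E) (N : ℕ) : ℝ≥0∞ :=
  ⨆ (n : ℕ) (_ : n ≤ N) (x : E) (_ : S.nrm x ≤ 1) (A : Finset ℕ) (_ : S.IsGreedySet x n A),
    S.nrm (S.proj A x)

/-- The signed indicator `1_{εA} = ∑_{n ∈ A} ε_n e_n`. -/
noncomputable def ind (S : BiorthSystem 𝕜 E) (ε : ℕ → 𝕜) (A : Finset ℕ) : E :=
  ∑ n ∈ A, ε n • S.vec n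

/-- The upper superdemocracy sequence `D(N)`. -/
noncomputable def upperDem (S : BiorthSystem 𝕜 E) (N : ℕ) : ℝ≥0∞ :=
  ⨆ (A : Finset ℕ) (_ : A.card = N) (ε : ℕ → 𝕜) (_ : ∀ n, ‖ε n‖ = 1), S.nrm (S.ind ε A)

/-- The lower superdemocracy sequence `d(N)`. -/
noncomputable def lowerDem (S : BiorthSystem 𝕜 E) (N : ℕ) : ℝ≥0∞ :=
  ⨅ (A : Finset ℕ) (_ : A.card = N) (ε : ℕ → 𝕜) (_ : ∀ n, ‖ε n‖ = 1), S.nrm (S.ind ε A)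

/-- The superdemocracy parameters `μ_N = sup_{1 ≤ n ≤ N} D(n) / d(n)`. -/
noncomputable def superdemConst (S : BiorthSystem 𝕜 E) (N : ℕ) : ℝ≥0∞ :=
  ⨆ (n : ℕ) (_ : 1 ≤ n) (_ : n ≤ N), S.upperDem n / S.lowerDem n

/-- The system is quasi-greedy: the greedy operators are uniformly bounded. -/
def IsQuasiGreedy (S : BiorthSystem 𝕜 E) : Prop :=
  ∃ C : ℝ≥0, ∀ N : ℕ, S.quasiGreedyConst N ≤ C

/-- The system is superdemocratic: `sup_N D(N) / d(N) < ∞`. -/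
def IsSuperdemocratic (S : BiorthSystem 𝕜 E) : Prop :=
  ∃ C : ℝ≥0, ∀ N : ℕ, S.superdemConst N ≤ C

/-- The system is bidemocratic: `D(N) D^*(N) ≤ c N`. -/
def IsBidemocratic (S : BiorthSystem 𝕜 E) : Prop :=
  ∃ C : ℝ≥0, ∀ N : ℕ, 1 ≤ N → S.upperDem N * S.dual.upperDem N ≤ C * N

end BiorthSystem

/-- `Δη(j) = η(j) - η(j-1)` for `j ≥ 1`, with the convention `η(0) = 0`. -/
def weightDiff (η : ℕ → ℝ) (j : ℕ) : ℝ := if j = 1 then η 1 else η j - η (j - 1)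

/-- `T_N(η₁, η₂) = ∑_{j=1}^N (η₁(j) / j) Δη₂(j)`. -/
noncomputable def weightT (η₁ η₂ : ℕ → ℝ) (N : ℕ) : ℝ :=
  ∑ j ∈ Finset.Icc 1 N, η₁ j / j * weightDiff η₂ j

/-- `min {T_N(D, D^*), T_N(D^*, D)}`, for systems with finite `D` and `D^*`. -/
noncomputable def BiorthSystem.overT {𝕜 : Type*} [RCLike 𝕜] {E : Type*} [AddCommGroup E]
    [Module 𝕜 E] (S : BiorthSystem 𝕜 E) (N : ℕ) : ℝ :=
  min (weightT (fun n => (S.upperDem n).toReal) (fun n => (S.dual.upperDem n).toReal) N)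
    (weightT (fun n => (S.dual.upperDem n).toReal) (fun n => (S.upperDem n).toReal) N)

/-- `a_N ≈ b_N`: two-sided comparison up to positive finite constants, for all `N ≥ 1`. -/
def Comparable (a b : ℕ → ℝ≥0∞) : Prop :=
  ∃ c C : ℝ≥0, 0 < c ∧ ∀ N : ℕ, 1 ≤ N → c * b N ≤ a N ∧ a N ≤ C * b N

/-- `[ln (N+1)]^{1/r'}`, where `1/r' = 1 - 1/r`. -/
noncomputable def logRate (r : ℝ≥0∞) (N : ℕ) : ℝ≥0∞ :=
  ENNReal.ofReal (Real.log (N + 1) ^ (1 - (r⁻¹).toReal))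

/-! ## The spaces `KT(p, r)`

Sequences are indexed by `n = 0, 1, 2, …`, so that the usual index is `n + 1`. -/

section KT

variable {𝕜 : Type*} [RCLike 𝕜]

/-- The non-increasing rearrangement of `|x|`; `rearr x j` is usually written `x^*_{j+1}`. -/
noncomputable def rearr (x : ℕ → 𝕜) (j : ℕ) : ℝ≥0∞ :=
  sInf {t : ℝ≥0∞ | {n : ℕ | t < ‖x n‖ₑ}.encard ≤ j}

/-- The Lorentz quasi-norm of `ℓ^{p,r}`. -/
noncomputable def lorentzNrm (p : ℝ) (r : ℝ≥0∞) (x : ℕ → 𝕜) : ℝ≥0∞ :=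
  if r = ⊤ then ⨆ j : ℕ, ((j : ℝ≥0∞) + 1) ^ (1 / p) * rearr x j
  else (∑' j : ℕ, (((j : ℝ≥0∞) + 1) ^ (1 / p) * rearr x j) ^ r.toReal / ((j : ℝ≥0∞) + 1)) ^
    (1 / r.toReal)

/-- The norm `‖x‖_{b_p} = sup_N |∑_{n ≤ N} x_n / n^{1/p'}|`, where `1/p' = 1 - 1/p`. -/
noncomputable def bNrm (p : ℝ) (x : ℕ → 𝕜) : ℝ≥0∞ :=
  ⨆ N : ℕ, ‖∑ n ∈ Finset.range N, x n / ((((n : ℝ) + 1) ^ (1 - 1 / p) : ℝ) : 𝕜)‖ₑ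

/-- The quasi-norm of `KT(p, r)`. -/
noncomputable def ktNrm (p : ℝ) (r : ℝ≥0∞) (x : ℕ → 𝕜) : ℝ≥0∞ :=
  max (lorentzNrm p r x) (bNrm p x)

theorem rearr_add (x y : ℕ → 𝕜) (i j : ℕ) : rearr (x + y) (i + j) ≤ rearr x i + rearr y j := by
  unfold rearr
  rw [ENNReal.sInf_add]
  refine le_iInf₂ fun s hs => ?_
  rw [add_comm s, ENNReal.sInf_add]
  refine le_iInf₂ fun t ht => sInf_le ?_
  have hsub : {n : ℕ | t + s < ‖(x + y) n‖ₑ} ⊆ {n | s < ‖x n‖ₑ} ∪ {n | t < ‖y n‖ₑ} := by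
    intro n hn
    by_contra hc
    simp only [Set.mem_union, Set.mem_ofPred_eq, not_or, not_lt] at hc hn
    have h2 : ‖(x + y) n‖ₑ ≤ t + s :=
      (enorm_add_le _ _).trans (by rw [add_comm t]; exact add_le_add hc.1 hc.2)
    exact absurd hn (not_lt.2 h2)
  refine (Set.encard_le_encard hsub).trans ((Set.encard_union_le _ _).trans ?_)
  push_cast
  exact add_le_add hs ht

theorem rearr_anti (x : ℕ → 𝕜) {i j : ℕ} (h : i ≤ j) : rearr x j ≤ rearr x i :=
  sInf_le_sInf fun t (ht : {n : ℕ | t < ‖x n‖ₑ}.encard ≤ i) =>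
    show {n : ℕ | t < ‖x n‖ₑ}.encard ≤ j from ht.trans (by exact_mod_cast h)

theorem rearr_smul_le (c : 𝕜) (x : ℕ → 𝕜) (j : ℕ) : rearr (c • x) j ≤ ‖c‖ₑ * rearr x j := by
  have htop : (⊤ : ℝ≥0∞) ∈ {t : ℝ≥0∞ | {n : ℕ | t < ‖x n‖ₑ}.encard ≤ j} := by simp
  have h : ∀ t ∈ {t : ℝ≥0∞ | {n : ℕ | t < ‖x n‖ₑ}.encard ≤ j}, rearr (c • x) j ≤ ‖c‖ₑ * t := by
    intro t ht
    refine sInf_le ((Set.encard_le_encard ?_).trans ht)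
    intro n hn
    by_contra hc
    simp only [Set.mem_ofPred_eq, not_lt, Pi.smul_apply, enorm_smul] at hn hc
    exact absurd hn (not_lt.2 (by gcongr))
  unfold rearr at h ⊢
  have : Nonempty {t : ℝ≥0∞ | {n : ℕ | t < ‖x n‖ₑ}.encard ≤ j} := ⟨⟨⊤, htop⟩⟩
  rw [sInf_eq_iInf' {t : ℝ≥0∞ | {n : ℕ | t < ‖x n‖ₑ}.encard ≤ j}, ENNReal.mul_iInf (by simp)]
  exact le_iInf fun t => h t t.2

theorem enorm_le_rearr_zero (x : ℕ → 𝕜) (n : ℕ) : ‖x n‖ₑ ≤ rearr x 0 := by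
  refine le_sInf fun t ht => ?_
  have h0 : {n : ℕ | t < ‖x n‖ₑ} = ∅ := by
    have h1 : {n : ℕ | t < ‖x n‖ₑ}.encard ≤ 0 := by simpa using ht
    simpa using h1
  by_contra hc
  have : n ∈ {n : ℕ | t < ‖x n‖ₑ} := not_le.1 hc
  simp [h0] at this

theorem one_le_toReal {r : ℝ≥0∞} (hr : 1 ≤ r) (h : r ≠ ⊤) : 1 ≤ r.toReal := by
  simpa using ENNReal.toReal_mono h hr

theorem enorm_le_lorentzNrm {p : ℝ} {r : ℝ≥0∞} (hr : 1 ≤ r) (x : ℕ → 𝕜) (n : ℕ) :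
    ‖x n‖ₑ ≤ lorentzNrm p r x := by
  refine (enorm_le_rearr_zero x n).trans ?_
  unfold lorentzNrm
  split_ifs with h
  · refine le_trans ?_ (le_iSup _ 0)
    simp
  · have hs := one_le_toReal hr h
    have h1 := ENNReal.le_tsum (f := fun j : ℕ =>
      (((j : ℝ≥0∞) + 1) ^ (1 / p) * rearr x j) ^ r.toReal / ((j : ℝ≥0∞) + 1)) 0
    simp only [Nat.cast_zero, zero_add, ENNReal.one_rpow, one_mul, div_one] at h1
    calc rearr x 0 = (rearr x 0 ^ r.toReal) ^ (1 / r.toReal) := by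
          rw [← ENNReal.rpow_mul, mul_one_div_cancel (by positivity), ENNReal.rpow_one]
      _ ≤ _ := ENNReal.rpow_le_rpow h1 (by positivity)

theorem lorentzNrm_smul_le {p : ℝ} {r : ℝ≥0∞} (hr : 1 ≤ r) (c : 𝕜) (x : ℕ → 𝕜) :
    lorentzNrm p r (c • x) ≤ ‖c‖ₑ * lorentzNrm p r x := by
  unfold lorentzNrm
  split_ifs with h
  · rw [ENNReal.mul_iSup]
    refine iSup_mono fun j => ?_
    calc _ ≤ ((j : ℝ≥0∞) + 1) ^ (1 / p) * (‖c‖ₑ * rearr x j) := by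
          gcongr; exact rearr_smul_le c x j
      _ = _ := by ring
  · have hs := one_le_toReal hr h
    set s := r.toReal
    have hs0 : 0 < s := by linarith
    calc _ ≤ (‖c‖ₑ ^ s * ∑' j : ℕ, (((j : ℝ≥0∞) + 1) ^ (1 / p) * rearr x j) ^ s /
            ((j : ℝ≥0∞) + 1)) ^ (1 / s) := by
          rw [← ENNReal.tsum_mul_left]
          refine ENNReal.rpow_le_rpow (ENNReal.tsum_le_tsum fun j => ?_) (by positivity)
          rw [← mul_div_assoc, ← ENNReal.mul_rpow_of_nonneg _ _ hs0.le]
          refine ENNReal.div_le_div_right (ENNReal.rpow_le_rpow ?_ hs0.le) _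
          calc _ ≤ ((j : ℝ≥0∞) + 1) ^ (1 / p) * (‖c‖ₑ * rearr x j) := by
                gcongr; exact rearr_smul_le c x j
            _ = _ := by ring
      _ = _ := by
          rw [ENNReal.mul_rpow_of_nonneg _ _ (by positivity), ← ENNReal.rpow_mul,
            mul_one_div_cancel hs0.ne', ENNReal.rpow_one]

theorem weight_rearr_add {p : ℝ} (hp : 1 ≤ p) (x y : ℕ → 𝕜) (i : ℕ) :
    ((i : ℝ≥0∞) + 1) ^ (1 / p) * rearr (x + y) i ≤
      2 * ((((i / 2 : ℕ) : ℝ≥0∞) + 1) ^ (1 / p) * rearr x (i / 2) +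
        (((i / 2 : ℕ) : ℝ≥0∞) + 1) ^ (1 / p) * rearr y (i / 2)) := by
  have hp0 : 0 ≤ 1 / p := by positivity
  have h1 : ((i : ℝ≥0∞) + 1) ^ (1 / p) ≤ 2 * (((i / 2 : ℕ) : ℝ≥0∞) + 1) ^ (1 / p) := by
    calc ((i : ℝ≥0∞) + 1) ^ (1 / p) ≤ (2 * (((i / 2 : ℕ) : ℝ≥0∞) + 1)) ^ (1 / p) := by
          refine ENNReal.rpow_le_rpow ?_ hp0
          have : i + 1 ≤ 2 * (i / 2 + 1) := by omega
          exact_mod_cast this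
      _ = 2 ^ (1 / p) * (((i / 2 : ℕ) : ℝ≥0∞) + 1) ^ (1 / p) :=
          ENNReal.mul_rpow_of_nonneg _ _ hp0
      _ ≤ 2 ^ (1 : ℝ) * (((i / 2 : ℕ) : ℝ≥0∞) + 1) ^ (1 / p) := by
          gcongr
          · norm_num
          · exact div_le_one_of_le₀ hp (by linarith)
      _ = _ := by rw [ENNReal.rpow_one]
  calc _ ≤ (2 * (((i / 2 : ℕ) : ℝ≥0∞) + 1) ^ (1 / p)) *
        (rearr x (i / 2) + rearr y (i / 2)) := by
        gcongr
        exact (rearr_anti _ (by omega)).trans (rearr_add x y (i / 2) (i / 2))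
    _ = _ := by ring

theorem tsum_half (G : ℕ → ℝ≥0∞) : ∑' i : ℕ, G (i / 2) = 2 * ∑' j, G j := by
  rw [← tsum_even_add_odd ENNReal.summable ENNReal.summable, two_mul]
  congr 1
  · exact tsum_congr fun k => by congr 1; omega
  · exact tsum_congr fun k => by congr 1; omega

theorem lorentzNrm_add {p : ℝ} {r : ℝ≥0∞} (hp : 1 ≤ p) (hr : 1 ≤ r) :
    ∃ C : ℝ≥0, ∀ x y : ℕ → 𝕜,
      lorentzNrm p r (x + y) ≤ C * (lorentzNrm p r x + lorentzNrm p r y) := by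
  by_cases h : r = ⊤
  · refine ⟨2, fun x y => ?_⟩
    simp only [lorentzNrm, h, if_true]
    refine iSup_le fun i => (weight_rearr_add hp x y i).trans ?_
    push_cast
    gcongr
    · exact le_iSup (fun j : ℕ => ((j : ℝ≥0∞) + 1) ^ (1 / p) * rearr x j) (i / 2)
    · exact le_iSup (fun j : ℕ => ((j : ℝ≥0∞) + 1) ^ (1 / p) * rearr y j) (i / 2)
  · have hs := one_le_toReal hr h
    simp only [lorentzNrm, h, if_false]
    set s := r.toReal
    have hs0 : 0 < s := by linarith
    set K : ℝ≥0∞ := 2 * (2 ^ s * 2 ^ (s - 1)) with hK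
    have hKt : K ^ (1 / s) ≠ ⊤ := by
      refine ENNReal.rpow_ne_top_of_nonneg (by positivity) ?_
      refine ENNReal.mul_ne_top (by simp) (ENNReal.mul_ne_top ?_ ?_)
      · exact ENNReal.rpow_ne_top_of_nonneg (by linarith) (by simp)
      · exact ENNReal.rpow_ne_top_of_nonneg (by linarith) (by simp)
    refine ⟨(K ^ (1 / s)).toNNReal, fun x y => ?_⟩
    rw [ENNReal.coe_toNNReal hKt]
    set F : (ℕ → 𝕜) → ℕ → ℝ≥0∞ := fun z j =>
      (((j : ℝ≥0∞) + 1) ^ (1 / p) * rearr z j) ^ s / ((j : ℝ≥0∞) + 1) with hF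
    have hpt : ∀ i, F (x + y) i ≤ (2 ^ s * 2 ^ (s - 1)) * (F x (i / 2) + F y (i / 2)) := by
      intro i
      simp only [hF]
      set a := (((i / 2 : ℕ) : ℝ≥0∞) + 1) ^ (1 / p) * rearr x (i / 2)
      set b := (((i / 2 : ℕ) : ℝ≥0∞) + 1) ^ (1 / p) * rearr y (i / 2)
      have hle : (((i / 2 : ℕ) : ℝ≥0∞) + 1) ≤ (i : ℝ≥0∞) + 1 := by
        have : i / 2 + 1 ≤ i + 1 := by omega
        exact_mod_cast this
      rw [← ENNReal.add_div, ← mul_div_assoc]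
      refine ENNReal.div_le_div ?_ hle
      calc _ ≤ (2 * (a + b)) ^ s := ENNReal.rpow_le_rpow (weight_rearr_add hp x y i) hs0.le
        _ = 2 ^ s * (a + b) ^ s := ENNReal.mul_rpow_of_nonneg _ _ hs0.le
        _ ≤ 2 ^ s * (2 ^ (s - 1) * (a ^ s + b ^ s)) := by
            gcongr
            exact ENNReal.rpow_add_le_mul_rpow_add_rpow a b hs
        _ = _ := by ring
    have hsum : ∑' i, F (x + y) i ≤ K * (∑' j, F x j + ∑' j, F y j) := by
      calc _ ≤ ∑' i : ℕ, (fun j => (2 ^ s * 2 ^ (s - 1)) * (F x j + F y j)) (i / 2) :=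
            ENNReal.tsum_le_tsum hpt
        _ = _ := by
            rw [tsum_half (fun j => (2 ^ s * 2 ^ (s - 1)) * (F x j + F y j)),
              ENNReal.tsum_mul_left, ENNReal.tsum_add, hK]
            ring
    calc _ ≤ (K * (∑' j, F x j + ∑' j, F y j)) ^ (1 / s) :=
          ENNReal.rpow_le_rpow hsum (by positivity)
      _ = K ^ (1 / s) * (∑' j, F x j + ∑' j, F y j) ^ (1 / s) :=
          ENNReal.mul_rpow_of_nonneg _ _ (by positivity)
      _ ≤ _ := by
          gcongr
          exact ENNReal.rpow_add_le_add_rpow _ _ (by positivity)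
            (div_le_one_of_le₀ hs (by linarith))

theorem bNrm_smul_le (p : ℝ) (c : 𝕜) (x : ℕ → 𝕜) : bNrm p (c • x) ≤ ‖c‖ₑ * bNrm p x := by
  unfold bNrm
  rw [ENNReal.mul_iSup]
  refine iSup_mono fun N => le_of_eq ?_
  rw [← enorm_mul, Finset.mul_sum]
  simp only [Pi.smul_apply, smul_eq_mul, mul_div_assoc]

theorem bNrm_add_le (p : ℝ) (x y : ℕ → 𝕜) : bNrm p (x + y) ≤ bNrm p x + bNrm p y := by
  refine iSup_le fun N => ?_
  simp only [Pi.add_apply, add_div, Finset.sum_add_distrib]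
  refine (enorm_add_le _ _).trans (add_le_add ?_ ?_)
  · exact le_iSup (fun N : ℕ =>
      ‖∑ n ∈ Finset.range N, x n / ((((n : ℝ) + 1) ^ (1 - 1 / p) : ℝ) : 𝕜)‖ₑ) N
  · exact le_iSup (fun N : ℕ =>
      ‖∑ n ∈ Finset.range N, y n / ((((n : ℝ) + 1) ^ (1 - 1 / p) : ℝ) : 𝕜)‖ₑ) N

theorem ktNrm_add {p : ℝ} {r : ℝ≥0∞} (hp : 1 ≤ p) (hr : 1 ≤ r) :
    ∃ C : ℝ≥0, ∀ x y : ℕ → 𝕜, ktNrm p r (x + y) ≤ C * (ktNrm p r x + ktNrm p r y) := by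
  obtain ⟨C, hC⟩ := lorentzNrm_add (𝕜 := 𝕜) hp hr
  refine ⟨max C 1, fun x y => max_le ((hC x y).trans ?_) ((bNrm_add_le p x y).trans ?_)⟩
  · gcongr
    · exact le_max_left _ _
    · exact le_max_left _ _
    · exact le_max_left _ _
  · calc bNrm p x + bNrm p y = ((1 : ℝ≥0) : ℝ≥0∞) * (bNrm p x + bNrm p y) := by simp
      _ ≤ _ := by
        gcongr
        · exact le_max_right _ _
        · exact le_max_right _ _
        · exact le_max_right _ _

theorem ktNrm_smul_le {p : ℝ} {r : ℝ≥0∞} (hr : 1 ≤ r) (c : 𝕜) (x : ℕ → 𝕜) :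
    ktNrm p r (c • x) ≤ ‖c‖ₑ * ktNrm p r x := by
  refine max_le ((lorentzNrm_smul_le hr c x).trans ?_) ((bNrm_smul_le p c x).trans ?_)
  · gcongr; exact le_max_left _ _
  · gcongr; exact le_max_right _ _

theorem ktNrm_smul {p : ℝ} {r : ℝ≥0∞} (hr : 1 ≤ r) (c : 𝕜) (x : ℕ → 𝕜) :
    ktNrm p r (c • x) = ‖c‖ₑ * ktNrm p r x := by
  refine le_antisymm (ktNrm_smul_le hr c x) ?_
  by_cases hc : c = 0
  · simp [hc]
  have h := ktNrm_smul_le (p := p) hr c⁻¹ (c • x)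
  rw [inv_smul_smul₀ hc, enorm_inv hc] at h
  have h0 : ‖c‖ₑ ≠ 0 := by simpa using hc
  calc ‖c‖ₑ * ktNrm p r x ≤ ‖c‖ₑ * (‖c‖ₑ⁻¹ * ktNrm p r (c • x)) := by gcongr
    _ = ktNrm p r (c • x) := by
      rw [← mul_assoc, ENNReal.mul_inv_cancel h0 (by finiteness), one_mul]

theorem rearr_single (n j : ℕ) : rearr (Pi.single n (1 : 𝕜)) j ≤ if j = 0 then 1 else 0 := by
  split_ifs with h
  · refine sInf_le ?_
    have : {m : ℕ | (1 : ℝ≥0∞) < ‖(Pi.single n (1 : 𝕜) : ℕ → 𝕜) m‖ₑ} = ∅ := by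
      ext m
      by_cases hm : m = n
      · subst hm; simp
      · simp [hm]
    simp [this]
  · refine sInf_le ?_
    have : {m : ℕ | (0 : ℝ≥0∞) < ‖(Pi.single n (1 : 𝕜) : ℕ → 𝕜) m‖ₑ} ⊆ {n} := by
      intro m hm
      by_contra hc
      have hc' : m ≠ n := hc
      simp [hc'] at hm
    refine (Set.encard_le_encard this).trans ?_
    rw [Set.encard_singleton]
    exact_mod_cast Nat.one_le_iff_ne_zero.2 h

theorem ktNrm_single_lt_top {p : ℝ} {r : ℝ≥0∞} (hr : 1 ≤ r) (n : ℕ) :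
    ktNrm p r (Pi.single n (1 : 𝕜)) < ⊤ := by
  have hw : ∀ j : ℕ, ((j : ℝ≥0∞) + 1) ^ (1 / p) * rearr (Pi.single n (1 : 𝕜)) j ≤
      if j = 0 then 1 else 0 := by
    intro j
    have h1 := rearr_single (𝕜 := 𝕜) n j
    by_cases hj : j = 0
    · subst hj; simpa using h1
    · simp only [hj, if_false, nonpos_iff_eq_zero] at h1 ⊢
      simp [h1]
  refine max_lt (lt_of_le_of_lt (b := 1) ?_ ENNReal.one_lt_top) ?_
  · unfold lorentzNrm
    split_ifs with h
    · refine iSup_le fun j => (hw j).trans ?_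
      split_ifs <;> simp
    · have hs := one_le_toReal hr h
      have hs0 : 0 < r.toReal := by linarith
      refine ENNReal.rpow_le_one ?_ (by positivity)
      rw [tsum_eq_single 0]
      · have h0 := hw 0
        simp only [if_true] at h0
        simpa using ENNReal.rpow_le_one h0 hs0.le
      · intro j hj
        have h1 := hw j
        simp only [hj, if_false, nonpos_iff_eq_zero] at h1
        rw [h1, ENNReal.zero_rpow_of_pos hs0, ENNReal.zero_div]
  · refine lt_of_le_of_lt (iSup_le fun N => ?_)
      (enorm_lt_top (x := (1 : 𝕜) / ((((n : ℝ) + 1) ^ (1 - 1 / p) : ℝ) : 𝕜)))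
    by_cases hN : n ∈ Finset.range N
    · rw [Finset.sum_eq_single_of_mem n hN]
      · simp
      · intro m _ hm
        simp [hm]
    · rw [Finset.sum_eq_zero]
      · simp
      · intro m hm
        have : m ≠ n := fun h => hN (h ▸ hm)
        simp [this]

/-- The space `KT(p, r)` of all null sequences with finite quasi-norm. -/
def KT (𝕜 : Type*) [RCLike 𝕜] (p : ℝ) (r : ℝ≥0∞) (hp : 1 ≤ p) (hr : 1 ≤ r) :
    Submodule 𝕜 (ℕ → 𝕜) where
  carrier := {x | Filter.Tendsto x Filter.atTop (𝓝 0) ∧ ktNrm p r x < ⊤}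
  zero_mem' := by
    refine ⟨tendsto_const_nhds, ?_⟩
    have h := ktNrm_smul (p := p) hr (0 : 𝕜) 0
    simp only [zero_smul, enorm_zero, zero_mul] at h
    simp [h]
  add_mem' := by
    rintro x y ⟨hx, hx'⟩ ⟨hy, hy'⟩
    refine ⟨by simpa [Pi.add_def] using hx.add hy, ?_⟩
    obtain ⟨C, hC⟩ := ktNrm_add (𝕜 := 𝕜) hp hr
    exact (hC x y).trans_lt (ENNReal.mul_lt_top (by simp) (ENNReal.add_lt_top.2 ⟨hx', hy'⟩))
  smul_mem' := by
    rintro c x ⟨hx, hx'⟩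
    refine ⟨by simpa [Pi.smul_def] using hx.const_smul c, ?_⟩
    rw [ktNrm_smul hr]
    exact ENNReal.mul_lt_top (by finiteness) hx'

/-- `KT(p, r)` with the canonical basis and its coordinate functionals. -/
noncomputable def ktSystem (𝕜 : Type*) [RCLike 𝕜] (p : ℝ) (r : ℝ≥0∞) (hp : 1 ≤ p) (hr : 1 ≤ r) :
    BiorthSystem 𝕜 (KT 𝕜 p r hp hr) where
  nrm x := ktNrm p r (x : ℕ → 𝕜)
  nrm_lt_top x := x.2.2
  eq_zero_of_nrm x hx := by
    refine Subtype.ext (funext fun n => ?_)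
    have h := (enorm_le_lorentzNrm (p := p) hr (x : ℕ → 𝕜) n).trans
      (le_max_left _ (bNrm p (x : ℕ → 𝕜)))
    have h2 : ‖(x : ℕ → 𝕜) n‖ₑ ≤ 0 := h.trans hx.le
    simpa using h2
  nrm_smul c x := ktNrm_smul hr c x
  nrm_add := by
    obtain ⟨C, hC⟩ := ktNrm_add (𝕜 := 𝕜) hp hr
    exact ⟨C, fun x y => hC x y⟩
  vec n := ⟨Pi.single n 1, by
    refine tendsto_const_nhds.congr' ?_
    filter_upwards [Filter.eventually_gt_atTop n] with m hm
    simp [hm.ne'], ktNrm_single_lt_top hr n⟩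
  coord n := (LinearMap.proj n).comp (KT 𝕜 p r hp hr).subtype
  coord_bdd n := ⟨1, fun x => by
    rw [ENNReal.coe_one, one_mul]
    exact (enorm_le_lorentzNrm (p := p) hr (x : ℕ → 𝕜) n).trans
      (le_max_left _ (bNrm p (x : ℕ → 𝕜)))⟩
  biorth n m := by
    simp [Pi.single_apply]

end KT

/-!
The proof works with an arbitrary system that is identified with the canonical basis by a linear
map into null sequences (`IsKTSystem`); this treats `KT(p, r)` and the closed linear span of its
basis at once. The rate is replaced by the comparable `(1 + 1/2 + ⋯ + 1/N)^{1/r'}` (`harmRate`).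

*Upper estimates.* By the Hardy–Littlewood rearrangement inequality
(`sum_enorm_mul_le_sum_rearr_mul`) and Hölder's inequality with harmonic weights
(`sum_rearr_mul_le`), a weighted partial sum over at most `N` indices is at most the rate times
the Lorentz quasi-norm. This bounds `K_N`, and by duality the norms of the projections of the dual
system. If `A` and `B` are sets of at most `N` indices and `B` is a greedy set of `x`, then the
part of `x` on `A \ B` is dominated by its part on `B \ A`. `HasDominationConst` measures the cost
of this replacement, and `lebesgue_le`, `lebesgueExp_le` reduce `L_N` to `K_{2N}`, and `L̃_N` to
the norms of the greedy operators, up to that cost. The cost is bounded for the system itself and,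
if `p > 1`, for the dual system as well; for `p = 1` it is at most a multiple of the rate in the
dual system. If `p > 1`, greedy operators are uniformly bounded: the partial sums of `P_A x`, for
a greedy set `A` of order `N`, are compared with those of `x` up to index `N`, and the rest is
controlled by the weak `ℓ^p` quasi-norm (`exists_nrm_proj_le`). By bidemocracy this passes to the
dual system (`exists_dual_nrm_proj_le`).

*Lower estimates.* The vector with coordinates `(-1)^n n^{-1/p}`, `n ≤ 2N`, has quasi-norm of
order at most `(ln N)^{1/r}` because its weighted partial sums cancel, while half of its terms
have a weighted sum of order `ln N`; that sum is a value of the functional `∑ n^{-1/p'} e_n^*`,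
which has norm at most `1`. A large number placed on any set makes that set greedy, so that this
pair bounds `K_N`, `L_N` and `L_N^*` from below. If `p = 1`, the functional has equal coordinates,
hence all subsets of its support are greedy, which bounds `L̃_N^*`, and a change of signs bounds
`D^*(N)`. For `g_N` and `L̃_N` with `p = 1` the positive terms have to be the large ones: this is
achieved by `dyadicSeq`, in which `2^q` terms `2^{-q}` are cancelled at once by `2^{K+q}` terms
`-2^{-(K+q)}`, for `q < K`. Finally `D(j) = j` for `p = 1`, so that one of the two sums in `T̄_N`
telescopes to `D^*(N)`.
-/

open scoped ENNReal NNReal Topology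

/-! ### Power sums and harmonic numbers -/

theorem sum_rpow_sub_one_le {s : ℝ} (hs : 0 < s) (k : ℕ) :
    ∑ j ∈ Finset.range k, ((j : ℝ) + 1) ^ (s - 1) ≤ max 1 s⁻¹ * (k : ℝ) ^ s := by
  rcases le_total 1 s with h1 | h1
  · rw [max_eq_left (inv_le_one_of_one_le₀ h1), one_mul]
    rcases Nat.eq_zero_or_pos k with rfl | hk
    · simp [Real.zero_rpow hs.ne']
    have hk' : (0 : ℝ) < k := by exact_mod_cast hk
    calc _ ≤ ∑ j ∈ Finset.range k, (k : ℝ) ^ (s - 1) := by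
          refine Finset.sum_le_sum fun j hj => Real.rpow_le_rpow (by positivity) ?_ (by linarith)
          exact_mod_cast Finset.mem_range.1 hj
      _ = k ^ s := by
          rw [Finset.sum_const, Finset.card_range, nsmul_eq_mul, Real.rpow_sub_one hk'.ne']
          field_simp
  · rw [max_eq_right (one_le_inv₀ hs |>.2 h1)]
    induction k with
    | zero => simp [Real.zero_rpow hs.ne']
    | succ k ih =>
      rw [Finset.sum_range_succ]
      have hk : (0 : ℝ) < (k : ℝ) + 1 := by positivity
      have hb := rpow_one_add_le_one_add_mul_self (s := -((k : ℝ) + 1)⁻¹)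
        (neg_le_neg (inv_le_one_of_one_le₀ (by linarith [(Nat.cast_nonneg k : (0 : ℝ) ≤ k)])))
        hs.le h1
      have he : (1 + -((k : ℝ) + 1)⁻¹) = k / (k + 1) := by field_simp; ring
      rw [he, Real.div_rpow (by positivity) hk.le, div_le_iff₀ (by positivity)] at hb
      have h2 : ((k : ℝ) + 1) ^ (s - 1) = ((k : ℝ) + 1) ^ s * ((k : ℝ) + 1)⁻¹ := by
        rw [Real.rpow_sub_one hk.ne', div_eq_mul_inv]
      have h3 : s⁻¹ * (k : ℝ) ^ s ≤ s⁻¹ * ((1 + s * -((k : ℝ) + 1)⁻¹) * ((k : ℝ) + 1) ^ s) := by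
        gcongr
      have h4 : s⁻¹ * ((1 + s * -((k : ℝ) + 1)⁻¹) * ((k : ℝ) + 1) ^ s) =
          s⁻¹ * ((k : ℝ) + 1) ^ s - ((k : ℝ) + 1) ^ s * ((k : ℝ) + 1)⁻¹ := by
        field_simp; ring
      push_cast
      linarith

theorem le_sum_rpow_sub_one {s : ℝ} (hs : 0 < s) (k : ℕ) :
    (k : ℝ) ^ s ≤ max 1 s * ∑ j ∈ Finset.range k, ((j : ℝ) + 1) ^ (s - 1) := by
  rcases le_total s 1 with h1 | h1
  · rw [max_eq_left h1, one_mul]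
    rcases Nat.eq_zero_or_pos k with rfl | hk
    · simp [Real.zero_rpow hs.ne']
    have hk' : (0 : ℝ) < k := by exact_mod_cast hk
    calc (k : ℝ) ^ s = ∑ j ∈ Finset.range k, (k : ℝ) ^ (s - 1) := by
          rw [Finset.sum_const, Finset.card_range, nsmul_eq_mul, Real.rpow_sub_one hk'.ne']
          field_simp
      _ ≤ _ := by
          refine Finset.sum_le_sum fun j hj =>
            Real.rpow_le_rpow_of_nonpos (by positivity) ?_ (by linarith)
          exact_mod_cast Finset.mem_range.1 hj
  · rw [max_eq_right h1]
    induction k with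
    | zero => simp [Real.zero_rpow hs.ne']
    | succ k ih =>
      rw [Finset.sum_range_succ]
      have hk : (0 : ℝ) < (k : ℝ) + 1 := by positivity
      have hb := one_add_mul_self_le_rpow_one_add (s := -((k : ℝ) + 1)⁻¹)
        (neg_le_neg (inv_le_one_of_one_le₀ (by linarith [(Nat.cast_nonneg k : (0 : ℝ) ≤ k)])))
        h1
      have he : (1 + -((k : ℝ) + 1)⁻¹) = k / (k + 1) := by field_simp; ring
      rw [he, Real.div_rpow (by positivity) hk.le, le_div_iff₀ (by positivity)] at hb
      have h2 : ((k : ℝ) + 1) ^ (s - 1) = ((k : ℝ) + 1) ^ s * ((k : ℝ) + 1)⁻¹ := by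
        rw [Real.rpow_sub_one hk.ne', div_eq_mul_inv]
      have h4 : (1 + s * -((k : ℝ) + 1)⁻¹) * ((k : ℝ) + 1) ^ s =
          ((k : ℝ) + 1) ^ s - s * (((k : ℝ) + 1) ^ s * ((k : ℝ) + 1)⁻¹) := by
        field_simp; ring
      push_cast
      rw [h2, mul_add]
      linarith

theorem ofReal_cast_add_one_rpow (j : ℕ) (a : ℝ) :
    ENNReal.ofReal (((j : ℝ) + 1) ^ a) = ((j : ℝ≥0∞) + 1) ^ a := by
  rw [← ENNReal.ofReal_rpow_of_pos (by positivity), ENNReal.ofReal_add (by positivity) zero_le_one,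
    ENNReal.ofReal_natCast, ENNReal.ofReal_one]

theorem cast_add_one_ne_top (j : ℕ) : (j : ℝ≥0∞) + 1 ≠ ⊤ := by finiteness

theorem cast_add_one_ne_zero (j : ℕ) : (j : ℝ≥0∞) + 1 ≠ 0 := by simp

theorem cast_add_one_rpow_add (j : ℕ) (a b : ℝ) :
    ((j : ℝ≥0∞) + 1) ^ (a + b) = ((j : ℝ≥0∞) + 1) ^ a * ((j : ℝ≥0∞) + 1) ^ b :=
  ENNReal.rpow_add _ _ (cast_add_one_ne_zero j) (cast_add_one_ne_top j)

theorem cast_add_one_rpow_ne_top (j : ℕ) (a : ℝ) : ((j : ℝ≥0∞) + 1) ^ a ≠ ⊤ := by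
  rw [← ofReal_cast_add_one_rpow]; exact ENNReal.ofReal_ne_top

theorem cast_add_one_rpow_ne_zero (j : ℕ) (a : ℝ) : ((j : ℝ≥0∞) + 1) ^ a ≠ 0 := by
  rw [← ofReal_cast_add_one_rpow, Ne, ENNReal.ofReal_eq_zero, not_le]; positivity

theorem ofReal_sum_rpow {s : ℝ} (k : ℕ) : ENNReal.ofReal
    (∑ j ∈ Finset.range k, ((j : ℝ) + 1) ^ s) = ∑ j ∈ Finset.range k, ((j : ℝ≥0∞) + 1) ^ s := by
  rw [ENNReal.ofReal_sum_of_nonneg fun j _ => by positivity]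
  exact Finset.sum_congr rfl fun j _ => ofReal_cast_add_one_rpow j s

theorem sum_rpow_le {s : ℝ} (hs : 0 < s) (k : ℕ) :
    ∑ j ∈ Finset.range k, ((j : ℝ≥0∞) + 1) ^ (s - 1) ≤
      ENNReal.ofReal (max 1 s⁻¹) * (k : ℝ≥0∞) ^ s := by
  rw [← ofReal_sum_rpow, ← ENNReal.ofReal_natCast, ENNReal.ofReal_rpow_of_nonneg (by positivity)
    hs.le, ← ENNReal.ofReal_mul (by positivity)]
  exact ENNReal.ofReal_le_ofReal (sum_rpow_sub_one_le hs k)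

theorem rpow_le_sum {s : ℝ} (hs : 0 < s) (k : ℕ) :
    (k : ℝ≥0∞) ^ s ≤ ENNReal.ofReal (max 1 s) *
      ∑ j ∈ Finset.range k, ((j : ℝ≥0∞) + 1) ^ (s - 1) := by
  rw [← ofReal_sum_rpow, ← ENNReal.ofReal_natCast, ENNReal.ofReal_rpow_of_nonneg (by positivity)
    hs.le, ← ENNReal.ofReal_mul (by positivity)]
  exact ENNReal.ofReal_le_ofReal (le_sum_rpow_sub_one hs k)

/-- The harmonic number `1 + 1/2 + ⋯ + 1/N` as an extended non-negative real. -/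
noncomputable def harm (N : ℕ) : ℝ≥0∞ := ∑ j ∈ Finset.range N, ((j : ℝ≥0∞) + 1)⁻¹

theorem harm_eq (N : ℕ) : harm N = ENNReal.ofReal (harmonic N : ℝ) := by
  unfold harm harmonic
  push_cast
  rw [ENNReal.ofReal_sum_of_nonneg fun j _ => by positivity]
  refine Finset.sum_congr rfl fun j _ => ?_
  rw [ENNReal.ofReal_inv_of_pos (by positivity), ENNReal.ofReal_add (by positivity) zero_le_one,
    ENNReal.ofReal_natCast, ENNReal.ofReal_one]

theorem harm_mono : Monotone harm := fun _ _ h =>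
  Finset.sum_le_sum_of_subset (Finset.range_mono h)

theorem harm_ne_top (N : ℕ) : harm N ≠ ⊤ := by rw [harm_eq]; exact ENNReal.ofReal_ne_top

theorem one_le_harm {N : ℕ} (hN : 1 ≤ N) : 1 ≤ harm N := by
  refine le_trans ?_ (harm_mono hN)
  simp [harm]

theorem harm_two_mul_le (N : ℕ) : harm (2 * N) ≤ 2 * harm N := by
  induction N with
  | zero => simp [harm]
  | succ N ih =>
    have e : 2 * (N + 1) = 2 * N + 1 + 1 := by ring
    unfold harm at ih ⊢
    rw [e, Finset.sum_range_succ, Finset.sum_range_succ, Finset.sum_range_succ _ N, add_assoc,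
      mul_add]
    have h1 : ((2 * N : ℕ) + 1 : ℝ≥0∞)⁻¹ + ((2 * N + 1 : ℕ) + 1 : ℝ≥0∞)⁻¹ ≤
        2 * ((N : ℝ≥0∞) + 1)⁻¹ := by
      rw [two_mul (_ : ℝ≥0∞)⁻¹]
      refine add_le_add ?_ ?_ <;> refine ENNReal.inv_le_inv.2 ?_ <;> norm_cast <;> omega
    exact add_le_add ih h1

theorem log_le_harm (N : ℕ) : ENNReal.ofReal (Real.log (N + 1)) ≤ harm N := by
  rw [harm_eq]
  refine ENNReal.ofReal_le_ofReal ?_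
  simpa using log_add_one_le_harmonic N

theorem harm_le_log {N : ℕ} (hN : 1 ≤ N) : harm N ≤ 3 * ENNReal.ofReal (Real.log (N + 1)) := by
  rw [harm_eq, show (3 : ℝ≥0∞) = ENNReal.ofReal 3 by simp, ← ENNReal.ofReal_mul (by norm_num)]
  refine ENNReal.ofReal_le_ofReal ((harmonic_le_one_add_log N).trans ?_)
  have hN' : (1 : ℝ) ≤ N := by exact_mod_cast hN
  have h1 : Real.log N ≤ Real.log (N + 1) := Real.log_le_log (by linarith) (by linarith)
  have h2 : Real.log 2 ≤ Real.log (N + 1) := Real.log_le_log (by norm_num) (by linarith)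
  linarith [Real.log_two_gt_d9]

theorem harm_two_pow_le (K : ℕ) : harm (2 ^ K) ≤ K + 1 := by
  induction K with
  | zero => simp [harm]
  | succ K ih =>
    have e : 2 ^ (K + 1) = 2 ^ K + 2 ^ K := by ring
    unfold harm at ih ⊢
    rw [e, Finset.sum_range_add]
    push_cast
    refine add_le_add ih ?_
    calc _ ≤ ∑ j ∈ Finset.range (2 ^ K), ((2 : ℝ≥0∞) ^ K)⁻¹ := by
          refine Finset.sum_le_sum fun j _ => ENNReal.inv_le_inv.2 ?_
          rw [add_assoc]; exact le_self_add
      _ = 1 := by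
          rw [Finset.sum_const, Finset.card_range, nsmul_eq_mul]
          push_cast
          exact ENNReal.mul_inv_cancel (by simp) (by finiteness)

/-! ### The non-increasing rearrangement -/

section Rearr

variable {𝕜 : Type*} [RCLike 𝕜]

theorem rearr_mono {x y : ℕ → 𝕜} (h : ∀ n, ‖x n‖ₑ ≤ ‖y n‖ₑ) (j : ℕ) : rearr x j ≤ rearr y j :=
  sInf_le_sInf fun t (ht : {n : ℕ | t < ‖y n‖ₑ}.encard ≤ j) =>
    show {n : ℕ | t < ‖x n‖ₑ}.encard ≤ j from
      (Set.encard_le_encard fun n (hn : t < ‖x n‖ₑ) => hn.trans_le (h n)).trans ht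

theorem le_rearr {x : ℕ → 𝕜} {B : Finset ℕ} {j : ℕ} (hB : j < B.card) {a : ℝ≥0∞}
    (ha : ∀ n ∈ B, a ≤ ‖x n‖ₑ) : a ≤ rearr x j := by
  refine le_sInf fun t (ht : {n : ℕ | t < ‖x n‖ₑ}.encard ≤ j) => ?_
  by_contra hc
  have hsub : (B : Set ℕ) ⊆ {n : ℕ | t < ‖x n‖ₑ} := fun n hn => (not_le.1 hc).trans_le (ha n hn)
  have h1 := (Set.encard_le_encard hsub).trans ht
  rw [Set.encard_coe_eq_coe_finsetCard] at h1
  exact absurd hB (not_lt.2 (by exact_mod_cast h1))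

theorem rearr_le_of_injOn {x : ℕ → 𝕜} {φ : ℕ → ℕ} {j : ℕ} {a : ℝ≥0∞}
    (hφ : Set.InjOn φ {n | x n ≠ 0}) (ha : ∀ n, x n ≠ 0 → j ≤ φ n → ‖x n‖ₑ ≤ a) :
    rearr x j ≤ a := by
  refine sInf_le ?_
  have hm : Set.MapsTo φ {n : ℕ | a < ‖x n‖ₑ} (Finset.range j : Set ℕ) := by
    intro n hn
    have h0 : x n ≠ 0 := fun h => by simp [h] at hn
    rw [Finset.coe_range, Set.mem_Iio]
    by_contra hc
    exact absurd (ha n h0 (not_lt.1 hc)) (not_le.2 hn)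
  have hsub : {n : ℕ | a < ‖x n‖ₑ} ⊆ {n | x n ≠ 0} :=
    fun n (hn : a < ‖x n‖ₑ) (h : x n = 0) => by simp [h] at hn
  have h1 := Set.encard_le_encard_of_injOn hm
    (hφ.mono hsub)
  rw [Set.encard_coe_eq_coe_finsetCard, Finset.card_range] at h1
  exact h1

theorem rearr_eq_zero_of_support {x : ℕ → 𝕜} {A : Finset ℕ} (hA : ∀ n ∉ A, x n = 0) {j : ℕ}
    (hj : A.card ≤ j) : rearr x j = 0 := by
  refine le_antisymm (sInf_le ?_) (zero_le)
  refine (Set.encard_le_encard (t := (A : Set ℕ)) fun n hn => ?_).trans ?_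
  · by_contra hc
    rw [Set.mem_ofPred_eq, hA n (by simpa using hc)] at hn
    simp at hn
  · rw [Set.encard_coe_eq_coe_finsetCard]
    exact_mod_cast hj

theorem rearr_le_of_forall {x : ℕ → 𝕜} {a : ℝ≥0∞} (ha : ∀ n, ‖x n‖ₑ ≤ a) (j : ℕ) :
    rearr x j ≤ a := by
  refine sInf_le ?_
  have : {n : ℕ | a < ‖x n‖ₑ} = ∅ := by
    ext n; simp [ha n]
  simp [this]

theorem sum_enorm_le_sum_rearr (x : ℕ → 𝕜) (A : Finset ℕ) :
    ∑ n ∈ A, ‖x n‖ₑ ≤ ∑ j ∈ Finset.range A.card, rearr x j := by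
  induction hk : A.card generalizing A with
  | zero => simp [Finset.card_eq_zero.1 hk]
  | succ k ih =>
    obtain ⟨m, hm, hmin⟩ := A.exists_min_image (fun n => ‖x n‖ₑ)
      (Finset.card_pos.1 (by omega))
    rw [← Finset.sum_erase_add _ _ hm, Finset.sum_range_succ]
    exact add_le_add (ih _ (by rw [Finset.card_erase_of_mem hm, hk]; rfl))
      (le_rearr (B := A) (by omega) hmin)

/-- The Hardy–Littlewood rearrangement inequality. The weight is reduced to the constant
case by subtracting its last value, which is a summation by parts. -/
theorem sum_enorm_mul_le_sum_rearr_mul (x : ℕ → 𝕜) (A : Finset ℕ) {v : ℕ → ℝ≥0∞}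
    (hv : Antitone v) :
    ∑ n ∈ A, ‖x n‖ₑ * v n ≤ ∑ j ∈ Finset.range A.card, rearr x j * v j := by
  have key : ∀ (M : ℕ) (v : ℕ → ℝ≥0∞), Antitone v → (∀ n, M ≤ n → v n = 0) →
      ∑ n ∈ A, ‖x n‖ₑ * v n ≤ ∑ j ∈ Finset.range A.card, rearr x j * v j := by
    intro M
    induction M with
    | zero => intro v _ h0; simp [h0]
    | succ M ih =>
      intro v hv h0
      have h1 := ih (fun n => v n - v M) (fun a b h => tsub_le_tsub_right (hv h) _)
        (fun n hn => tsub_eq_zero_of_le (hv hn))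
      -- the truncated constant `c n = v M` for `n ≤ M`, `0` beyond
      have e : ∀ n, v n = (v n - v M) + if n ≤ M then v M else 0 := by
        intro n
        split_ifs with h
        · exact (tsub_add_cancel_of_le (hv h)).symm
        · rw [h0 n (by omega)]; simp
      have h2 : ∑ n ∈ A, ‖x n‖ₑ * (if n ≤ M then v M else 0) ≤
          ∑ j ∈ Finset.range A.card, rearr x j * (if j ≤ M then v M else 0) := by
        simp only [mul_ite, mul_zero, ← Finset.sum_filter, ← Finset.sum_mul]
        gcongr
        refine (sum_enorm_le_sum_rearr x _).trans (Finset.sum_le_sum_of_subset fun j hj => ?_)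
        have hc1 : (A.filter (· ≤ M)).card ≤ A.card := Finset.card_filter_le _ _
        have hc2 : (A.filter (· ≤ M)).card ≤ M + 1 := by
          rw [← Finset.card_range (M + 1)]
          refine Finset.card_le_card fun n hn => ?_
          have := (Finset.mem_filter.1 hn).2
          simp; omega
        simp only [Finset.mem_range, Finset.mem_filter] at hj ⊢
        omega
      calc ∑ n ∈ A, ‖x n‖ₑ * v n = ∑ n ∈ A, ‖x n‖ₑ * (v n - v M) +
            ∑ n ∈ A, ‖x n‖ₑ * (if n ≤ M then v M else 0) := by
            rw [← Finset.sum_add_distrib]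
            refine Finset.sum_congr rfl fun n _ => ?_
            rw [← mul_add, ← e n]
        _ ≤ _ := add_le_add h1 h2
        _ = _ := by
            rw [← Finset.sum_add_distrib]
            refine Finset.sum_congr rfl fun n _ => ?_
            rw [← mul_add, ← e n]
  -- cut the weight off beyond `A`
  obtain ⟨M, hM⟩ : ∃ M, A ⊆ Finset.range M := Finset.exists_nat_subset_range A
  have hAM : A.card ≤ M := by simpa using Finset.card_le_card hM
  have h := key M (fun n => if n < M then v n else 0) (fun a b hab => by
    dsimp only
    split_ifs with h1 h2
    · exact hv hab
    · omega
    · exact zero_le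
    · exact le_rfl) (fun n hn => if_neg (by omega))
  refine le_trans (le_of_eq ?_) (h.trans (le_of_eq ?_))
  · exact Finset.sum_congr rfl fun n hn => by rw [if_pos (Finset.mem_range.1 (hM hn))]
  · exact Finset.sum_congr rfl fun n hn => by
      rw [if_pos ((Finset.mem_range.1 hn).trans_le hAM)]

/-! ### The Lorentz quasi-norm -/

theorem lorentzNrm_mono {p : ℝ} {r : ℝ≥0∞} {x y : ℕ → 𝕜} (h : ∀ n, ‖x n‖ₑ ≤ ‖y n‖ₑ) :
    lorentzNrm p r x ≤ lorentzNrm p r y := by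
  unfold lorentzNrm
  split_ifs
  · exact iSup_mono fun j => mul_le_mul_right (rearr_mono h j) _
  · refine ENNReal.rpow_le_rpow (ENNReal.tsum_le_tsum fun j => ?_) (by positivity)
    exact ENNReal.div_le_div_right (ENNReal.rpow_le_rpow
      (mul_le_mul_right (rearr_mono h j) _) (by positivity)) _

theorem lorentz_term {θ s : ℝ} (hs : 0 ≤ s) (j : ℕ) (a : ℝ≥0∞) :
    (((j : ℝ≥0∞) + 1) ^ θ * a) ^ s / ((j : ℝ≥0∞) + 1) =
      a ^ s * ((j : ℝ≥0∞) + 1) ^ (θ * s - 1) := by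
  rw [ENNReal.mul_rpow_of_nonneg _ _ hs, ← ENNReal.rpow_mul, sub_eq_add_neg,
    cast_add_one_rpow_add, ENNReal.rpow_neg_one, div_eq_mul_inv]
  ring

/-- `ℓ^{p,r}` embeds into `ℓ^{p,∞}`. -/
theorem exists_rearr_le_lorentzNrm {p : ℝ} {r : ℝ≥0∞} (hp : 1 ≤ p) (hr : 1 ≤ r) :
    ∃ C : ℝ≥0, ∀ (x : ℕ → 𝕜) (j : ℕ),
      ((j : ℝ≥0∞) + 1) ^ (1 / p) * rearr x j ≤ C * lorentzNrm p r x := by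
  by_cases h : r = ⊤
  · refine ⟨1, fun x j => ?_⟩
    simp only [lorentzNrm, h, if_true, ENNReal.coe_one, one_mul]
    exact le_iSup (fun j : ℕ => ((j : ℝ≥0∞) + 1) ^ (1 / p) * rearr x j) j
  have hs := one_le_toReal hr h
  set s := r.toReal with hs_def
  have hs0 : 0 < s := by linarith
  have hσ : 0 < 1 / p * s := by positivity
  have hK : ENNReal.ofReal (max 1 (1 / p * s)) ^ (1 / s) ≠ ⊤ :=
    ENNReal.rpow_ne_top_of_nonneg (by positivity) ENNReal.ofReal_ne_top
  refine ⟨(ENNReal.ofReal (max 1 (1 / p * s)) ^ (1 / s)).toNNReal, fun x j => ?_⟩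
  rw [ENNReal.coe_toNNReal hK]
  simp only [lorentzNrm, h, if_false]
  rw [← ENNReal.mul_rpow_of_nonneg _ _ (by positivity), one_div s, ENNReal.le_rpow_inv_iff hs0,
    ENNReal.mul_rpow_of_nonneg _ _ hs0.le, ← ENNReal.rpow_mul]
  calc _ ≤ (ENNReal.ofReal (max 1 (1 / p * s)) *
        ∑ i ∈ Finset.range (j + 1), ((i : ℝ≥0∞) + 1) ^ (1 / p * s - 1)) * rearr x j ^ s := by
        gcongr
        simpa using rpow_le_sum hσ (j + 1)
    _ = ENNReal.ofReal (max 1 (1 / p * s)) *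
        ∑ i ∈ Finset.range (j + 1), rearr x j ^ s * ((i : ℝ≥0∞) + 1) ^ (1 / p * s - 1) := by
        rw [mul_assoc, mul_comm _ (rearr x j ^ s), Finset.mul_sum]
    _ ≤ ENNReal.ofReal (max 1 (1 / p * s)) *
        ∑ i ∈ Finset.range (j + 1),
          (((i : ℝ≥0∞) + 1) ^ (1 / p) * rearr x i) ^ s / ((i : ℝ≥0∞) + 1) := by
        refine mul_le_mul_right (Finset.sum_le_sum fun i hi => ?_) _
        rw [lorentz_term hs0.le]
        gcongr
        exact rearr_anti x (by simp at hi; omega)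
    _ ≤ _ := mul_le_mul_right (ENNReal.sum_le_tsum _) _

/-- Hölder's inequality between `ℓ^{p,r}` and the harmonic weights. -/
theorem sum_rearr_mul_le {p : ℝ} {r : ℝ≥0∞} (hr : 1 ≤ r) (x : ℕ → 𝕜) (N : ℕ) :
    ∑ j ∈ Finset.range N, rearr x j * ((j : ℝ≥0∞) + 1) ^ (1 / p - 1) ≤
      harm N ^ (1 - (r⁻¹).toReal) * lorentzNrm p r x := by
  have e : ∀ j : ℕ, rearr x j * ((j : ℝ≥0∞) + 1) ^ (1 / p - 1) =
      ((j : ℝ≥0∞) + 1)⁻¹ * (((j : ℝ≥0∞) + 1) ^ (1 / p) * rearr x j) := by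
    intro j
    rw [sub_eq_add_neg, cast_add_one_rpow_add, ENNReal.rpow_neg_one]
    ring
  simp only [e]
  by_cases h : r = ⊤
  · subst h
    simp only [lorentzNrm, if_true, ENNReal.inv_top, ENNReal.toReal_zero, sub_zero,
      ENNReal.rpow_one, harm, Finset.sum_mul]
    refine Finset.sum_le_sum fun j _ => mul_le_mul_right ?_ _
    exact le_iSup (fun j : ℕ => ((j : ℝ≥0∞) + 1) ^ (1 / p) * rearr x j) j
  have hs := one_le_toReal hr h
  simp only [lorentzNrm, h, if_false, ENNReal.toReal_inv]
  set s := r.toReal with hs_def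
  refine (ENNReal.inner_le_weight_mul_Lp_of_nonneg _ hs _ _).trans ?_
  rw [one_div s]
  refine mul_le_mul_right (ENNReal.rpow_le_rpow ?_ (by positivity)) _
  refine le_trans (le_of_eq (Finset.sum_congr rfl fun j _ => ?_))
    (ENNReal.sum_le_tsum (Finset.range N))
  rw [mul_comm, ← div_eq_mul_inv]

theorem toReal_inv_nonneg_le_one {r : ℝ≥0∞} (hr : 1 ≤ r) :
    0 ≤ (r⁻¹).toReal ∧ (r⁻¹).toReal ≤ 1 :=
  ⟨ENNReal.toReal_nonneg, by
    simpa using ENNReal.toReal_mono ENNReal.one_ne_top (ENNReal.inv_le_one.2 hr)⟩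

/-- A sequence whose entries are bounded, after relabelling, by those of `a * n ^ (-1 / p)` for
`n ≤ M`. -/
theorem lorentzNrm_le_of_injOn {p : ℝ} {r : ℝ≥0∞} (hr : 1 ≤ r) {x : ℕ → 𝕜} {φ : ℕ → ℕ}
    {M : ℕ} {a : ℝ≥0∞} (hφ : Set.InjOn φ {n | x n ≠ 0}) (hM : ∀ n, x n ≠ 0 → φ n < M)
    (ha : ∀ n, x n ≠ 0 → ((φ n : ℝ≥0∞) + 1) ^ (1 / p) * ‖x n‖ₑ ≤ a) (hp : 1 ≤ p) :
    lorentzNrm p r x ≤ a * harm M ^ (r⁻¹).toReal := by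
  have h1 : ∀ j : ℕ, ((j : ℝ≥0∞) + 1) ^ (1 / p) * rearr x j ≤ a := by
    intro j
    rw [mul_comm, ← ENNReal.le_div_iff_mul_le (Or.inl (cast_add_one_rpow_ne_zero j _))
      (Or.inl (cast_add_one_rpow_ne_top j _))]
    refine rearr_le_of_injOn hφ fun n hn hj => ?_
    rw [ENNReal.le_div_iff_mul_le (Or.inl (cast_add_one_rpow_ne_zero j _))
      (Or.inl (cast_add_one_rpow_ne_top j _)), mul_comm]
    refine le_trans ?_ (ha n hn)
    gcongr
  have h2 : ∀ j, M ≤ j → rearr x j = 0 := by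
    intro j hj
    refine le_antisymm (rearr_le_of_injOn hφ fun n hn hj' => ?_) (zero_le)
    have := hM n hn
    omega
  unfold lorentzNrm
  split_ifs with h
  · subst h
    simpa using h1
  have hs := one_le_toReal hr h
  rw [ENNReal.toReal_inv]
  set s := r.toReal with hs_def
  have hs0 : 0 < s := by linarith
  rw [tsum_eq_sum (s := Finset.range M) fun j hj => by
    rw [h2 j (by simpa using hj)]; simp [hs0]]
  calc _ ≤ (∑ j ∈ Finset.range M, a ^ s * ((j : ℝ≥0∞) + 1)⁻¹) ^ (1 / s) := by
        gcongr with j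
        rw [div_eq_mul_inv]
        gcongr
        exact h1 j
    _ = _ := by
        rw [← Finset.mul_sum, ENNReal.mul_rpow_of_nonneg _ _ (by positivity), ← ENNReal.rpow_mul,
          mul_one_div_cancel hs0.ne', ENNReal.rpow_one, one_div, harm]

/-- The constant in the estimate `‖x‖_{p,r} ≤ C a k^{1/p}` for `x` supported on `k` indices and
bounded by `a`; it is `1` if `p = 1`. -/
noncomputable def flatConst (p : ℝ) (r : ℝ≥0∞) : ℝ≥0∞ :=
  if r = ⊤ then 1 else ENNReal.ofReal (max 1 (1 / p * r.toReal)⁻¹) ^ (1 / r.toReal)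

theorem flatConst_ne_top (p : ℝ) (r : ℝ≥0∞) : flatConst p r ≠ ⊤ := by
  unfold flatConst
  split_ifs
  · simp
  · exact ENNReal.rpow_ne_top_of_nonneg (by positivity) ENNReal.ofReal_ne_top

theorem flatConst_one {r : ℝ≥0∞} (hr : 1 ≤ r) : flatConst 1 r = 1 := by
  unfold flatConst
  split_ifs with h
  · rfl
  · have hs := one_le_toReal hr h
    rw [max_eq_left]
    · simp
    · simpa using inv_le_one_of_one_le₀ hs

theorem lorentzNrm_le_of_support {p : ℝ} {r : ℝ≥0∞} (hp : 1 ≤ p) (hr : 1 ≤ r) {x : ℕ → 𝕜}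
    {A : Finset ℕ} (hA : ∀ n ∉ A, x n = 0) {a : ℝ≥0∞} (ha : ∀ n, ‖x n‖ₑ ≤ a) :
    lorentzNrm p r x ≤ flatConst p r * (a * (A.card : ℝ≥0∞) ^ (1 / p)) := by
  have h1 := rearr_le_of_forall ha
  have h2 : ∀ j, A.card ≤ j → rearr x j = 0 := fun j hj => rearr_eq_zero_of_support hA hj
  unfold lorentzNrm flatConst
  split_ifs with h
  · rw [one_mul]
    refine iSup_le fun j => ?_
    rcases lt_or_ge j A.card with hj | hj
    · rw [mul_comm]
      gcongr
      · exact h1 j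
      · exact_mod_cast hj
    · simp [h2 j hj]
  have hs := one_le_toReal hr h
  set s := r.toReal with hs_def
  have hs0 : 0 < s := by linarith
  have hσ : 0 < 1 / p * s := by positivity
  rw [tsum_eq_sum (s := Finset.range A.card) fun j hj => by
    rw [h2 j (by simpa using hj)]; simp [hs0]]
  calc _ ≤ (a ^ s * (ENNReal.ofReal (max 1 (1 / p * s)⁻¹) *
        (A.card : ℝ≥0∞) ^ (1 / p * s))) ^ (1 / s) := by
        refine ENNReal.rpow_le_rpow ?_ (by positivity)
        refine le_trans ?_ (mul_le_mul_right (sum_rpow_le hσ _) _)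
        rw [Finset.mul_sum]
        refine Finset.sum_le_sum fun j _ => ?_
        rw [lorentz_term hs0.le]
        gcongr
        exact h1 j
    _ = _ := by
        rw [ENNReal.mul_rpow_of_nonneg _ _ (by positivity),
          ENNReal.mul_rpow_of_nonneg _ _ (by positivity), ← ENNReal.rpow_mul, ← ENNReal.rpow_mul,
          mul_one_div_cancel hs0.ne', ENNReal.rpow_one, mul_assoc, mul_one_div_cancel hs0.ne',
          mul_one]
        ring

/-! ### The norm of weighted partial sums -/

theorem enorm_div_weight (p : ℝ) (a : 𝕜) (n : ℕ) :
    ‖a / ((((n : ℝ) + 1) ^ (1 - 1 / p) : ℝ) : 𝕜)‖ₑ = ‖a‖ₑ * ((n : ℝ≥0∞) + 1) ^ (1 / p - 1) := by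
  have h : (0 : ℝ) < ((n : ℝ) + 1) ^ (1 - 1 / p) := by positivity
  rw [div_eq_mul_inv, enorm_mul, ← neg_sub 1 (1 / p), ← ofReal_cast_add_one_rpow,
    ← ofReal_norm (_)⁻¹, norm_inv, RCLike.norm_ofReal, abs_of_pos h, Real.rpow_neg (by positivity)]

theorem bNrm_le_of_forall {p : ℝ} {x : ℕ → 𝕜} {c : ℝ≥0∞}
    (h : ∀ M, ∑ n ∈ Finset.range M, ‖x n‖ₑ * ((n : ℝ≥0∞) + 1) ^ (1 / p - 1) ≤ c) :
    bNrm p x ≤ c := by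
  refine iSup_le fun M => le_trans ((enorm_sum_le _ _).trans (le_of_eq ?_)) (h M)
  exact Finset.sum_congr rfl fun n _ => enorm_div_weight p _ n

theorem weight_antitone {p : ℝ} (hp : 1 ≤ p) :
    Antitone fun n : ℕ => ((n : ℝ≥0∞) + 1) ^ (1 / p - 1) := by
  intro m n h
  have h1 : 0 ≤ 1 - 1 / p := by rw [sub_nonneg]; exact div_le_one_of_le₀ hp (by linarith)
  simp only [← neg_sub 1 (1 / p), ENNReal.rpow_neg]
  gcongr

theorem bNrm_le_sum_rearr {p : ℝ} (hp : 1 ≤ p) {x : ℕ → 𝕜} {A : Finset ℕ}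
    (hA : ∀ n ∉ A, x n = 0) :
    bNrm p x ≤ ∑ j ∈ Finset.range A.card, rearr x j * ((j : ℝ≥0∞) + 1) ^ (1 / p - 1) := by
  refine bNrm_le_of_forall fun M => le_trans ?_
    (sum_enorm_mul_le_sum_rearr_mul x A (weight_antitone hp))
  refine Finset.sum_le_sum_of_ne_zero fun n _ hn => ?_
  by_contra hc
  simp [hA n hc] at hn

theorem bNrm_le_of_support {p : ℝ} (hp : 1 ≤ p) {x : ℕ → 𝕜}
    {A : Finset ℕ} (hA : ∀ n ∉ A, x n = 0) {a : ℝ≥0∞} (ha : ∀ n, ‖x n‖ₑ ≤ a) :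
    bNrm p x ≤ ENNReal.ofReal p * (a * (A.card : ℝ≥0∞) ^ (1 / p)) := by
  refine (bNrm_le_sum_rearr hp hA).trans ?_
  calc _ ≤ a * ∑ j ∈ Finset.range A.card, ((j : ℝ≥0∞) + 1) ^ (1 / p - 1) := by
        rw [Finset.mul_sum]
        gcongr
        exact rearr_le_of_forall ha _
    _ ≤ a * (ENNReal.ofReal (max 1 (1 / p)⁻¹) * (A.card : ℝ≥0∞) ^ (1 / p)) := by
        gcongr
        exact sum_rpow_le (by positivity) _
    _ = _ := by
        rw [one_div, inv_inv, max_eq_right hp]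
        ring

theorem ktNrm_le_of_support {p : ℝ} {r : ℝ≥0∞} (hp : 1 ≤ p) (hr : 1 ≤ r) {x : ℕ → 𝕜}
    {A : Finset ℕ} (hA : ∀ n ∉ A, x n = 0) {a : ℝ≥0∞} (ha : ∀ n, ‖x n‖ₑ ≤ a) :
    ktNrm p r x ≤ max (flatConst p r) (ENNReal.ofReal p) * (a * (A.card : ℝ≥0∞) ^ (1 / p)) :=
  max_le ((lorentzNrm_le_of_support hp hr hA ha).trans (mul_le_mul_left (le_max_left _ _) _))
    ((bNrm_le_of_support hp hA ha).trans (mul_le_mul_left (le_max_right _ _) _))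

end Rearr

/-! ### Lebesgue-type constants of a biorthogonal system -/

namespace BiorthSystem

variable {𝕜 : Type*} [RCLike 𝕜] {E : Type*} [AddCommGroup E] [Module 𝕜 E]

theorem nrm_zero (S : BiorthSystem 𝕜 E) : S.nrm 0 = 0 := by
  have h := S.nrm_smul 0 0
  simpa using h

theorem nrm_neg (S : BiorthSystem 𝕜 E) (x : E) : S.nrm (-x) = S.nrm x := by
  have h := S.nrm_smul (-1) x
  simpa using h

theorem exists_one_le_nrm_add (S : BiorthSystem 𝕜 E) :
    ∃ C : ℝ≥0, 1 ≤ C ∧ ∀ x y, S.nrm (x + y) ≤ C * (S.nrm x + S.nrm y) := by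
  obtain ⟨C, hC⟩ := S.nrm_add
  refine ⟨max 1 C, le_max_left _ _, fun x y => (hC x y).trans ?_⟩
  gcongr
  exact le_max_right _ _

theorem coord_sum (S : BiorthSystem 𝕜 E) (A : Finset ℕ) (c : ℕ → 𝕜) (m : ℕ) :
    S.coord m (∑ n ∈ A, c n • S.vec n) = if m ∈ A then c m else 0 := by
  simp [map_sum, S.biorth]

theorem coord_proj (S : BiorthSystem 𝕜 E) (A : Finset ℕ) (x : E) (m : ℕ) :
    S.coord m (S.proj A x) = if m ∈ A then S.coord m x else 0 :=
  S.coord_sum A (fun n => S.coord n x) m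

theorem proj_add (S : BiorthSystem 𝕜 E) (A : Finset ℕ) (x y : E) :
    S.proj A (x + y) = S.proj A x + S.proj A y := by
  simp [proj, add_smul, Finset.sum_add_distrib]

theorem proj_smul (S : BiorthSystem 𝕜 E) (A : Finset ℕ) (c : 𝕜) (x : E) :
    S.proj A (c • x) = c • S.proj A x := by
  simp [proj, Finset.smul_sum, mul_smul]

theorem proj_sub (S : BiorthSystem 𝕜 E) (A : Finset ℕ) (x y : E) :
    S.proj A (x - y) = S.proj A x - S.proj A y := by
  simp [proj, sub_smul, Finset.sum_sub_distrib]

theorem proj_congr (S : BiorthSystem 𝕜 E) {A B : Finset ℕ} {x y : E} (hAB : A ⊆ B)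
    (h : ∀ n ∈ A, S.coord n x = S.coord n y) (h0 : ∀ n ∈ B, n ∉ A → S.coord n y = 0) :
    S.proj A x = S.proj B y := by
  unfold proj
  rw [← Finset.sum_subset hAB (fun n hB hA => by rw [h0 n hB hA, zero_smul])]
  exact Finset.sum_congr rfl fun n hn => by rw [h n hn]

theorem proj_sum_of_subset (S : BiorthSystem 𝕜 E) {A B : Finset ℕ} (hAB : A ⊆ B) (c : ℕ → 𝕜) :
    S.proj B (∑ n ∈ A, c n • S.vec n) = ∑ n ∈ A, c n • S.vec n := by
  unfold proj
  rw [← Finset.sum_subset hAB fun n _ hA => by rw [coord_sum, if_neg hA, zero_smul]]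
  exact Finset.sum_congr rfl fun n hn => by rw [coord_sum, if_pos hn]

theorem proj_union (S : BiorthSystem 𝕜 E) (A B : Finset ℕ) (x : E) :
    S.proj (A ∪ B) x = S.proj B x + S.proj (A \ B) x := by
  unfold proj
  rw [← Finset.sum_union Finset.disjoint_sdiff, Finset.union_sdiff_self_eq_union, Finset.union_comm]

/-- The norm of `∑ n ∈ A, c n • e n` is at most `Q * S.nrm x` whenever all `|c n|`, `n ∈ A`, are
dominated by all the coordinates of `x` on a set of at most `N` indices that is at least as large
as `A`. -/
def HasDominationConst (S : BiorthSystem 𝕜 E) (N : ℕ) (Q : ℝ≥0) : Prop :=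
  ∀ (A B : Finset ℕ) (c : ℕ → 𝕜) (x : E), A.card ≤ B.card → B.card ≤ N →
    (∀ n ∈ A, ∀ m ∈ B, ‖c n‖ ≤ ‖S.coord m x‖) → S.nrm (∑ n ∈ A, c n • S.vec n) ≤ Q * S.nrm x

/-- If `B` is a greedy set of `x` and `|A| ≤ |B|`, then the part of `x` on `A \ B` is dominated by
the part on `B \ A`, where `x` agrees with every `z` that differs from `x` only on `A`. -/
theorem HasDominationConst.proj_sdiff_le {S : BiorthSystem 𝕜 E} {N : ℕ} {Q : ℝ≥0}
    (hQ : S.HasDominationConst N Q) {x z : E} {A B : Finset ℕ} (hB : S.IsGreedySet x N B)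
    (hA : A.card ≤ N) (hz : ∀ m ∉ A, S.coord m z = S.coord m x) :
    S.nrm (S.proj (A \ B) x) ≤ Q * S.nrm z := by
  refine hQ (A \ B) (B \ A) (fun n => S.coord n x) z ?_ ?_ ?_
  · have h1 := Finset.card_sdiff_add_card_inter A B
    have h2 := Finset.card_sdiff_add_card_inter B A
    rw [Finset.inter_comm] at h2
    have := hB.1
    omega
  · exact (Finset.card_le_card Finset.sdiff_subset).trans hB.1.le
  · intro n hn m hm
    rw [Finset.mem_sdiff] at hn hm
    rw [hz m hm.2]
    exact hB.2 m hm.1 n hn.2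

/-- If `z` is `x` minus a combination of the `e n`, `n ∈ A`, and `B` is greedy, then
`x - P_B x = (z - P_{A ∪ B} z) + P_{A \ B} x`. -/
theorem lebesgue_le (S : BiorthSystem 𝕜 E) {C K Q : ℝ≥0} (hC1 : 1 ≤ C)
    (hC : ∀ x y, S.nrm (x + y) ≤ C * (S.nrm x + S.nrm y)) {N : ℕ}
    (hK : ∀ A : Finset ℕ, A.card ≤ 2 * N → ∀ x, S.nrm (S.proj A x) ≤ K * S.nrm x)
    (hQ : S.HasDominationConst N Q) :
    S.lebesgue N ≤ (C * (C * (1 + K) + Q) : ℝ≥0) := by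
  refine sInf_le fun x B hB => ?_
  have h0 : ((C * (C * (1 + K) + Q) : ℝ≥0) : ℝ≥0∞) ≠ 0 := by
    have : 0 < C := by positivity
    exact_mod_cast (by positivity : 0 < C * (C * (1 + K) + Q)).ne'
  rw [← ENNReal.div_le_iff' h0 ENNReal.coe_ne_top]
  refine le_iInf₂ fun A hA => le_iInf fun c => ?_
  rw [ENNReal.div_le_iff' h0 ENNReal.coe_ne_top]
  set z := x - ∑ n ∈ A, c n • S.vec n with hz
  have hz' : ∀ m ∉ A, S.coord m z = S.coord m x := by
    intro m hm
    rw [hz, map_sub, coord_sum, if_neg hm, sub_zero]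
  have e1 : x - S.proj B x = (z + -S.proj (A ∪ B) z) + S.proj (A \ B) x := by
    rw [hz, proj_sub, proj_sum_of_subset _ Finset.subset_union_left, proj_union]
    abel
  have hcard : (A ∪ B).card ≤ 2 * N := by
    have := Finset.card_union_le A B
    have := hB.1
    omega
  rw [e1]
  push_cast
  calc _ ≤ C * (C * (S.nrm z + K * S.nrm z) + Q * S.nrm z) := by
        refine (hC _ _).trans ?_
        gcongr
        · refine (hC _ _).trans ?_
          rw [nrm_neg]
          gcongr
          exact hK _ hcard z
        · exact hQ.proj_sdiff_le hB hA hz'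
    _ = _ := by ring

/-- If `z = x - P_A x` and `B` is greedy, then `x - P_B x = (z - P_{B \ A} z) + P_{A \ B} x`, and
`B \ A` is a greedy set of `z`. -/
theorem lebesgueExp_le (S : BiorthSystem 𝕜 E) {C G Q : ℝ≥0} (hC1 : 1 ≤ C)
    (hC : ∀ x y, S.nrm (x + y) ≤ C * (S.nrm x + S.nrm y)) {N : ℕ}
    (hG : ∀ (n : ℕ) (x : E) (A : Finset ℕ), S.IsGreedySet x n A →
      S.nrm (S.proj A x) ≤ G * S.nrm x)
    (hQ : S.HasDominationConst N Q) :
    S.lebesgueExp N ≤ (C * (C * (1 + G) + Q) : ℝ≥0) := by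
  refine sInf_le fun x B hB => ?_
  have h0 : ((C * (C * (1 + G) + Q) : ℝ≥0) : ℝ≥0∞) ≠ 0 := by
    have : 0 < C := by positivity
    exact_mod_cast (by positivity : 0 < C * (C * (1 + G) + Q)).ne'
  rw [← ENNReal.div_le_iff' h0 ENNReal.coe_ne_top]
  refine le_iInf₂ fun A hA => ?_
  rw [ENNReal.div_le_iff' h0 ENNReal.coe_ne_top]
  set z := x - S.proj A x with hz
  have hzc : ∀ m, S.coord m z = if m ∈ A then 0 else S.coord m x := by
    intro m
    rw [hz, map_sub, coord_proj]
    split_ifs <;> simp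
  have e0 : S.proj (B \ A) z = S.proj (B \ A) x :=
    S.proj_congr le_rfl (fun n hn => by rw [hzc, if_neg (Finset.mem_sdiff.1 hn).2])
      (fun n h h' => absurd h h')
  have e1 : x - S.proj B x = (z + -S.proj (B \ A) z) + S.proj (A \ B) x := by
    have h1 := S.proj_union A B x
    have h2 := S.proj_union B A x
    rw [Finset.union_comm, h1] at h2
    have h3 := eq_sub_of_add_eq h2.symm
    rw [e0, hz, h3]
    abel
  have hgr : S.IsGreedySet z (B \ A).card (B \ A) := by
    refine ⟨rfl, fun n hn m hm => ?_⟩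
    rw [Finset.mem_sdiff] at hn hm
    rw [hzc n, if_neg hn.2, hzc m]
    split_ifs with h
    · simp
    · exact hB.2 n hn.1 m fun h' => hm ⟨h', h⟩
  rw [e1]
  push_cast
  calc _ ≤ C * (C * (S.nrm z + G * S.nrm z) + Q * S.nrm z) := by
        refine (hC _ _).trans ?_
        gcongr
        · refine (hC _ _).trans ?_
          rw [nrm_neg]
          gcongr
          exact hG _ z _ hgr
        · exact hQ.proj_sdiff_le hB hA fun m hm => by rw [hzc, if_neg hm]
    _ = _ := by ring

theorem sigma_le_nrm (S : BiorthSystem 𝕜 E) {N : ℕ} {x y : E} {A : Finset ℕ} (hA : A.card ≤ N)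
    (c : ℕ → 𝕜) (h : y - ∑ n ∈ A, c n • S.vec n = x) : S.sigma N y ≤ S.nrm x := by
  rw [← h]
  exact iInf_le_of_le A (iInf_le_of_le hA (iInf_le _ c))

theorem sigma_le_sigmaExp (S : BiorthSystem 𝕜 E) (N : ℕ) (x : E) :
    S.sigma N x ≤ S.sigmaExp N x :=
  le_iInf₂ fun _ hA => S.sigma_le_nrm hA (fun n => S.coord n x) rfl

theorem lebesgueExp_le_lebesgue (S : BiorthSystem 𝕜 E) (N : ℕ) :
    S.lebesgueExp N ≤ S.lebesgue N :=
  sInf_le_sInf fun _ hC x A hA =>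
    (hC x A hA).trans (mul_le_mul_right (S.sigma_le_sigmaExp N x) _)

/-- The lower bound for `L_N`: if all coordinates of `x` on `A` are replaced by one large number,
then `A` becomes a greedy set of the new vector, whose `N`-term error is still at most `‖x‖`. -/
theorem nrm_sub_proj_le_lebesgue (S : BiorthSystem 𝕜 E) {N M : ℕ} {x : E} {A : Finset ℕ}
    (hA : A.card ≤ N) (hx : ∀ n, M ≤ n → S.coord n x = 0) :
    S.nrm (x - S.proj A x) ≤ S.lebesgue N * S.nrm x := by
  by_cases hx0 : x = 0
  · subst hx0; simp [proj, nrm_zero]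
  have h0 : S.nrm x ≠ 0 := fun h => hx0 (S.eq_zero_of_nrm x h)
  rw [← ENNReal.div_le_iff h0 (S.nrm_lt_top x).ne]
  refine le_sInf fun C hC => ?_
  rw [ENNReal.div_le_iff h0 (S.nrm_lt_top x).ne]
  -- enlarge `A` to `N` elements by indices where `x` vanishes
  obtain ⟨L, hL⟩ := Finset.exists_nat_subset_range A
  set A' := A ∪ Finset.Ico (max L M) (max L M + (N - A.card)) with hA'
  have hdisj : Disjoint A (Finset.Ico (max L M) (max L M + (N - A.card))) := by
    rw [Finset.disjoint_left]
    intro n hn hn'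
    have h1 := Finset.mem_range.1 (hL hn)
    have h2 := (Finset.mem_Ico.1 hn').1
    omega
  have hcard : A'.card = N := by
    rw [hA', Finset.card_union_of_disjoint hdisj, Nat.card_Ico]; omega
  have hproj : S.proj A x = S.proj A' x :=
    S.proj_congr Finset.subset_union_left (fun _ _ => rfl) fun n hn hn' => by
      refine hx n ?_
      have := (Finset.mem_Ico.1 ((Finset.mem_union.1 hn).resolve_left hn')).1
      omega
  set T : ℝ := ∑ n ∈ Finset.range M, ‖S.coord n x‖ with hT
  have hT0 : 0 ≤ T := Finset.sum_nonneg fun _ _ => norm_nonneg _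
  have hTx : ∀ n, ‖S.coord n x‖ ≤ T := by
    intro n
    rcases lt_or_ge n M with hn | hn
    · exact Finset.single_le_sum (f := fun n => ‖S.coord n x‖) (fun _ _ => norm_nonneg _)
        (Finset.mem_range.2 hn)
    · rw [hx n hn]; simpa using hT0
  set c : ℕ → 𝕜 := fun n => (T : 𝕜) - S.coord n x with hc
  set y := x + ∑ n ∈ A', c n • S.vec n with hy
  have hyc : ∀ m, S.coord m y = if m ∈ A' then (T : 𝕜) else S.coord m x := by
    intro m
    rw [hy, map_add, coord_sum]
    split_ifs <;> simp [hc]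
  have hgr : S.IsGreedySet y N A' := by
    refine ⟨hcard, fun n hn m hm => ?_⟩
    rw [hyc n, hyc m, if_pos hn, if_neg hm, RCLike.norm_ofReal, abs_of_nonneg hT0]
    exact hTx m
  have e : x - S.proj A x = y - S.proj A' y := by
    rw [hy, proj_add, proj_sum_of_subset _ subset_rfl, hproj]; abel
  rw [e]
  exact (hC y A' hgr).trans
    (mul_le_mul_right (S.sigma_le_nrm hcard.le c (by rw [hy, add_sub_cancel_right])) _)

/-- The lower bound for `L̃_N`. The set `A` is already greedy; if it has fewer than `N` elements, it
is filled up by new, large coordinates, which expansional approximation can remove again. -/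
theorem nrm_sub_proj_le_lebesgueExp (S : BiorthSystem 𝕜 E) {N n M : ℕ} {x : E} {A : Finset ℕ}
    (hA : S.IsGreedySet x n A) (hn : n ≤ N) (hx : ∀ n, M ≤ n → S.coord n x = 0) :
    S.nrm (x - S.proj A x) ≤ S.lebesgueExp N * S.nrm x := by
  by_cases hx0 : x = 0
  · subst hx0; simp [proj, nrm_zero]
  have h0 : S.nrm x ≠ 0 := fun h => hx0 (S.eq_zero_of_nrm x h)
  rw [← ENNReal.div_le_iff h0 (S.nrm_lt_top x).ne]
  refine le_sInf fun C hC => ?_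
  rw [ENNReal.div_le_iff h0 (S.nrm_lt_top x).ne]
  obtain ⟨L, hL⟩ := Finset.exists_nat_subset_range A
  set F := Finset.Ico (max L M) (max L M + (N - n)) with hF
  have hFM : ∀ m ∈ F, S.coord m x = 0 := fun m hm => hx m (by
    have := (Finset.mem_Ico.1 hm).1
    omega)
  have hdisj : Disjoint A F := by
    rw [Finset.disjoint_left]
    intro n hn hn'
    have h1 := Finset.mem_range.1 (hL hn)
    have h2 := (Finset.mem_Ico.1 hn').1
    omega
  have hcardF : F.card = N - n := by rw [hF, Nat.card_Ico]; omega
  have hcard : (A ∪ F).card = N := by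
    rw [Finset.card_union_of_disjoint hdisj, hcardF, hA.1]; omega
  set T : ℝ := ∑ n ∈ Finset.range M, ‖S.coord n x‖ with hT
  have hT0 : 0 ≤ T := Finset.sum_nonneg fun _ _ => norm_nonneg _
  have hTx : ∀ n, ‖S.coord n x‖ ≤ T := by
    intro n
    rcases lt_or_ge n M with hn | hn
    · exact Finset.single_le_sum (f := fun n => ‖S.coord n x‖) (fun _ _ => norm_nonneg _)
        (Finset.mem_range.2 hn)
    · rw [hx n hn]; simpa using hT0
  set y := x + ∑ n ∈ F, (T : 𝕜) • S.vec n with hy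
  have hyc : ∀ m, S.coord m y = if m ∈ F then (T : 𝕜) else S.coord m x := by
    intro m
    rw [hy, map_add, S.coord_sum F fun _ => (T : 𝕜)]
    split_ifs with h
    · rw [hFM m h, zero_add]
    · rw [add_zero]
  have hTn : ‖(T : 𝕜)‖ = T := by rw [RCLike.norm_ofReal, abs_of_nonneg hT0]
  have hgr : S.IsGreedySet y N (A ∪ F) := by
    refine ⟨hcard, fun k hk m hm => ?_⟩
    rw [Finset.mem_union, not_or] at hm
    rw [hyc k, hyc m, if_neg hm.2]
    split_ifs with h
    · rw [hTn]; exact hTx m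
    · exact hA.2 k ((Finset.mem_union.1 hk).resolve_right h) m hm.1
  have e1 : S.proj F y = ∑ n ∈ F, (T : 𝕜) • S.vec n := by
    unfold proj
    exact Finset.sum_congr rfl fun m hm => by rw [hyc, if_pos hm]
  have e2 : S.proj A y = S.proj A x :=
    S.proj_congr le_rfl (fun m hm => by rw [hyc, if_neg (Finset.disjoint_left.1 hdisj hm)])
      (fun _ h h' => absurd h h')
  have e : x - S.proj A x = y - S.proj (A ∪ F) y := by
    rw [proj_union, Finset.sdiff_eq_self_of_disjoint hdisj, e1, e2, hy]; abel
  rw [e]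
  refine (hC y _ hgr).trans (mul_le_mul_right ?_ _)
  refine iInf₂_le_of_le F (by omega) (le_of_eq ?_)
  rw [e1, hy, add_sub_cancel_right]

theorem one_le_lebesgueExp (S : BiorthSystem 𝕜 E) (N : ℕ) : 1 ≤ S.lebesgueExp N := by
  have hv : S.vec 0 ≠ 0 := fun h => by
    have := S.biorth 0 0
    simp [h] at this
  have h := S.nrm_sub_proj_le_lebesgueExp (N := N) (n := 0) (M := 1) (x := S.vec 0) (A := ∅)
    ⟨rfl, by simp⟩ (Nat.zero_le _) (fun n hn => by rw [S.biorth, if_neg (by omega)])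
  have h0 : S.nrm (S.vec 0) ≠ 0 := fun h => hv (S.eq_zero_of_nrm _ h)
  simp only [proj, Finset.sum_empty, sub_zero] at h
  rw [← ENNReal.div_le_iff h0 (S.nrm_lt_top _).ne, ENNReal.div_self h0 (S.nrm_lt_top _).ne] at h
  exact h

theorem exists_nrm_smul_le_one (S : BiorthSystem 𝕜 E) {x : E} (hx : x ≠ 0) :
    ∃ c : 𝕜, ‖c‖ₑ = (S.nrm x)⁻¹ ∧ S.nrm (c • x) ≤ 1 := by
  have h0 : S.nrm x ≠ 0 := fun h => hx (S.eq_zero_of_nrm x h)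
  have ht : S.nrm x ≠ ⊤ := (S.nrm_lt_top x).ne
  have htpos : 0 < (S.nrm x).toReal := ENNReal.toReal_pos h0 ht
  have hc : ‖(((S.nrm x).toReal⁻¹ : ℝ) : 𝕜)‖ₑ = (S.nrm x)⁻¹ := by
    rw [← ofReal_norm, RCLike.norm_ofReal, abs_of_pos (inv_pos.2 htpos),
      ENNReal.ofReal_inv_of_pos htpos, ENNReal.ofReal_toReal ht]
  exact ⟨_, hc, by rw [S.nrm_smul, hc, ENNReal.inv_mul_cancel h0 ht]⟩

theorem nrm_proj_le_condConst (S : BiorthSystem 𝕜 E) {N : ℕ} {A : Finset ℕ} (hA : A.card ≤ N)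
    (x : E) : S.nrm (S.proj A x) ≤ S.condConst N * S.nrm x := by
  by_cases hx : x = 0
  · subst hx; simp [proj, nrm_zero]
  have h0 : S.nrm x ≠ 0 := fun h => hx (S.eq_zero_of_nrm x h)
  obtain ⟨c, hc, hc1⟩ := S.exists_nrm_smul_le_one hx
  have h : S.nrm (S.proj A (c • x)) ≤ S.condConst N :=
    le_iSup₂_of_le A hA (le_iSup₂_of_le (c • x) hc1 le_rfl)
  rwa [proj_smul, S.nrm_smul, hc, mul_comm, ← div_eq_mul_inv,
    ENNReal.div_le_iff h0 (S.nrm_lt_top x).ne] at h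

theorem nrm_proj_le_quasiGreedyConst (S : BiorthSystem 𝕜 E) {N n : ℕ} (hn : n ≤ N) {x : E}
    {A : Finset ℕ} (hA : S.IsGreedySet x n A) :
    S.nrm (S.proj A x) ≤ S.quasiGreedyConst N * S.nrm x := by
  by_cases hx : x = 0
  · subst hx; simp [proj, nrm_zero]
  have h0 : S.nrm x ≠ 0 := fun h => hx (S.eq_zero_of_nrm x h)
  obtain ⟨c, hc, hc1⟩ := S.exists_nrm_smul_le_one hx
  have hA' : S.IsGreedySet (c • x) n A := ⟨hA.1, fun k hk m hm => by
    rw [map_smul, map_smul, norm_smul, norm_smul]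
    exact mul_le_mul_of_nonneg_left (hA.2 k hk m hm) (norm_nonneg _)⟩
  have h : S.nrm (S.proj A (c • x)) ≤ S.quasiGreedyConst N :=
    le_iSup₂_of_le n hn (le_iSup₂_of_le (c • x) hc1 (le_iSup₂_of_le A hA' le_rfl))
  rwa [proj_smul, S.nrm_smul, hc, mul_comm, ← div_eq_mul_inv,
    ENNReal.div_le_iff h0 (S.nrm_lt_top x).ne] at h

theorem condConst_le (S : BiorthSystem 𝕜 E) {N : ℕ} {K : ℝ≥0∞}
    (hK : ∀ A : Finset ℕ, A.card ≤ N → ∀ x, S.nrm (S.proj A x) ≤ K * S.nrm x) :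
    S.condConst N ≤ K :=
  iSup₂_le fun A hA => iSup₂_le fun x hx =>
    (hK A hA x).trans ((mul_le_mul_right hx K).trans_eq (mul_one K))

theorem quasiGreedyConst_le (S : BiorthSystem 𝕜 E) {N : ℕ} {K : ℝ≥0∞}
    (hK : ∀ n ≤ N, ∀ (x : E) (A : Finset ℕ), S.IsGreedySet x n A →
      S.nrm (S.proj A x) ≤ K * S.nrm x) :
    S.quasiGreedyConst N ≤ K :=
  iSup₂_le fun n hn => iSup₂_le fun x hx => iSup₂_le fun A hA =>
    (hK n hn x A hA).trans ((mul_le_mul_right hx K).trans_eq (mul_one K))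

/-! ### The dual system -/

theorem dual_coord (S : BiorthSystem 𝕜 E) (n : ℕ) (f : S.dualSpan) :
    S.dual.coord n f = (f : E →ₗ[𝕜] 𝕜) (S.vec n) := rfl

theorem dual_sum_apply (S : BiorthSystem 𝕜 E) (A : Finset ℕ) (c : ℕ → 𝕜) (x : E) :
    ((∑ n ∈ A, c n • S.dual.vec n : S.dualSpan) : E →ₗ[𝕜] 𝕜) x = ∑ n ∈ A, c n * S.coord n x := by
  simp [dual]

theorem dual_proj_apply (S : BiorthSystem 𝕜 E) (A : Finset ℕ) (f : S.dualSpan) (x : E) :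
    ((S.dual.proj A f : S.dualSpan) : E →ₗ[𝕜] 𝕜) x = (f : E →ₗ[𝕜] 𝕜) (S.proj A x) := by
  rw [proj, dual_sum_apply, proj, map_sum]
  exact Finset.sum_congr rfl fun n _ => by rw [map_smul, dual_coord, smul_eq_mul, mul_comm]

theorem enorm_dual_apply_le (S : BiorthSystem 𝕜 E) (f : S.dualSpan) (x : E) :
    ‖(f : E →ₗ[𝕜] 𝕜) x‖ₑ ≤ S.dual.nrm f * S.nrm x :=
  S.enorm_apply_le _ x

theorem dual_nrm_le (S : BiorthSystem 𝕜 E) {f : S.dualSpan} {K : ℝ≥0∞}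
    (h : ∀ x, ‖(f : E →ₗ[𝕜] 𝕜) x‖ₑ ≤ K * S.nrm x) : S.dual.nrm f ≤ K :=
  iSup₂_le fun x hx => (h x).trans ((mul_le_mul_right hx K).trans_eq (mul_one K))

theorem dual_nrm_proj_le (S : BiorthSystem 𝕜 E) {A : Finset ℕ} {K : ℝ≥0∞}
    (hK : ∀ x, S.nrm (S.proj A x) ≤ K * S.nrm x) (f : S.dualSpan) :
    S.dual.nrm (S.dual.proj A f) ≤ K * S.dual.nrm f := by
  refine S.dual_nrm_le fun x => ?_
  rw [dual_proj_apply]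
  refine (S.enorm_dual_apply_le f _).trans ?_
  calc _ ≤ S.dual.nrm f * (K * S.nrm x) := mul_le_mul_right (hK x) _
    _ = _ := by ring

/-- The sum of the coordinates of a functional over `B` is its value at a signed indicator. -/
theorem sum_enorm_dual_coord_le (S : BiorthSystem 𝕜 E) {B : Finset ℕ} {U : ℝ≥0∞}
    (hU : ∀ c : ℕ → 𝕜, (∀ n, ‖c n‖ ≤ 1) → S.nrm (∑ n ∈ B, c n • S.vec n) ≤ U)
    (f : S.dualSpan) : ∑ n ∈ B, ‖S.dual.coord n f‖ₑ ≤ S.dual.nrm f * U := by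
  choose c hc hcf using fun n => RCLike.exists_norm_eq_mul_self (S.dual.coord n f)
  have h := (S.enorm_dual_apply_le f (∑ n ∈ B, c n • S.vec n)).trans
    (mul_le_mul_right (hU c fun n => (hc n).le) _)
  refine le_trans (le_of_eq ?_) h
  have e : (f : E →ₗ[𝕜] 𝕜) (∑ n ∈ B, c n • S.vec n) =
      ((∑ n ∈ B, ‖S.dual.coord n f‖ : ℝ) : 𝕜) := by
    rw [map_sum, RCLike.ofReal_sum]
    exact Finset.sum_congr rfl fun n _ => by rw [map_smul, hcf n]; rfl
  rw [e, ← ofReal_norm, RCLike.norm_ofReal, abs_of_nonneg (by positivity),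
    ENNReal.ofReal_sum_of_nonneg fun n _ => norm_nonneg _]
  exact Finset.sum_congr rfl fun n _ => (ofReal_norm _).symm

end BiorthSystem

/-! ### Growth of the rate -/

theorem enorm_le_one_of_norm_le {𝕜 : Type*} [RCLike 𝕜] {a : 𝕜} (h : ‖a‖ ≤ 1) : ‖a‖ₑ ≤ 1 := by
  simpa using enorm_le_iff_norm_le.2 (show ‖a‖ ≤ ‖(1 : 𝕜)‖ by simpa using h)

theorem ennreal_rpow_le_self {a : ℝ≥0∞} {t : ℝ} (ha : 1 ≤ a) (ht : t ≤ 1) : a ^ t ≤ a := by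
  simpa using ENNReal.rpow_le_rpow_of_exponent_le ha ht

/-- The rate `[1 + 1/2 + ⋯ + 1/N]^{1/r'}`, which is comparable with `logRate r N`. -/
noncomputable def harmRate (r : ℝ≥0∞) (N : ℕ) : ℝ≥0∞ := harm N ^ (1 - (r⁻¹).toReal)

theorem harmRate_mono {r : ℝ≥0∞} (hr : 1 ≤ r) : Monotone (harmRate r) := fun _ _ h =>
  ENNReal.rpow_le_rpow (harm_mono h) (sub_nonneg.2 (toReal_inv_nonneg_le_one hr).2)

theorem harmRate_ne_top {r : ℝ≥0∞} (hr : 1 ≤ r) (N : ℕ) : harmRate r N ≠ ⊤ :=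
  ENNReal.rpow_ne_top_of_nonneg (sub_nonneg.2 (toReal_inv_nonneg_le_one hr).2) (harm_ne_top N)

theorem one_le_harmRate {r : ℝ≥0∞} (hr : 1 ≤ r) {N : ℕ} (hN : 1 ≤ N) : 1 ≤ harmRate r N := by
  simpa [harmRate] using ENNReal.rpow_le_rpow (one_le_harm hN)
    (sub_nonneg.2 (toReal_inv_nonneg_le_one hr).2)

theorem mul_rpow_le_of_le_one {a : ℝ≥0∞} (b : ℝ≥0∞) {t : ℝ} (ha : 1 ≤ a) (ht0 : 0 ≤ t)
    (ht : t ≤ 1) : (a * b) ^ t ≤ a * b ^ t := by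
  rw [ENNReal.mul_rpow_of_nonneg _ _ ht0]
  gcongr
  exact ennreal_rpow_le_self ha ht

theorem harmRate_two_mul_le {r : ℝ≥0∞} (hr : 1 ≤ r) (N : ℕ) :
    harmRate r (2 * N) ≤ 2 * harmRate r N := by
  obtain ⟨h0, h1⟩ := toReal_inv_nonneg_le_one hr
  exact (ENNReal.rpow_le_rpow (harm_two_mul_le N) (by linarith)).trans
    (mul_rpow_le_of_le_one _ (by norm_num) (by linarith) (by linarith))

theorem harmRate_le_harm {r : ℝ≥0∞} {N : ℕ} (hN : 1 ≤ N) :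
    harmRate r N ≤ harm N :=
  ennreal_rpow_le_self (one_le_harm hN) (by linarith [ENNReal.toReal_nonneg (a := r⁻¹)])

theorem rpow_le_of_le_mul_rpow {a T : ℝ≥0∞} {t : ℝ} (ha : a ≠ 0) (ha' : a ≠ ⊤)
    (h : a ≤ T * a ^ t) : a ^ (1 - t) ≤ T := by
  rw [ENNReal.rpow_sub _ _ ha ha', ENNReal.rpow_one]
  refine ENNReal.div_le_of_le_mul h

theorem logRate_eq {r : ℝ≥0∞} {N : ℕ} (hN : 1 ≤ N) :
    logRate r N = ENNReal.ofReal (Real.log (N + 1)) ^ (1 - (r⁻¹).toReal) := by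
  have hN' : (1 : ℝ) ≤ N := by exact_mod_cast hN
  rw [logRate, ENNReal.ofReal_rpow_of_pos (Real.log_pos (by linarith))]

theorem comparable_logRate {r : ℝ≥0∞} (hr : 1 ≤ r) {a : ℕ → ℝ≥0∞}
    (h1 : ∃ c : ℝ≥0, ∀ N, 1 ≤ N → harmRate r N ≤ c * a N)
    (h2 : ∃ C : ℝ≥0, ∀ N, 1 ≤ N → a N ≤ C * harmRate r N) : Comparable a (logRate r) := by
  obtain ⟨c, hc⟩ := h1
  obtain ⟨C, hC⟩ := h2
  obtain ⟨ht0, ht1⟩ := toReal_inv_nonneg_le_one hr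
  refine ⟨(max c 1)⁻¹, C * 3, by positivity, fun N hN => ⟨?_, ?_⟩⟩
  · have h0 : ((max c 1 : ℝ≥0) : ℝ≥0∞) ≠ 0 := by
      have : 0 < max c 1 := by positivity
      exact_mod_cast this.ne'
    rw [ENNReal.coe_inv (by positivity), mul_comm, ← div_eq_mul_inv,
      ENNReal.div_le_iff' h0 ENNReal.coe_ne_top]
    calc logRate r N ≤ harmRate r N := by
          rw [logRate_eq hN]
          exact ENNReal.rpow_le_rpow (log_le_harm N) (by linarith)
      _ ≤ c * a N := hc N hN
      _ ≤ _ := by gcongr; exact le_max_left _ _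
  · calc a N ≤ C * harmRate r N := hC N hN
      _ ≤ C * (3 * logRate r N) := by
          gcongr
          rw [logRate_eq hN]
          exact (ENNReal.rpow_le_rpow (harm_le_log hN) (by linarith)).trans
            (mul_rpow_le_of_le_one _ (by norm_num) (by linarith) (by linarith))
      _ = _ := by push_cast; ring

theorem BiorthSystem.HasDominationConst.mono {𝕜 : Type*} [RCLike 𝕜] {E : Type*} [AddCommGroup E]
    [Module 𝕜 E] {S : BiorthSystem 𝕜 E} {N : ℕ} {Q Q' : ℝ≥0} (h : S.HasDominationConst N Q)
    (hQ : Q ≤ Q') : S.HasDominationConst N Q' := fun A B c x hA hB hc =>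
  (h A B c x hA hB hc).trans (by gcongr)

theorem BiorthSystem.lebesgue_le_harmRate {𝕜 : Type*} [RCLike 𝕜] {E : Type*} [AddCommGroup E]
    [Module 𝕜 E] {S : BiorthSystem 𝕜 E} {r : ℝ≥0∞} (hr : 1 ≤ r)
    (hK : ∀ N, ∀ A : Finset ℕ, A.card ≤ N → ∀ x,
      S.nrm (S.proj A x) ≤ harmRate r N * S.nrm x)
    (hQ : ∃ Q : ℝ≥0, ∀ N, 1 ≤ N → S.HasDominationConst N (Q * (harmRate r N).toNNReal)) :
    ∃ C : ℝ≥0, ∀ N, 1 ≤ N → S.lebesgue N ≤ C * harmRate r N := by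
  obtain ⟨C, hC1, hC⟩ := S.exists_one_le_nrm_add
  obtain ⟨Q, hQ⟩ := hQ
  refine ⟨C * (C * (1 + 2) + Q), fun N hN => ?_⟩
  have e := ENNReal.coe_toNNReal (harmRate_ne_top hr N)
  refine (S.lebesgue_le hC1 hC (K := 2 * (harmRate r N).toNNReal) (fun A hA x => ?_)
    (hQ N hN)).trans ?_
  · refine (hK _ A hA x).trans ?_
    push_cast
    rw [e]
    gcongr
    exact harmRate_two_mul_le hr N
  · push_cast
    rw [e]
    calc _ ≤ (C : ℝ≥0∞) * (C * (harmRate r N + 2 * harmRate r N) + Q * harmRate r N) := by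
          gcongr
          exact one_le_harmRate hr hN
      _ = _ := by ring

/-! ### Systems isometric to the canonical basis of `KT(p, r)` -/

section

variable {𝕜 : Type*} [RCLike 𝕜] {E : Type*} [AddCommGroup E] [Module 𝕜 E]

/-- `ι` identifies `S` with the canonical basis in a space of null sequences with the quasi-norm of
`KT(p, r)`. This covers `KT(p, r)` itself and the closed linear span of its basis. -/
structure IsKTSystem (S : BiorthSystem 𝕜 E) (p : ℝ) (r : ℝ≥0∞) (ι : E →ₗ[𝕜] (ℕ → 𝕜)) : Prop where
  nrm_eq : ∀ x, S.nrm x = ktNrm p r (ι x)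
  vec_eq : ∀ n, ι (S.vec n) = Pi.single n 1
  coord_eq : ∀ n x, S.coord n x = ι x n
  tendsto : ∀ x, Filter.Tendsto (ι x) Filter.atTop (𝓝 0)

theorem isKTSystem_ktSystem {p : ℝ} {r : ℝ≥0∞} (hp : 1 ≤ p) (hr : 1 ≤ r) :
    IsKTSystem (ktSystem 𝕜 p r hp hr) p r (KT 𝕜 p r hp hr).subtype :=
  ⟨fun _ => rfl, fun _ => rfl, fun _ _ => rfl, fun x => x.2.1⟩

theorem isKTSystem_restrict {p : ℝ} {r : ℝ≥0∞} (hp : 1 ≤ p) (hr : 1 ≤ r) :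
    IsKTSystem (ktSystem 𝕜 p r hp hr).restrict p r
      ((KT 𝕜 p r hp hr).subtype.comp (ktSystem 𝕜 p r hp hr).closedSpan.subtype) :=
  ⟨fun _ => rfl, fun _ => rfl, fun _ _ => rfl, fun x => x.1.2.1⟩

namespace IsKTSystem

variable {S : BiorthSystem 𝕜 E} {p : ℝ} {r : ℝ≥0∞} {ι : E →ₗ[𝕜] (ℕ → 𝕜)}

theorem map_sum_apply (h : IsKTSystem S p r ι) (A : Finset ℕ) (c : ℕ → 𝕜) (m : ℕ) :
    ι (∑ n ∈ A, c n • S.vec n) m = if m ∈ A then c m else 0 := by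
  rw [← h.coord_eq, S.coord_sum]

theorem map_proj_apply (h : IsKTSystem S p r ι) (A : Finset ℕ) (x : E) (m : ℕ) :
    ι (S.proj A x) m = if m ∈ A then ι x m else 0 := by
  rw [← h.coord_eq, S.coord_proj, h.coord_eq]

theorem enorm_map_proj_le (h : IsKTSystem S p r ι) (A : Finset ℕ) (x : E) (m : ℕ) :
    ‖ι (S.proj A x) m‖ₑ ≤ ‖ι x m‖ₑ := by
  rw [h.map_proj_apply]
  split_ifs <;> simp

theorem lorentzNrm_le (h : IsKTSystem S p r ι) (x : E) : lorentzNrm p r (ι x) ≤ S.nrm x := by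
  rw [h.nrm_eq]; exact le_max_left _ _

theorem bNrm_le (h : IsKTSystem S p r ι) (x : E) : bNrm p (ι x) ≤ S.nrm x := by
  rw [h.nrm_eq]; exact le_max_right _ _

theorem enorm_sum_le (h : IsKTSystem S p r ι) (x : E) (N : ℕ) :
    ‖∑ n ∈ Finset.range N, ι x n / ((((n : ℝ) + 1) ^ (1 - 1 / p) : ℝ) : 𝕜)‖ₑ ≤ S.nrm x :=
  le_trans (le_iSup (fun N : ℕ =>
      ‖∑ n ∈ Finset.range N, ι x n / ((((n : ℝ) + 1) ^ (1 - 1 / p) : ℝ) : 𝕜)‖ₑ) N) (h.bNrm_le x)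

theorem nrm_sum_le (h : IsKTSystem S p r ι) (hp : 1 ≤ p) (hr : 1 ≤ r) (A : Finset ℕ) {c : ℕ → 𝕜}
    {a : ℝ≥0∞} (hc : ∀ n ∈ A, ‖c n‖ₑ ≤ a) : S.nrm (∑ n ∈ A, c n • S.vec n) ≤
      max (flatConst p r) (ENNReal.ofReal p) * (a * (A.card : ℝ≥0∞) ^ (1 / p)) := by
  rw [h.nrm_eq]
  refine ktNrm_le_of_support hp hr (fun n hn => by rw [h.map_sum_apply, if_neg hn]) fun n => ?_
  rw [h.map_sum_apply]
  split_ifs with hn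
  · exact hc n hn
  · simp

/-- The upper estimate of `K_N`: the partial sums of `P_A x` are estimated by rearrangement and
Hölder's inequality. -/
theorem nrm_proj_le_harmRate (h : IsKTSystem S p r ι) (hp : 1 ≤ p) (hr : 1 ≤ r) (N : ℕ)
    (A : Finset ℕ) (hA : A.card ≤ N) (x : E) : S.nrm (S.proj A x) ≤ harmRate r N * S.nrm x := by
  rcases A.eq_empty_or_nonempty with rfl | hne
  · simp [BiorthSystem.proj, S.nrm_zero]
  have hN : 1 ≤ N := (Finset.card_pos.2 hne).trans_le hA
  have hl : lorentzNrm p r (ι (S.proj A x)) ≤ S.nrm x :=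
    (lorentzNrm_mono (h.enorm_map_proj_le A x)).trans (h.lorentzNrm_le x)
  rw [h.nrm_eq (S.proj A x)]
  refine max_le ?_ ?_
  · calc _ ≤ 1 * S.nrm x := by rw [one_mul]; exact hl
      _ ≤ _ := by gcongr; exact one_le_harmRate hr hN
  · refine (bNrm_le_sum_rearr hp fun n hn => by rw [h.map_proj_apply, if_neg hn]).trans ?_
    refine (sum_rearr_mul_le hr _ _).trans ?_
    exact mul_le_mul' (harmRate_mono hr hA) hl

/-- The lower democracy estimate, from the embedding of `ℓ^{p,r}` into `ℓ^{p,∞}`. -/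
theorem exists_le_nrm (h : IsKTSystem S p r ι) (hp : 1 ≤ p) (hr : 1 ≤ r) :
    ∃ C : ℝ≥0, ∀ (x : E) (B : Finset ℕ) (a : ℝ≥0∞), (∀ m ∈ B, a ≤ ‖S.coord m x‖ₑ) →
      a * (B.card : ℝ≥0∞) ^ (1 / p) ≤ C * S.nrm x := by
  obtain ⟨C, hC⟩ := exists_rearr_le_lorentzNrm (𝕜 := 𝕜) hp hr
  refine ⟨C, fun x B a ha => ?_⟩
  have hp0 : 0 < 1 / p := by positivity
  rcases B.eq_empty_or_nonempty with rfl | hne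
  · simp [show 0 < p by linarith]
  obtain ⟨k, hk⟩ := Nat.exists_eq_succ_of_ne_zero (Finset.card_pos.2 hne).ne'
  have h1 : a ≤ rearr (ι x) k := le_rearr (B := B) (by omega) fun m hm => by
    rw [← h.coord_eq]; exact ha m hm
  calc _ ≤ ((k : ℝ≥0∞) + 1) ^ (1 / p) * rearr (ι x) k := by
        rw [hk, mul_comm]
        push_cast
        gcongr
    _ ≤ C * lorentzNrm p r (ι x) := hC _ _
    _ ≤ _ := by gcongr; exact h.lorentzNrm_le x

theorem exists_hasDominationConst (h : IsKTSystem S p r ι) (hp : 1 ≤ p) (hr : 1 ≤ r) :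
    ∃ Q : ℝ≥0, ∀ N, S.HasDominationConst N Q := by
  obtain ⟨C, hC⟩ := h.exists_le_nrm hp hr
  have hF : max (flatConst p r) (ENNReal.ofReal p) ≠ ⊤ := by
    simp [flatConst_ne_top]
  refine ⟨(max (flatConst p r) (ENNReal.ofReal p)).toNNReal * C,
    fun N A B c x hAB _ hc => ?_⟩
  rcases A.eq_empty_or_nonempty with rfl | hne
  · simp [S.nrm_zero]
  obtain ⟨k, hk, hmax⟩ := A.exists_max_image (fun n => ‖c n‖ₑ) hne
  push_cast
  rw [ENNReal.coe_toNNReal hF, mul_assoc]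
  refine (h.nrm_sum_le hp hr A hmax).trans (mul_le_mul_right ?_ _)
  refine le_trans ?_ (hC x B ‖c k‖ₑ fun m hm => enorm_le_iff_norm_le.2 (hc k hk m hm))
  gcongr

theorem exists_sum_coord_le (h : IsKTSystem S p r ι) (hp : 1 < p) (hr : 1 ≤ r) :
    ∃ C : ℝ≥0, ∀ (x : E) (A : Finset ℕ),
      ∑ n ∈ A, ‖S.coord n x‖ₑ ≤ C * (A.card : ℝ≥0∞) ^ (1 - 1 / p) * S.nrm x := by
  obtain ⟨C, hC⟩ := exists_rearr_le_lorentzNrm (𝕜 := 𝕜) hp.le hr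
  have hp1 : 0 < 1 - 1 / p := by
    rw [sub_pos, div_lt_one (by linarith)]; exact hp
  refine ⟨C * (max 1 (1 - 1 / p)⁻¹).toNNReal, fun x A => ?_⟩
  simp only [h.coord_eq]
  refine (sum_enorm_le_sum_rearr _ _).trans ?_
  calc _ ≤ ∑ j ∈ Finset.range A.card, (C * S.nrm x) * ((j : ℝ≥0∞) + 1) ^ (1 - 1 / p - 1) := by
        refine Finset.sum_le_sum fun j _ => ?_
        have h1 := (hC (ι x) j).trans (mul_le_mul_right (h.lorentzNrm_le x) _)
        calc rearr (ι x) j = (((j : ℝ≥0∞) + 1) ^ (1 / p) * rearr (ι x) j) *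
              ((j : ℝ≥0∞) + 1) ^ (1 - 1 / p - 1) := by
              rw [mul_right_comm, ← cast_add_one_rpow_add]
              simp
          _ ≤ _ := by gcongr
    _ ≤ (C * S.nrm x) * (ENNReal.ofReal (max 1 (1 - 1 / p)⁻¹) *
          (A.card : ℝ≥0∞) ^ (1 - 1 / p)) := by
        rw [← Finset.mul_sum]
        gcongr
        exact sum_rpow_le hp1 _
    _ = _ := by
        push_cast
        rw [ENNReal.ofReal]
        ring

theorem sum_coord_le (h : IsKTSystem S 1 r ι) (hr : 1 ≤ r) (x : E) (A : Finset ℕ) :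
    ∑ n ∈ A, ‖S.coord n x‖ₑ ≤ harmRate r A.card * S.nrm x := by
  simp only [h.coord_eq]
  refine (sum_enorm_le_sum_rearr _ _).trans ?_
  have h1 := sum_rearr_mul_le (p := 1) hr (ι x) A.card
  simp only [ne_eq, one_ne_zero, not_false_eq_true, div_self, sub_self, ENNReal.rpow_zero,
    mul_one] at h1
  exact h1.trans (mul_le_mul_right (h.lorentzNrm_le x) _)

/-- Here `V k` bounds the democracy functions of the dual system. If all `|c n|`, `n ∈ A`, are at
most `a` and `f` has `k = |B|` coordinates of modulus at least `a`, then the norm of `∑ n ∈ A, c n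
• e n ^ *` is at most `a * V k`, while testing `f` on a signed indicator of `B` gives `a * k ≤ C *
‖f‖ * k ^ (1 / p)`. -/
theorem hasDominationConst_dual (h : IsKTSystem S p r ι) (hp : 1 ≤ p) (hr : 1 ≤ r)
    {V : ℕ → ℝ≥0∞} {Q : ℝ≥0} {N : ℕ}
    (hV : ∀ (x : E) (A : Finset ℕ) (k : ℕ), A.card ≤ k →
      ∑ n ∈ A, ‖S.coord n x‖ₑ ≤ V k * S.nrm x)
    (hQ : ∀ k, 1 ≤ k → k ≤ N → V k * (k : ℝ≥0∞) ^ (1 / p) ≤ Q * k) :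
    S.dual.HasDominationConst N ((max (flatConst p r) (ENNReal.ofReal p)).toNNReal * Q) := by
  have hF : max (flatConst p r) (ENNReal.ofReal p) ≠ ⊤ := by
    simp [flatConst_ne_top]
  intro A B c f hAB hBN hc
  rcases A.eq_empty_or_nonempty with rfl | hne
  · simp [S.dual.nrm_zero]
  have hB : 1 ≤ B.card := (Finset.card_pos.2 hne).trans_le hAB
  obtain ⟨k, hk, hmax⟩ := A.exists_max_image (fun n => ‖c n‖ₑ) hne
  have h1 : S.dual.nrm (∑ n ∈ A, c n • S.dual.vec n) ≤ ‖c k‖ₑ * V B.card := by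
    refine S.dual_nrm_le fun x => ?_
    rw [S.dual_sum_apply]
    calc _ ≤ ∑ n ∈ A, ‖c k‖ₑ * ‖S.coord n x‖ₑ := by
          refine (_root_.enorm_sum_le _ _).trans (Finset.sum_le_sum fun n hn => ?_)
          rw [enorm_mul]
          gcongr
          exact hmax n hn
      _ ≤ ‖c k‖ₑ * (V B.card * S.nrm x) := by
          rw [← Finset.mul_sum]
          gcongr
          exact hV x A _ hAB
      _ = _ := by ring
  have h2 : ‖c k‖ₑ * B.card ≤ S.dual.nrm f *
      (max (flatConst p r) (ENNReal.ofReal p) * (1 * (B.card : ℝ≥0∞) ^ (1 / p))) := by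
    refine le_trans ?_ (S.sum_enorm_dual_coord_le (B := B) (fun c' hc' =>
      h.nrm_sum_le hp hr B fun n _ => ?_) f)
    · rw [mul_comm, ← nsmul_eq_mul]
      exact Finset.card_nsmul_le_sum _ _ _ fun m hm => enorm_le_iff_norm_le.2 (hc k hk m hm)
    · exact enorm_le_one_of_norm_le (hc' n)
  push_cast
  rw [ENNReal.coe_toNNReal hF]
  have hB0 : (B.card : ℝ≥0∞) ≠ 0 := by
    have : B.card ≠ 0 := by omega
    exact_mod_cast this
  refine h1.trans ((ENNReal.mul_le_mul_iff_left hB0 (ENNReal.natCast_ne_top _)).1 ?_)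
  calc ‖c k‖ₑ * V B.card * B.card = V B.card * (‖c k‖ₑ * B.card) := by ring
    _ ≤ V B.card * (S.dual.nrm f *
      (max (flatConst p r) (ENNReal.ofReal p) * (1 * (B.card : ℝ≥0∞) ^ (1 / p)))) := by gcongr
    _ = max (flatConst p r) (ENNReal.ofReal p) * S.dual.nrm f *
        (V B.card * (B.card : ℝ≥0∞) ^ (1 / p)) := by ring
    _ ≤ max (flatConst p r) (ENNReal.ofReal p) * S.dual.nrm f * (Q * B.card) := by
        exact mul_le_mul_right (hQ _ hB hBN) _
    _ = _ := by ring

theorem exists_hasDominationConst_dual (h : IsKTSystem S p r ι) (hp : 1 < p) (hr : 1 ≤ r) :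
    ∃ Q : ℝ≥0, ∀ N, S.dual.HasDominationConst N Q := by
  obtain ⟨C, hC⟩ := h.exists_sum_coord_le hp hr
  have hp1 : 0 ≤ 1 - 1 / p := by
    rw [sub_nonneg, div_le_one (by linarith)]; exact hp.le
  refine ⟨_, fun N => h.hasDominationConst_dual hp.le hr (Q := C)
    (V := fun k => C * (k : ℝ≥0∞) ^ (1 - 1 / p)) (fun x A k hk => ?_) fun k hk _ => ?_⟩
  · refine (hC x A).trans ?_
    gcongr
  · have hk0 : (k : ℝ≥0∞) ≠ 0 := by
      have : k ≠ 0 := by omega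
      exact_mod_cast this
    rw [mul_assoc, ← ENNReal.rpow_add _ _ hk0 (ENNReal.natCast_ne_top _)]
    simp

theorem exists_hasDominationConst_dual_one (h : IsKTSystem S 1 r ι) (hr : 1 ≤ r) :
    ∃ Q : ℝ≥0, ∀ N, 1 ≤ N →
      S.dual.HasDominationConst N (Q * (harmRate r N).toNNReal) := by
  refine ⟨_, fun N hN => h.hasDominationConst_dual le_rfl hr
    (V := harmRate r) (fun x A k hk => ?_) fun k hk hkN => ?_⟩
  · refine (h.sum_coord_le hr x A).trans ?_
    gcongr
    exact harmRate_mono hr hk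
  · rw [ENNReal.coe_toNNReal (harmRate_ne_top hr N), div_one, ENNReal.rpow_one]
    gcongr
    exact harmRate_mono hr hkN

/-! ### Quasi-greediness for `p > 1` -/

theorem exists_isGreedySet (h : IsKTSystem S p r ι) (x : E) (n : ℕ) :
    ∃ A, S.IsGreedySet x n A := by
  induction n with
  | zero => exact ⟨∅, rfl, by simp⟩
  | succ n ih =>
    obtain ⟨A, hA, hA'⟩ := ih
    obtain ⟨k, hkA, hk⟩ : ∃ k ∉ A, ∀ m ∉ A, ‖S.coord m x‖ ≤ ‖S.coord k x‖ := by
      by_cases h0 : ∀ m ∉ A, S.coord m x = 0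
      · obtain ⟨k, hk⟩ := Infinite.exists_notMem_finset A
        exact ⟨k, hk, fun m hm => by rw [h0 m hm]; simp⟩
      · push Not at h0
        obtain ⟨m₀, hm₀, hne⟩ := h0
        have ht := (h.tendsto x).norm
        rw [norm_zero] at ht
        obtain ⟨L, hL⟩ := Filter.eventually_atTop.1
          (ht.eventually_lt_const (norm_pos_iff.2 (h.coord_eq m₀ x ▸ hne)))
        have hm₀L : m₀ < L := by
          by_contra hc
          exact lt_irrefl _ (hL m₀ (not_lt.1 hc))
        obtain ⟨k, hk, hmax⟩ := (Finset.range L \ A).exists_max_image (fun n => ‖S.coord n x‖)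
          ⟨m₀, by simp [hm₀L, hm₀]⟩
        refine ⟨k, (Finset.mem_sdiff.1 hk).2, fun m hm => ?_⟩
        rcases lt_or_ge m L with hmL | hmL
        · exact hmax m (by simp [hmL, hm])
        · refine le_trans ?_ (hmax m₀ (by simp [hm₀L, hm₀]))
          rw [h.coord_eq, h.coord_eq]
          exact (hL m hmL).le
    refine ⟨insert k A, by rw [Finset.card_insert_of_notMem hkA, hA], fun i hi m hm => ?_⟩
    rw [Finset.mem_insert, not_or] at hm
    rcases Finset.mem_insert.1 hi with rfl | hi
    · exact hk m hm.2
    · exact hA' i hi m hm.2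

/-- Off a greedy set of order `n`, the coordinates are at most a multiple of `n ^ (-1 / p)`. -/
theorem exists_coord_mul_le (h : IsKTSystem S p r ι) (hp : 1 ≤ p) (hr : 1 ≤ r) :
    ∃ C : ℝ≥0, ∀ (x : E) (n : ℕ) (A : Finset ℕ), S.IsGreedySet x n A → ∀ m ∉ A,
      ‖S.coord m x‖ₑ * (n : ℝ≥0∞) ^ (1 / p) ≤ C * S.nrm x := by
  obtain ⟨C, hC⟩ := h.exists_le_nrm hp hr
  refine ⟨C, fun x n A hA m hm => ?_⟩
  rw [← hA.1]
  exact hC x A _ fun k hk => enorm_le_iff_norm_le.2 (hA.2 k hk m hm)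

/-- Up to index `n`, the partial sums of `P_A x`, for a greedy set `A` of order `n`, are close to
those of `x`: the missing coordinates are small, and the coordinates in `A` beyond `n` have small
weights. -/
theorem exists_nrm_proj_le (h : IsKTSystem S p r ι) (hp : 1 < p) (hr : 1 ≤ r) :
    ∃ G : ℝ≥0, ∀ (n : ℕ) (x : E) (A : Finset ℕ), S.IsGreedySet x n A →
      S.nrm (S.proj A x) ≤ G * S.nrm x := by
  obtain ⟨C₁, hC₁⟩ := h.exists_coord_mul_le hp.le hr
  obtain ⟨C₂, hC₂⟩ := h.exists_sum_coord_le hp hr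
  have hp1 : 0 ≤ 1 - 1 / p := by
    rw [sub_nonneg, div_le_one (by linarith)]; exact hp.le
  refine ⟨1 + p.toNNReal * C₁ + C₂, fun N x A hA => ?_⟩
  rcases Nat.eq_zero_or_pos N with hN | hN
  · rw [Finset.card_eq_zero.1 (hA.1.trans hN)]
    simp [BiorthSystem.proj, S.nrm_zero]
  have hN0 : (N : ℝ≥0∞) ≠ 0 := by exact_mod_cast hN.ne'
  set w : ℕ → ℝ≥0∞ := fun n => ((n : ℝ≥0∞) + 1) ^ (1 / p - 1) with hw
  set v : ℕ → 𝕜 := fun n => ((((n : ℝ) + 1) ^ (1 - 1 / p) : ℝ) : 𝕜) with hv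
  rw [h.nrm_eq (S.proj A x)]
  refine max_le ?_ (iSup_le fun M => ?_)
  · refine (lorentzNrm_mono (h.enorm_map_proj_le A x)).trans ((h.lorentzNrm_le x).trans ?_)
    push_cast
    rw [add_assoc, add_mul, one_mul]
    exact le_self_add
  -- the missing coordinates below `N`, and the coordinates in `A` from `N` on
  have hsmall : ∑ n ∈ Finset.range N, (if n ∈ A then 0 else ‖ι x n‖ₑ * w n) ≤
      p.toNNReal * C₁ * S.nrm x := by
    have hi : ∀ n ∈ Finset.range N, (if n ∈ A then 0 else ‖ι x n‖ₑ * w n) * (N : ℝ≥0∞) ^ (1 / p) ≤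
        C₁ * S.nrm x * w n := by
      intro n _
      split_ifs with hn
      · simp
      · have := hC₁ x N A hA n hn
        rw [h.coord_eq] at this
        calc _ = (‖ι x n‖ₑ * (N : ℝ≥0∞) ^ (1 / p)) * w n := by ring
          _ ≤ _ := by gcongr
    have hNp0 : (N : ℝ≥0∞) ^ (1 / p) ≠ 0 := by
      simp [ENNReal.rpow_eq_zero_iff, hN0]
    have hNpt : (N : ℝ≥0∞) ^ (1 / p) ≠ ⊤ :=
      ENNReal.rpow_ne_top_of_nonneg (by positivity) (ENNReal.natCast_ne_top _)
    refine (ENNReal.mul_le_mul_iff_left hNp0 hNpt).1 ?_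
    rw [Finset.sum_mul]
    calc _ ≤ C₁ * S.nrm x * ∑ n ∈ Finset.range N, w n := by
          rw [Finset.mul_sum]; exact Finset.sum_le_sum hi
      _ ≤ C₁ * S.nrm x * (ENNReal.ofReal (max 1 (1 / p)⁻¹) * (N : ℝ≥0∞) ^ (1 / p)) := by
          gcongr
          exact sum_rpow_le (by positivity) _
      _ = _ := by
          rw [one_div, inv_inv, max_eq_right hp.le, ENNReal.ofReal]
          ring
  have htail : ∑ n ∈ A, (if n < N then 0 else ‖ι x n‖ₑ * w n) ≤ C₂ * S.nrm x := by
    have hwN : ∀ n, N ≤ n → w n ≤ (N : ℝ≥0∞) ^ (1 / p - 1) := by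
      intro n hn
      have : (N : ℝ≥0∞) ≤ (n : ℝ≥0∞) + 1 := by exact_mod_cast hn.trans (Nat.le_succ n)
      simp only [hw, ← neg_sub 1 (1 / p), ENNReal.rpow_neg]
      gcongr
    calc _ ≤ ∑ n ∈ A, (N : ℝ≥0∞) ^ (1 / p - 1) * ‖S.coord n x‖ₑ := by
          refine Finset.sum_le_sum fun n _ => ?_
          split_ifs with hn
          · exact zero_le
          · rw [h.coord_eq, mul_comm]
            gcongr
            exact hwN n (not_lt.1 hn)
      _ ≤ (N : ℝ≥0∞) ^ (1 / p - 1) * (C₂ * (N : ℝ≥0∞) ^ (1 - 1 / p) * S.nrm x) := by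
          rw [← Finset.mul_sum]
          gcongr
          simpa [hA.1] using hC₂ x A
      _ = ((N : ℝ≥0∞) ^ (1 / p - 1) * (N : ℝ≥0∞) ^ (1 - 1 / p)) * (C₂ * S.nrm x) := by ring
      _ = _ := by
          rw [← ENNReal.rpow_add _ _ hN0 (ENNReal.natCast_ne_top _)]
          simp
  have e : ∑ n ∈ Finset.range M, ι (S.proj A x) n / v n =
      ∑ n ∈ Finset.range (min M N), ι x n / v n -
        ∑ n ∈ Finset.range (min M N), (if n ∈ A then 0 else ι x n / v n) +
        ∑ n ∈ Finset.range M, (if n ∈ A then (if n < N then 0 else ι x n / v n) else 0) := by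
    have e1 : Finset.range (min M N) = (Finset.range M).filter (· < N) := by
      ext n; simp
    rw [e1, Finset.sum_filter, Finset.sum_filter, ← Finset.sum_sub_distrib,
      ← Finset.sum_add_distrib]
    refine Finset.sum_congr rfl fun n _ => ?_
    rw [h.map_proj_apply]
    split_ifs <;> simp
  have hwv : ∀ n, ‖ι x n / v n‖ₑ = ‖ι x n‖ₑ * w n := fun n => enorm_div_weight p _ n
  rw [e]
  have b1 := h.enorm_sum_le x (min M N)
  have b2 : ‖∑ n ∈ Finset.range (min M N), (if n ∈ A then 0 else ι x n / v n)‖ₑ ≤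
      p.toNNReal * C₁ * S.nrm x := by
    refine (_root_.enorm_sum_le _ _).trans (le_trans ?_ hsmall)
    refine (Finset.sum_le_sum_of_subset (Finset.range_mono (min_le_right M N))).trans
      (Finset.sum_le_sum fun n _ => ?_)
    split_ifs
    · simp
    · exact (hwv n).le
  have b3 : ‖∑ n ∈ Finset.range M, (if n ∈ A then (if n < N then 0 else ι x n / v n) else 0)‖ₑ ≤
      C₂ * S.nrm x := by
    refine le_trans ?_ htail
    rw [Finset.sum_ite_mem]
    refine (_root_.enorm_sum_le _ _).trans ((Finset.sum_le_sum_of_subset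
      Finset.inter_subset_right).trans (Finset.sum_le_sum fun n _ => ?_))
    split_ifs
    · simp
    · exact (hwv n).le
  calc _ ≤ S.nrm x + p.toNNReal * C₁ * S.nrm x + C₂ * S.nrm x := by
        refine (enorm_add_le _ _).trans (add_le_add ?_ b3)
        exact (enorm_sub_le).trans (add_le_add b1 b2)
    _ = _ := by push_cast; ring

/-- Quasi-greediness passes to the dual system: on `x`, the functionals `P_B f` and `f ∘ P_E`,
for greedy sets `B` of `f` and `E` of `x` of the same order, differ only by the contributions of
`B \ E`, where `x` is small, and of `E \ B`, where `f` is small. -/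
theorem exists_dual_nrm_proj_le (h : IsKTSystem S p r ι) (hp : 1 < p) (hr : 1 ≤ r) :
    ∃ G : ℝ≥0, ∀ (n : ℕ) (f : S.dualSpan) (B : Finset ℕ), S.dual.IsGreedySet f n B →
      S.dual.nrm (S.dual.proj B f) ≤ G * S.dual.nrm f := by
  obtain ⟨G, hG⟩ := h.exists_nrm_proj_le hp hr
  obtain ⟨C₁, hC₁⟩ := h.exists_coord_mul_le hp.le hr
  obtain ⟨C₂, hC₂⟩ := h.exists_sum_coord_le hp hr
  have hFt : max (flatConst p r) (ENNReal.ofReal p) ≠ ⊤ := by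
    simp [flatConst_ne_top]
  obtain ⟨F, hF⟩ : ∃ F : ℝ≥0, (F : ℝ≥0∞) = max (flatConst p r) (ENNReal.ofReal p) :=
    ⟨_, ENNReal.coe_toNNReal hFt⟩
  refine ⟨G + F * C₁ + F * C₂, fun N f B hB => S.dual_nrm_le fun x => ?_⟩
  rcases Nat.eq_zero_or_pos N with hN | hN
  · rw [Finset.card_eq_zero.1 (hB.1.trans hN)]
    simp [BiorthSystem.proj]
  have hN0 : (N : ℝ≥0∞) ≠ 0 := by exact_mod_cast hN.ne'
  have hNt : (N : ℝ≥0∞) ≠ ⊤ := ENNReal.natCast_ne_top _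
  obtain ⟨E', hE⟩ := h.exists_isGreedySet x N
  rw [S.dual_proj_apply]
  have hf : ∑ n ∈ B, ‖S.dual.coord n f‖ₑ ≤ S.dual.nrm f * (F * (N : ℝ≥0∞) ^ (1 / p)) := by
    refine S.sum_enorm_dual_coord_le (fun c hc => ?_) f
    have := h.nrm_sum_le hp.le hr B (c := c) (a := 1) fun n _ =>
      enorm_le_one_of_norm_le (hc n)
    rwa [one_mul, hB.1, ← hF] at this
  have e : (f : E →ₗ[𝕜] 𝕜) (S.proj B x) = (f : E →ₗ[𝕜] 𝕜) (S.proj E' x) +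
      ∑ n ∈ B \ E', S.coord n x * S.dual.coord n f -
      ∑ n ∈ E' \ B, S.coord n x * S.dual.coord n f := by
    have e1 : ∀ A : Finset ℕ, (f : E →ₗ[𝕜] 𝕜) (S.proj A x) =
        ∑ n ∈ A, S.coord n x * S.dual.coord n f := by
      intro A
      rw [BiorthSystem.proj, map_sum]
      exact Finset.sum_congr rfl fun n _ => by rw [map_smul]; rfl
    rw [e1, e1, ← Finset.sum_inter_add_sum_sdiff B E', ← Finset.sum_inter_add_sum_sdiff E' B,
      Finset.inter_comm E' B]
    ring
  have b1 : ‖(f : E →ₗ[𝕜] 𝕜) (S.proj E' x)‖ₑ ≤ G * (S.dual.nrm f * S.nrm x) := by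
    refine (S.enorm_dual_apply_le f _).trans ?_
    calc _ ≤ S.dual.nrm f * (G * S.nrm x) := by gcongr; exact hG N x E' hE
      _ = _ := by ring
  have b2 : ‖∑ n ∈ B \ E', S.coord n x * S.dual.coord n f‖ₑ ≤
      F * C₁ * (S.dual.nrm f * S.nrm x) := by
    have hNp0 : (N : ℝ≥0∞) ^ (1 / p) ≠ 0 := by
      simp [ENNReal.rpow_eq_zero_iff, hN0]
    have hNpt : (N : ℝ≥0∞) ^ (1 / p) ≠ ⊤ :=
      ENNReal.rpow_ne_top_of_nonneg (by positivity) hNt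
    refine (ENNReal.mul_le_mul_iff_left hNp0 hNpt).1 ?_
    calc _ ≤ (∑ n ∈ B \ E', ‖S.coord n x * S.dual.coord n f‖ₑ) * (N : ℝ≥0∞) ^ (1 / p) := by
          gcongr; exact _root_.enorm_sum_le _ _
      _ ≤ ∑ n ∈ B \ E', (C₁ * S.nrm x) * ‖S.dual.coord n f‖ₑ := by
          rw [Finset.sum_mul]
          refine Finset.sum_le_sum fun n hn => ?_
          rw [enorm_mul, mul_right_comm]
          exact mul_le_mul_left (hC₁ x N E' hE n (Finset.mem_sdiff.1 hn).2) _
      _ ≤ (C₁ * S.nrm x) * (S.dual.nrm f * (F * (N : ℝ≥0∞) ^ (1 / p))) := by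
          rw [← Finset.mul_sum]
          gcongr
          exact (Finset.sum_le_sum_of_subset Finset.sdiff_subset).trans hf
      _ = _ := by ring
  have b3 : ‖∑ n ∈ E' \ B, S.coord n x * S.dual.coord n f‖ₑ ≤
      F * C₂ * (S.dual.nrm f * S.nrm x) := by
    have hmin : ∀ n ∉ B, ‖S.dual.coord n f‖ₑ * N ≤ S.dual.nrm f * (F * (N : ℝ≥0∞) ^ (1 / p)) := by
      intro n hn
      refine le_trans ?_ hf
      rw [mul_comm, ← nsmul_eq_mul, ← hB.1]
      exact Finset.card_nsmul_le_sum _ _ _ fun m hm => enorm_le_iff_norm_le.2 (hB.2 m hm n hn)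
    refine (ENNReal.mul_le_mul_iff_left hN0 hNt).1 ?_
    calc _ ≤ (∑ n ∈ E' \ B, ‖S.coord n x * S.dual.coord n f‖ₑ) * (N : ℝ≥0∞) := by
          gcongr; exact _root_.enorm_sum_le _ _
      _ ≤ ∑ n ∈ E' \ B, (S.dual.nrm f * (F * (N : ℝ≥0∞) ^ (1 / p))) * ‖S.coord n x‖ₑ := by
          rw [Finset.sum_mul]
          refine Finset.sum_le_sum fun n hn => ?_
          rw [enorm_mul, mul_assoc, mul_comm]
          exact mul_le_mul_left (hmin n (Finset.mem_sdiff.1 hn).2) _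
      _ ≤ (S.dual.nrm f * (F * (N : ℝ≥0∞) ^ (1 / p))) *
          (C₂ * (N : ℝ≥0∞) ^ (1 - 1 / p) * S.nrm x) := by
          rw [← Finset.mul_sum]
          gcongr
          refine (Finset.sum_le_sum_of_subset Finset.sdiff_subset).trans ?_
          simpa [hE.1] using hC₂ x E'
      _ = F * C₂ * (S.dual.nrm f * S.nrm x) *
          ((N : ℝ≥0∞) ^ (1 / p) * (N : ℝ≥0∞) ^ (1 - 1 / p)) := by ring
      _ = _ := by
          rw [← ENNReal.rpow_add _ _ hN0 hNt]
          simp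
  rw [e]
  calc _ ≤ G * (S.dual.nrm f * S.nrm x) + F * C₁ * (S.dual.nrm f * S.nrm x) +
        F * C₂ * (S.dual.nrm f * S.nrm x) :=
        (enorm_sub_le).trans (add_le_add ((enorm_add_le _ _).trans (add_le_add b1 b2)) b3)
    _ = _ := by push_cast; ring

end IsKTSystem

end

/-! ### The alternating test vector -/

theorem alternating_sum_mem (L : ℕ) :
    0 ≤ ∑ n ∈ Finset.range L, (-1 : ℝ) ^ n * ((n : ℝ) + 1)⁻¹ ∧
      ∑ n ∈ Finset.range L, (-1 : ℝ) ^ n * ((n : ℝ) + 1)⁻¹ ≤ 1 := by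
  have key : ∀ L : ℕ,
      (Even L → 0 ≤ ∑ n ∈ Finset.range L, (-1 : ℝ) ^ n * ((n : ℝ) + 1)⁻¹ ∧
        ∑ n ∈ Finset.range L, (-1 : ℝ) ^ n * ((n : ℝ) + 1)⁻¹ ≤ 1 - ((L : ℝ) + 1)⁻¹) ∧
      (¬ Even L → ((L : ℝ) + 1)⁻¹ ≤ ∑ n ∈ Finset.range L, (-1 : ℝ) ^ n * ((n : ℝ) + 1)⁻¹ ∧
        ∑ n ∈ Finset.range L, (-1 : ℝ) ^ n * ((n : ℝ) + 1)⁻¹ ≤ 1) := by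
    intro L
    induction L with
    | zero => simp
    | succ L ih =>
      have hd : (((L + 1 : ℕ) : ℝ) + 1)⁻¹ ≤ ((L : ℝ) + 1)⁻¹ := by
        push_cast
        gcongr
        linarith
      have hpos : 0 < (((L + 1 : ℕ) : ℝ) + 1)⁻¹ := by positivity
      rw [Finset.sum_range_succ, Nat.even_add_one]
      refine ⟨fun hL => ?_, fun hL => ?_⟩
      · have h := ih.2 hL
        rw [Nat.not_even_iff_odd] at hL
        rw [hL.neg_one_pow]
        constructor <;> linarith
      · have h := ih.1 (not_not.1 hL)
        rw [(not_not.1 hL).neg_one_pow]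
        constructor <;> linarith
  have hpos : 0 < ((L : ℝ) + 1)⁻¹ := by positivity
  by_cases hL : Even L
  · have := (key L).1 hL
    constructor <;> linarith
  · have := (key L).2 hL
    constructor <;> linarith

theorem harm_le_two_mul_sum_even (N : ℕ) : harm N ≤ 2 * ENNReal.ofReal
    (∑ n ∈ Finset.range (2 * N), if Even n then ((n : ℝ) + 1)⁻¹ else 0) := by
  rw [show (2 : ℝ≥0∞) = ENNReal.ofReal 2 by simp, ← ENNReal.ofReal_mul (by norm_num), harm_eq]
  refine ENNReal.ofReal_le_ofReal ?_
  unfold harmonic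
  push_cast
  induction N with
  | zero => simp
  | succ N ih =>
    have e : 2 * (N + 1) = 2 * N + 1 + 1 := by ring
    rw [e, Finset.sum_range_succ, Finset.sum_range_succ, Finset.sum_range_succ _ (2 * N),
      if_pos (even_two_mul N), if_neg (by simp), add_zero, mul_add]
    refine add_le_add ih ?_
    rw [← div_eq_mul_inv, le_div_iff₀ (by positivity), inv_mul_le_iff₀ (by positivity)]
    push_cast
    linarith

theorem rpow_neg_div_rpow {a p : ℝ} (ha : 0 < a) : a ^ (-(1 / p)) / a ^ (1 - 1 / p) = a⁻¹ := by
  rw [← Real.rpow_sub ha, ← Real.rpow_neg_one]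
  congr 1
  ring

/-- The odd indices below `2 * N`; in the numbering from `1` these are the even ones. -/
def oddBelow (N : ℕ) : Finset ℕ := (Finset.range (2 * N)).filter (¬ Even ·)

theorem oddBelow_subset (N : ℕ) : oddBelow N ⊆ Finset.range (2 * N) := Finset.filter_subset _ _

theorem card_oddBelow (N : ℕ) : (oddBelow N).card = N := by
  unfold oddBelow
  induction N with
  | zero => simp
  | succ N ih =>
    have e : 2 * (N + 1) = 2 * N + 1 + 1 := by ring
    rw [e, Finset.range_add_one, Finset.filter_insert, if_pos (by simp), Finset.range_add_one,
      Finset.filter_insert, if_neg (by simp), Finset.card_insert_of_notMem (by simp), ih]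

theorem card_range_sdiff_oddBelow (N : ℕ) : (Finset.range (2 * N) \ oddBelow N).card = N := by
  rw [Finset.card_sdiff_of_subset (oddBelow_subset N), card_oddBelow, Finset.card_range]
  omega

section

variable {𝕜 : Type*} [RCLike 𝕜] {E : Type*} [AddCommGroup E] [Module 𝕜 E]

/-- The vector `∑ (-1) ^ n * n ^ (-1 / p) * e n` with `M` terms. Its partial sums are small by
cancellation, but those of its projection on every second index are not. -/
noncomputable def BiorthSystem.altVec (S : BiorthSystem 𝕜 E) (p : ℝ) (M : ℕ) : E :=
  ∑ n ∈ Finset.range M, (((-1) ^ n * ((n : ℝ) + 1) ^ (-(1 / p)) : ℝ) : 𝕜) • S.vec n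

/-- The functional `∑ n ^ (-1 / p') * e n ^ *` with `M` terms, whose value is a partial sum in the
definition of `bNrm`. -/
noncomputable def BiorthSystem.weightFun (S : BiorthSystem 𝕜 E) (p : ℝ) (M : ℕ) : S.dualSpan :=
  ∑ n ∈ Finset.range M, ((((n : ℝ) + 1) ^ (1 - 1 / p) : ℝ) : 𝕜)⁻¹ • S.dual.vec n

theorem BiorthSystem.altVec_sub_proj (S : BiorthSystem 𝕜 E) (p : ℝ) (N : ℕ) :
    S.altVec p (2 * N) - S.proj (oddBelow N) (S.altVec p (2 * N)) =
      S.proj (Finset.range (2 * N) \ oddBelow N) (S.altVec p (2 * N)) := by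
  have h1 := S.proj_union (Finset.range (2 * N)) (oddBelow N) (S.altVec p (2 * N))
  rw [Finset.union_eq_left.2 (oddBelow_subset N)] at h1
  have h2 : S.proj (Finset.range (2 * N)) (S.altVec p (2 * N)) = S.altVec p (2 * N) :=
    S.proj_sum_of_subset le_rfl _
  rw [h2] at h1
  exact sub_eq_of_eq_add' h1

namespace IsKTSystem

variable {S : BiorthSystem 𝕜 E} {p : ℝ} {r : ℝ≥0∞} {ι : E →ₗ[𝕜] (ℕ → 𝕜)}

theorem weightFun_apply (h : IsKTSystem S p r ι) (M : ℕ) (x : E) :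
    (S.weightFun p M : E →ₗ[𝕜] 𝕜) x =
      ∑ n ∈ Finset.range M, ι x n / ((((n : ℝ) + 1) ^ (1 - 1 / p) : ℝ) : 𝕜) := by
  rw [BiorthSystem.weightFun, S.dual_sum_apply]
  exact Finset.sum_congr rfl fun n _ => by rw [h.coord_eq, mul_comm, ← div_eq_mul_inv]

theorem enorm_weightFun_le (h : IsKTSystem S p r ι) (M : ℕ) (x : E) :
    ‖(S.weightFun p M : E →ₗ[𝕜] 𝕜) x‖ₑ ≤ S.nrm x := by
  rw [h.weightFun_apply]
  exact h.enorm_sum_le x M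

theorem dual_nrm_weightFun_le (h : IsKTSystem S p r ι) (M : ℕ) :
    S.dual.nrm (S.weightFun p M) ≤ 1 :=
  S.dual_nrm_le fun x => by rw [one_mul]; exact h.enorm_weightFun_le M x

theorem coord_altVec (S : BiorthSystem 𝕜 E) (p : ℝ) (M n : ℕ) : S.coord n (S.altVec p M) =
    if n < M then (((-1) ^ n * ((n : ℝ) + 1) ^ (-(1 / p)) : ℝ) : 𝕜) else 0 := by
  rw [BiorthSystem.altVec,
    S.coord_sum _ fun n : ℕ => (((-1) ^ n * ((n : ℝ) + 1) ^ (-(1 / p)) : ℝ) : 𝕜)]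
  simp

theorem altVec_div_weight (h : IsKTSystem S p r ι) (M n : ℕ) :
    ι (S.altVec p M) n / ((((n : ℝ) + 1) ^ (1 - 1 / p) : ℝ) : 𝕜) =
      ((if n < M then (-1) ^ n * ((n : ℝ) + 1)⁻¹ else 0 : ℝ) : 𝕜) := by
  rw [← h.coord_eq, coord_altVec]
  split_ifs
  · rw [← RCLike.ofReal_div, mul_div_assoc, rpow_neg_div_rpow (by positivity)]
  · simp

theorem nrm_altVec_le (h : IsKTSystem S p r ι) (hp : 1 ≤ p) (hr : 1 ≤ r) {M : ℕ} (hM : 1 ≤ M) :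
    S.nrm (S.altVec p M) ≤ harm M ^ (r⁻¹).toReal := by
  rw [h.nrm_eq]
  refine max_le ?_ (iSup_le fun L => ?_)
  · rw [← one_mul (harm M ^ _)]
    have h0 : ∀ n, ι (S.altVec p M) n ≠ 0 → n < M := by
      intro n hn
      by_contra hc
      rw [← h.coord_eq, coord_altVec, if_neg hc] at hn
      exact hn rfl
    refine lorentzNrm_le_of_injOn hr (φ := id) (Set.injOn_id _) h0 (fun n hn => ?_) hp
    rw [← h.coord_eq, coord_altVec, if_pos (h0 n hn), ← ofReal_norm, RCLike.norm_ofReal, abs_mul,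
      abs_pow, abs_neg, abs_one, one_pow, one_mul, abs_of_pos (by positivity),
      ofReal_cast_add_one_rpow, id, ← cast_add_one_rpow_add]
    simp
  · have e : ∑ n ∈ Finset.range L,
        ι (S.altVec p M) n / ((((n : ℝ) + 1) ^ (1 - 1 / p) : ℝ) : 𝕜) =
        ((∑ n ∈ Finset.range (min L M), (-1) ^ n * ((n : ℝ) + 1)⁻¹ : ℝ) : 𝕜) := by
      have e1 : Finset.range (min L M) = (Finset.range L).filter (· < M) := by
        ext n; simp
      rw [e1, Finset.sum_filter, RCLike.ofReal_sum]
      exact Finset.sum_congr rfl fun n _ => h.altVec_div_weight M n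
    rw [e]
    have hb := alternating_sum_mem (min L M)
    have h1 : (1 : ℝ≥0∞) ≤ harm M ^ (r⁻¹).toReal := by
      simpa using ENNReal.rpow_le_rpow (one_le_harm hM) (ENNReal.toReal_nonneg (a := r⁻¹))
    refine (enorm_le_one_of_norm_le ?_).trans h1
    rw [RCLike.norm_ofReal, abs_of_nonneg hb.1]
    exact hb.2

theorem harm_le_enorm_weightFun (h : IsKTSystem S p r ι) (N : ℕ) :
    harm N ≤ 2 * ‖(S.weightFun p (2 * N) : E →ₗ[𝕜] 𝕜)
      (S.proj (Finset.range (2 * N) \ oddBelow N) (S.altVec p (2 * N)))‖ₑ := by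
  have e : (S.weightFun p (2 * N) : E →ₗ[𝕜] 𝕜)
      (S.proj (Finset.range (2 * N) \ oddBelow N) (S.altVec p (2 * N))) =
      ((∑ n ∈ Finset.range (2 * N), if Even n then ((n : ℝ) + 1)⁻¹ else 0 : ℝ) : 𝕜) := by
    rw [h.weightFun_apply, RCLike.ofReal_sum]
    refine Finset.sum_congr rfl fun n hn => ?_
    rw [Finset.mem_range] at hn
    have hm : n ∈ Finset.range (2 * N) \ oddBelow N ↔ Even n := by
      simp [oddBelow, hn]
    rw [h.map_proj_apply]
    simp only [hm]
    split_ifs with he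
    · rw [h.altVec_div_weight, if_pos hn, he.neg_one_pow, one_mul]
    · simp
  rw [e, ← ofReal_norm, RCLike.norm_ofReal, abs_of_nonneg]
  · exact harm_le_two_mul_sum_even N
  · refine Finset.sum_nonneg fun n _ => ?_
    split_ifs <;> positivity

/-- Any operator norm `T` that controls the value of the test functional at a projection of the test
vector is bounded from below, as this value is of order `ln N` and the vector has norm at most
`[1 + 1/2 + ⋯ + 1/(2N)]^{1/r}`. -/
theorem harmRate_le_of_enorm_weightFun_le (h : IsKTSystem S p r ι) (hp : 1 ≤ p) (hr : 1 ≤ r)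
    {N : ℕ} (hN : 1 ≤ N) {T : ℝ≥0∞} (hT : ‖(S.weightFun p (2 * N) : E →ₗ[𝕜] 𝕜)
      (S.proj (Finset.range (2 * N) \ oddBelow N) (S.altVec p (2 * N)))‖ₑ ≤
        T * S.nrm (S.altVec p (2 * N))) : harmRate r N ≤ (4 : ℝ≥0) * T := by
  obtain ⟨ht0, ht1⟩ := toReal_inv_nonneg_le_one hr
  have h0 : harm N ≠ 0 := (zero_lt_one.trans_le (one_le_harm hN)).ne'
  refine rpow_le_of_le_mul_rpow h0 (harm_ne_top N) ?_
  calc harm N ≤ 2 * (T * harm (2 * N) ^ (r⁻¹).toReal) := by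
        refine (h.harm_le_enorm_weightFun N).trans ?_
        gcongr
        exact hT.trans (mul_le_mul_right (h.nrm_altVec_le hp hr (by omega)) _)
    _ ≤ 2 * (T * (2 * harm N ^ (r⁻¹).toReal)) := by
        gcongr
        exact (ENNReal.rpow_le_rpow (harm_two_mul_le N) ht0).trans
          (mul_rpow_le_of_le_one _ (by norm_num) ht0 ht1)
    _ = _ := by push_cast; ring

theorem harmRate_le_condConst (h : IsKTSystem S p r ι) (hp : 1 ≤ p) (hr : 1 ≤ r) {N : ℕ}
    (hN : 1 ≤ N) : harmRate r N ≤ (4 : ℝ≥0) * S.condConst N :=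
  h.harmRate_le_of_enorm_weightFun_le hp hr hN ((h.enorm_weightFun_le _ _).trans
    (S.nrm_proj_le_condConst (card_range_sdiff_oddBelow N).le _))

theorem harmRate_le_lebesgue (h : IsKTSystem S p r ι) (hp : 1 ≤ p) (hr : 1 ≤ r) {N : ℕ}
    (hN : 1 ≤ N) : harmRate r N ≤ (4 : ℝ≥0) * S.lebesgue N := by
  refine h.harmRate_le_of_enorm_weightFun_le hp hr hN ((h.enorm_weightFun_le _ _).trans ?_)
  rw [← S.altVec_sub_proj]
  exact S.nrm_sub_proj_le_lebesgue (M := 2 * N) (card_oddBelow N).le fun n hn => by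
    rw [coord_altVec, if_neg (by omega)]

theorem enorm_weightFun_proj_le (h : IsKTSystem S p r ι) {N : ℕ} {L : ℝ≥0∞}
    (hL : S.dual.nrm (S.weightFun p (2 * N) - S.dual.proj (oddBelow N) (S.weightFun p (2 * N))) ≤
      L * S.dual.nrm (S.weightFun p (2 * N))) :
    ‖(S.weightFun p (2 * N) : E →ₗ[𝕜] 𝕜)
      (S.proj (Finset.range (2 * N) \ oddBelow N) (S.altVec p (2 * N)))‖ₑ ≤
        L * S.nrm (S.altVec p (2 * N)) := by
  rw [← S.altVec_sub_proj, map_sub, ← S.dual_proj_apply]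
  refine (S.enorm_dual_apply_le
    (S.weightFun p (2 * N) - S.dual.proj (oddBelow N) (S.weightFun p (2 * N)))
    (S.altVec p (2 * N))).trans (mul_le_mul_left (hL.trans ?_) _)
  exact (mul_le_mul_right (h.dual_nrm_weightFun_le _) _).trans_eq (mul_one L)

theorem coord_weightFun (S : BiorthSystem 𝕜 E) (p : ℝ) (M n : ℕ) :
    S.dual.coord n (S.weightFun p M) =
      if n < M then ((((n : ℝ) + 1) ^ (1 - 1 / p) : ℝ) : 𝕜)⁻¹ else 0 := by
  rw [BiorthSystem.weightFun,
    S.dual.coord_sum _ fun n : ℕ => ((((n : ℝ) + 1) ^ (1 - 1 / p) : ℝ) : 𝕜)⁻¹]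
  simp

theorem harmRate_le_dual_lebesgue (h : IsKTSystem S p r ι) (hp : 1 ≤ p) (hr : 1 ≤ r) {N : ℕ}
    (hN : 1 ≤ N) : harmRate r N ≤ (4 : ℝ≥0) * S.dual.lebesgue N :=
  h.harmRate_le_of_enorm_weightFun_le hp hr hN (h.enorm_weightFun_proj_le
    (S.dual.nrm_sub_proj_le_lebesgue (M := 2 * N) (card_oddBelow N).le fun n hn => by
      rw [coord_weightFun, if_neg (by omega)]))

/-- For `p = 1` all coordinates of the test functional are equal, so that every subset of its
support is greedy. -/
theorem harmRate_le_dual_lebesgueExp (h : IsKTSystem S 1 r ι) (hr : 1 ≤ r) {N : ℕ}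
    (hN : 1 ≤ N) : harmRate r N ≤ (4 : ℝ≥0) * S.dual.lebesgueExp N := by
  refine h.harmRate_le_of_enorm_weightFun_le le_rfl hr hN (h.enorm_weightFun_proj_le
    (S.dual.nrm_sub_proj_le_lebesgueExp (n := N) (M := 2 * N) ⟨card_oddBelow N, fun n hn m _ => ?_⟩
      le_rfl fun n hn => by rw [coord_weightFun, if_neg (by omega)]))
  have hn' : n < 2 * N := Finset.mem_range.1 (oddBelow_subset N hn)
  rw [coord_weightFun, coord_weightFun, if_pos hn']
  split_ifs <;> simp

/-! ### Democracy functions for `p = 1` -/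

theorem nrm_sum_le_card (h : IsKTSystem S 1 r ι) (hr : 1 ≤ r) (A : Finset ℕ) {c : ℕ → 𝕜}
    (hc : ∀ n, ‖c n‖ ≤ 1) : S.nrm (∑ n ∈ A, c n • S.vec n) ≤ A.card := by
  have := h.nrm_sum_le le_rfl hr A (a := 1) (c := c) fun n _ => enorm_le_one_of_norm_le (hc n)
  simpa [flatConst_one hr] using this

theorem upperDem_eq (h : IsKTSystem S 1 r ι) (hr : 1 ≤ r) (N : ℕ) : S.upperDem N = N := by
  refine le_antisymm ?_ ?_
  · refine iSup₂_le fun A hA => iSup₂_le fun ε hε => ?_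
    rw [← hA]
    exact h.nrm_sum_le_card hr A fun n => (hε n).le
  · refine le_iSup₂_of_le (Finset.range N) (Finset.card_range N)
      (le_iSup₂_of_le (fun _ => 1) (fun _ => norm_one) ?_)
    refine le_trans ?_ (h.enorm_sum_le _ N)
    have e : ∑ n ∈ Finset.range N, ι (S.ind (fun _ => 1) (Finset.range N)) n /
        ((((n : ℝ) + 1) ^ (1 - 1 / (1 : ℝ)) : ℝ) : 𝕜) = ((N : ℝ) : 𝕜) := by
      rw [Finset.sum_congr rfl fun n hn => by
        rw [BiorthSystem.ind, h.map_sum_apply _ fun _ => (1 : 𝕜), if_pos hn]]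
      simp
    rw [e, ← ofReal_norm, RCLike.norm_ofReal, Nat.abs_cast, ENNReal.ofReal_natCast]

theorem nrm_vec_le (h : IsKTSystem S 1 r ι) (hr : 1 ≤ r) (n : ℕ) : S.nrm (S.vec n) ≤ 1 := by
  simpa using h.nrm_sum_le_card hr {n} (c := fun _ => 1) (by simp)

theorem dual_ind_le (h : IsKTSystem S 1 r ι) (hr : 1 ≤ r) (A : Finset ℕ) {ε : ℕ → 𝕜}
    (hε : ∀ n, ‖ε n‖ = 1) : S.dual.nrm (S.dual.ind ε A) ≤ harmRate r A.card := by
  refine S.dual_nrm_le fun x => ?_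
  rw [BiorthSystem.ind, S.dual_sum_apply]
  refine ((_root_.enorm_sum_le _ _).trans ?_).trans (h.sum_coord_le hr x A)
  refine Finset.sum_le_sum fun n _ => ?_
  rw [enorm_mul]
  calc _ ≤ 1 * ‖S.coord n x‖ₑ := by
        gcongr
        exact enorm_le_one_of_norm_le (hε n).le
    _ = _ := one_mul _

theorem one_le_dual_ind (h : IsKTSystem S 1 r ι) (hr : 1 ≤ r) {A : Finset ℕ} (hA : 1 ≤ A.card)
    {ε : ℕ → 𝕜} (hε : ∀ n, ‖ε n‖ = 1) : 1 ≤ S.dual.nrm (S.dual.ind ε A) := by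
  obtain ⟨m, hm⟩ := Finset.card_pos.1 hA
  have h1 := S.enorm_dual_apply_le (S.dual.ind ε A) (S.vec m)
  rw [← S.dual_coord, BiorthSystem.ind, S.dual.coord_sum, if_pos hm, ← ofReal_norm, hε m,
    ENNReal.ofReal_one] at h1
  exact h1.trans ((mul_le_mul_right (h.nrm_vec_le hr m) _).trans_eq (mul_one _))

theorem dual_upperDem_le (h : IsKTSystem S 1 r ι) (hr : 1 ≤ r) (N : ℕ) :
    S.dual.upperDem N ≤ harmRate r N :=
  iSup₂_le fun A hA => iSup₂_le fun _ hε => hA ▸ h.dual_ind_le hr A hε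

theorem one_le_dual_lowerDem (h : IsKTSystem S 1 r ι) (hr : 1 ≤ r) {N : ℕ} (hN : 1 ≤ N) :
    1 ≤ S.dual.lowerDem N :=
  le_iInf₂ fun _ hA => le_iInf₂ fun _ hε => h.one_le_dual_ind hr (by omega) hε

theorem one_le_dual_upperDem (h : IsKTSystem S 1 r ι) (hr : 1 ≤ r) {N : ℕ} (hN : 1 ≤ N) :
    1 ≤ S.dual.upperDem N :=
  (h.one_le_dual_ind hr (A := Finset.range N) (by simpa) (ε := fun _ => 1) fun _ =>
    norm_one).trans (le_iSup₂_of_le (Finset.range N) (Finset.card_range N)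
      (le_iSup₂_of_le (fun _ => 1) (fun _ => norm_one) le_rfl))

/-- The indicator of the first `N` indices is a partial sum functional. -/
theorem dual_lowerDem_le (h : IsKTSystem S 1 r ι) (N : ℕ) : S.dual.lowerDem N ≤ 1 := by
  refine iInf₂_le_of_le (Finset.range N) (Finset.card_range N)
    (iInf₂_le_of_le (fun _ => 1) (fun _ => norm_one) ?_)
  have e : S.dual.ind (fun _ => 1) (Finset.range N) = S.weightFun 1 N := by
    simp [BiorthSystem.ind, BiorthSystem.weightFun]
  rw [e]
  exact h.dual_nrm_weightFun_le N

/-- The functional with alternating signs is tested on the alternating vector. -/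
theorem harmRate_le_dual_upperDem (h : IsKTSystem S 1 r ι) (hr : 1 ≤ r) {N : ℕ} (hN : 1 ≤ N) :
    harmRate r N ≤ S.dual.upperDem N := by
  have hε : ∀ n : ℕ, ‖((-1) ^ n : 𝕜)‖ = 1 := by simp
  have h0 : harm N ≠ 0 := (zero_lt_one.trans_le (one_le_harm hN)).ne'
  refine rpow_le_of_le_mul_rpow h0 (harm_ne_top N) ?_
  have h1 := S.enorm_dual_apply_le (S.dual.ind (fun n => (-1) ^ n) (Finset.range N))
    (S.altVec 1 N)
  have e : (S.dual.ind (fun n => (-1) ^ n) (Finset.range N) : E →ₗ[𝕜] 𝕜) (S.altVec 1 N) =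
      ((harmonic N : ℝ) : 𝕜) := by
    rw [BiorthSystem.ind, S.dual_sum_apply, harmonic]
    push_cast
    refine Finset.sum_congr rfl fun n hn => ?_
    rw [coord_altVec, if_pos (Finset.mem_range.1 hn), RCLike.ofReal_mul, ← mul_assoc,
      RCLike.ofReal_pow, RCLike.ofReal_neg, RCLike.ofReal_one, ← mul_pow]
    simp [Real.rpow_neg_one]
  have hh : (0 : ℝ) ≤ (harmonic N : ℝ) := by
    have := (log_add_one_le_harmonic N)
    exact (Real.log_nonneg (by simp)).trans this
  rw [e, ← ofReal_norm, RCLike.norm_ofReal, abs_of_nonneg hh, ← harm_eq] at h1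
  refine h1.trans (mul_le_mul' ?_ (h.nrm_altVec_le le_rfl hr hN))
  exact le_iSup₂_of_le (Finset.range N) (Finset.card_range N) (le_iSup₂_of_le _ hε le_rfl)

theorem isSuperdemocratic (h : IsKTSystem S 1 r ι) (hr : 1 ≤ r) : S.IsSuperdemocratic := by
  obtain ⟨C, hC⟩ := h.exists_le_nrm le_rfl hr
  refine ⟨C, fun N => iSup_le fun n => iSup₂_le fun hn _ => ?_⟩
  have hlow : (n : ℝ≥0∞) ≤ C * S.lowerDem n := by
    have hC0 : (C : ℝ≥0∞) ≠ 0 := fun h0 => by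
      have := hC (S.vec 0) {0} 1 (by simp [S.biorth])
      simp [h0] at this
    rw [← ENNReal.div_le_iff' hC0 ENNReal.coe_ne_top]
    refine le_iInf₂ fun A hA => le_iInf₂ fun ε hε => ?_
    rw [ENNReal.div_le_iff' hC0 ENNReal.coe_ne_top]
    have := hC (S.ind ε A) A 1 fun m hm => by
      rw [BiorthSystem.ind, S.coord_sum, if_pos hm, ← ofReal_norm, hε m, ENNReal.ofReal_one]
    simpa [hA] using this
  rw [h.upperDem_eq hr]
  exact ENNReal.div_le_of_le_mul hlow

theorem comparable_dual_superdemConst (h : IsKTSystem S 1 r ι) (hr : 1 ≤ r) :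
    Comparable S.dual.superdemConst (logRate r) := by
  refine comparable_logRate hr ⟨1, fun N hN => ?_⟩ ⟨1, fun N hN => ?_⟩
  · rw [ENNReal.coe_one, one_mul]
    refine le_trans ?_ (le_iSup_of_le N (le_iSup₂_of_le hN le_rfl le_rfl))
    refine (h.harmRate_le_dual_upperDem hr hN).trans ?_
    calc S.dual.upperDem N = S.dual.upperDem N / 1 := by simp
      _ ≤ _ := ENNReal.div_le_div_left (h.dual_lowerDem_le N) _
  · rw [ENNReal.coe_one, one_mul]
    refine iSup_le fun n => iSup₂_le fun hn hnN => ?_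
    calc _ ≤ S.dual.upperDem n / 1 := ENNReal.div_le_div_left (h.one_le_dual_lowerDem hr hn) _
      _ ≤ harmRate r N := by
          rw [div_one]
          exact (h.dual_upperDem_le hr n).trans (harmRate_mono hr hnN)

/-- Since `D(j) = j`, the first sum telescopes to `D^*(N)`, while the second one is at least
`1 + 1/2 + ⋯ + 1/N`. -/
theorem comparable_overT (h : IsKTSystem S 1 r ι) (hr : 1 ≤ r) :
    Comparable (fun N => ENNReal.ofReal (S.overT N)) (logRate r) := by
  have hD : ∀ n, (S.upperDem n).toReal = n := fun n => by simp [h.upperDem_eq hr]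
  have hfin : ∀ n, S.dual.upperDem n ≠ ⊤ := fun n =>
    ((h.dual_upperDem_le hr n).trans_lt (harmRate_ne_top hr n).lt_top).ne
  have e1 : ∀ N, 1 ≤ N → weightT (fun n => (S.upperDem n).toReal)
      (fun n => (S.dual.upperDem n).toReal) N = (S.dual.upperDem N).toReal := by
    intro N hN
    unfold weightT
    simp only [hD]
    induction N, hN using Nat.le_induction with
    | base => simp [weightDiff]
    | succ N hN ih =>
      rw [Finset.sum_Icc_succ_top (by omega), ih, weightDiff, if_neg (by omega)]
      have : ((N + 1 : ℕ) : ℝ) ≠ 0 := by positivity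
      rw [div_self this]
      simp
  have e2 : ∀ N, harm N ≤ ENNReal.ofReal (weightT (fun n => (S.dual.upperDem n).toReal)
      (fun n => (S.upperDem n).toReal) N) := by
    intro N
    rw [harm_eq, harmonic_eq_sum_Icc]
    refine ENNReal.ofReal_le_ofReal ?_
    unfold weightT
    push_cast
    refine Finset.sum_le_sum fun j hj => ?_
    have hj1 := (Finset.mem_Icc.1 hj).1
    have hw : weightDiff (fun n => (S.upperDem n).toReal) j = 1 := by
      simp only [weightDiff, hD]
      split_ifs
      · simp
      · rw [Nat.cast_sub hj1]; simp
    have h1 : 1 ≤ (S.dual.upperDem j).toReal := by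
      simpa using ENNReal.toReal_mono (hfin j) (h.one_le_dual_upperDem hr hj1)
    rw [hw, mul_one, inv_eq_one_div]
    gcongr
  refine comparable_logRate hr ⟨1, fun N hN => ?_⟩ ⟨1, fun N hN => ?_⟩
  · rw [ENNReal.coe_one, one_mul, BiorthSystem.overT, ENNReal.ofReal_min, e1 N hN,
      ENNReal.ofReal_toReal (hfin N)]
    exact le_min (h.harmRate_le_dual_upperDem hr hN) ((harmRate_le_harm hN).trans (e2 N))
  · rw [ENNReal.coe_one, one_mul, BiorthSystem.overT, ENNReal.ofReal_min, e1 N hN,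
      ENNReal.ofReal_toReal (hfin N)]
    exact (min_le_left _ _).trans (h.dual_upperDem_le hr N)

/-! ### Bidemocracy for `p > 1` -/

theorem isBidemocratic (h : IsKTSystem S p r ι) (hp : 1 < p) (hr : 1 ≤ r) :
    S.IsBidemocratic := by
  obtain ⟨C, hC⟩ := h.exists_sum_coord_le hp hr
  have hFt : max (flatConst p r) (ENNReal.ofReal p) ≠ ⊤ := by
    simp [flatConst_ne_top]
  refine ⟨(max (flatConst p r) (ENNReal.ofReal p)).toNNReal * C, fun N hN => ?_⟩
  have hN0 : (N : ℝ≥0∞) ≠ 0 := by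
    have : N ≠ 0 := by omega
    exact_mod_cast this
  have h1 : S.upperDem N ≤ max (flatConst p r) (ENNReal.ofReal p) * (N : ℝ≥0∞) ^ (1 / p) := by
    refine iSup₂_le fun A hA => iSup₂_le fun ε hε => ?_
    have := h.nrm_sum_le hp.le hr A (a := 1) (c := ε) fun n _ =>
      enorm_le_one_of_norm_le (hε n).le
    rwa [one_mul, hA] at this
  have h2 : S.dual.upperDem N ≤ C * (N : ℝ≥0∞) ^ (1 - 1 / p) := by
    refine iSup₂_le fun A hA => iSup₂_le fun ε hε => S.dual_nrm_le fun x => ?_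
    rw [BiorthSystem.ind, S.dual_sum_apply, ← hA]
    refine (_root_.enorm_sum_le _ _).trans (le_trans (Finset.sum_le_sum fun n _ => ?_) (hC x A))
    rw [enorm_mul]
    calc _ ≤ 1 * ‖S.coord n x‖ₑ := by
          gcongr
          exact enorm_le_one_of_norm_le (hε n).le
      _ = _ := one_mul _
  push_cast
  rw [ENNReal.coe_toNNReal hFt]
  calc _ ≤ (max (flatConst p r) (ENNReal.ofReal p) * (N : ℝ≥0∞) ^ (1 / p)) *
        (C * (N : ℝ≥0∞) ^ (1 - 1 / p)) := mul_le_mul' h1 h2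
    _ = max (flatConst p r) (ENNReal.ofReal p) * C *
        ((N : ℝ≥0∞) ^ (1 / p) * (N : ℝ≥0∞) ^ (1 - 1 / p)) := by ring
    _ = _ := by
        rw [← ENNReal.rpow_add _ _ hN0 (ENNReal.natCast_ne_top _)]
        simp

end IsKTSystem

end

/-! ### The dyadic test vector for `p = 1` -/

/-- A block of `a` entries `1 / a`, followed by `b` entries `-1 / b`. -/
noncomputable def balancedBlock (a b i : ℕ) : ℝ :=
  if i < a then (a : ℝ)⁻¹ else if i < a + b then -(b : ℝ)⁻¹ else 0

theorem sum_balancedBlock (a b t : ℕ) :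
    ∑ i ∈ Finset.range t, balancedBlock a b i =
      (min t a : ℕ) * (a : ℝ)⁻¹ - (min (t - a) b : ℕ) * (b : ℝ)⁻¹ := by
  induction t with
  | zero => simp
  | succ t ih =>
    rw [Finset.sum_range_succ, ih, balancedBlock]
    split_ifs with h1 h2
    · rw [min_eq_left h1.le, min_eq_left (by omega : t + 1 ≤ a), Nat.sub_eq_zero_of_le h1.le,
        Nat.sub_eq_zero_of_le (by omega : t + 1 ≤ a)]
      push_cast
      ring
    · rw [min_eq_right (by omega : a ≤ t), min_eq_right (by omega : a ≤ t + 1),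
        min_eq_left (by omega : t - a ≤ b), min_eq_left (by omega : t + 1 - a ≤ b),
        show t + 1 - a = t - a + 1 by omega]
      push_cast
      ring
    · rw [min_eq_right (by omega : a ≤ t), min_eq_right (by omega : a ≤ t + 1),
        min_eq_right (by omega : b ≤ t - a), min_eq_right (by omega : b ≤ t + 1 - a)]
      ring

theorem sum_balancedBlock_mem {a b : ℕ} (ha : 0 < a) (hb : 0 < b) (t : ℕ) :
    0 ≤ ∑ i ∈ Finset.range t, balancedBlock a b i ∧
      ∑ i ∈ Finset.range t, balancedBlock a b i ≤ 1 := by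
  have ha' : (0 : ℝ) < a := by exact_mod_cast ha
  have hb' : (0 : ℝ) < b := by exact_mod_cast hb
  have h1 : ((min t a : ℕ) : ℝ) * (a : ℝ)⁻¹ ≤ 1 := by
    rw [← div_eq_mul_inv, div_le_one ha']
    exact_mod_cast min_le_right t a
  have h2 : ((min (t - a) b : ℕ) : ℝ) * (b : ℝ)⁻¹ ≤ 1 := by
    rw [← div_eq_mul_inv, div_le_one hb']
    exact_mod_cast min_le_right (t - a) b
  have h3 : (0 : ℝ) ≤ (min (t - a) b : ℕ) * (b : ℝ)⁻¹ := by positivity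
  rw [sum_balancedBlock]
  refine ⟨?_, by linarith⟩
  rcases le_total a t with h | h
  · rw [min_eq_right h, mul_inv_cancel₀ ha'.ne']
    linarith
  · rw [Nat.sub_eq_zero_of_le h]
    simp only [zero_le, inf_of_le_left, CharP.cast_eq_zero, zero_mul, sub_zero]
    positivity

theorem sum_balancedBlock_eq_zero {a b t : ℕ} (ha : 0 < a) (hb : 0 < b) (ht : a + b ≤ t) :
    ∑ i ∈ Finset.range t, balancedBlock a b i = 0 := by
  have ha' : (a : ℝ) ≠ 0 := by exact_mod_cast ha.ne'
  have hb' : (b : ℝ) ≠ 0 := by exact_mod_cast hb.ne'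
  rw [sum_balancedBlock, min_eq_right (by omega), min_eq_right (by omega),
    mul_inv_cancel₀ ha', mul_inv_cancel₀ hb', sub_self]

theorem sum_range_div_mod {W : ℕ} (F : ℕ → ℕ → ℝ) (q t : ℕ) (ht : t ≤ W) :
    ∑ n ∈ Finset.range (W * q + t), F (n / W) (n % W) =
      ∑ k ∈ Finset.range q, ∑ i ∈ Finset.range W, F k i + ∑ i ∈ Finset.range t, F q i := by
  have step : ∀ q t, t ≤ W → ∑ i ∈ Finset.range t, F ((W * q + i) / W) ((W * q + i) % W) =
      ∑ i ∈ Finset.range t, F q i := by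
    intro q t ht
    refine Finset.sum_congr rfl fun i hi => ?_
    have hi' : i < W := (Finset.mem_range.1 hi).trans_le ht
    rw [Nat.mul_add_div (by omega), Nat.div_eq_of_lt hi', add_zero, Nat.mul_add_mod,
      Nat.mod_eq_of_lt hi']
  rw [Finset.sum_range_add, step q t ht]
  congr 1
  induction q with
  | zero => simp
  | succ q ih => rw [mul_add, mul_one, Finset.sum_range_add, ih, step q W le_rfl,
      Finset.sum_range_succ]

theorem two_pow_add_inj {g g' i i' : ℕ} (hi : i < 2 ^ g) (hi' : i' < 2 ^ g')
    (h : 2 ^ g + i = 2 ^ g' + i') : g = g' ∧ i = i' := by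
  have hg : g = g' := by
    rcases lt_trichotomy g g' with hlt | rfl | hlt
    · have := Nat.pow_le_pow_right (n := 2) (by norm_num) (Nat.succ_le_of_lt hlt)
      rw [pow_succ] at this
      omega
    · rfl
    · have := Nat.pow_le_pow_right (n := 2) (by norm_num) (Nat.succ_le_of_lt hlt)
      rw [pow_succ] at this
      omega
  subst hg
  exact ⟨rfl, by omega⟩

/-- The length of the blocks in `dyadicSeq`. -/
def blockLen (K : ℕ) : ℕ := 2 ^ K + 2 ^ (K + K)

/-- `K` blocks, the `q`-th of which consists of `2 ^ q` entries `2 ^ (-q)`, followed by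
`2 ^ (K + q)` entries `-2 ^ (-(K + q))` and some zeros. The positive entries form a greedy set. The
moduli are, up to a factor `2`, a rearrangement of `1, 1/2, 1/3, …, 4 ^ (-K)`. -/
noncomputable def dyadicSeq (K n : ℕ) : ℝ :=
  if n / blockLen K < K then
    balancedBlock (2 ^ (n / blockLen K)) (2 ^ (K + n / blockLen K)) (n % blockLen K) else 0

/-- The set of positive entries of `dyadicSeq K`. -/
def dyadicPos (K : ℕ) : Finset ℕ :=
  (Finset.range (blockLen K * K)).filter fun n => n % blockLen K < 2 ^ (n / blockLen K)

/-- The position of the entry `n` in a non-increasing rearrangement of `|dyadicSeq K|`. -/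
def dyadicRank (K n : ℕ) : ℕ :=
  if n % blockLen K < 2 ^ (n / blockLen K) then 2 ^ (n / blockLen K) + n % blockLen K - 1
  else 2 ^ (K + n / blockLen K) + (n % blockLen K - 2 ^ (n / blockLen K)) - 1

theorem blockLen_pos (K : ℕ) : 0 < blockLen K := by
  unfold blockLen; positivity

theorem le_blockLen {K q : ℕ} (hq : q < K) : 2 ^ q + 2 ^ (K + q) ≤ blockLen K :=
  add_le_add (Nat.pow_le_pow_right (by norm_num) hq.le)
    (Nat.pow_le_pow_right (by norm_num) (by omega))

theorem dyadicSeq_eq_zero {K n : ℕ} (hn : blockLen K * K ≤ n) : dyadicSeq K n = 0 := by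
  rw [dyadicSeq, if_neg]
  rw [not_lt, Nat.le_div_iff_mul_le (blockLen_pos K), mul_comm]
  exact hn

theorem dyadicSeq_ne_zero {K n : ℕ} (hn : dyadicSeq K n ≠ 0) : n / blockLen K < K ∧
    n % blockLen K < 2 ^ (n / blockLen K) + 2 ^ (K + n / blockLen K) := by
  unfold dyadicSeq balancedBlock at hn
  split_ifs at hn with h1 h2 h3
  · exact ⟨h1, h2.trans_le (Nat.le_add_right _ _)⟩
  · exact ⟨h1, h3⟩
  · exact absurd rfl hn
  · exact absurd rfl hn

theorem mem_dyadicPos {K n : ℕ} : n ∈ dyadicPos K ↔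
    n / blockLen K < K ∧ n % blockLen K < 2 ^ (n / blockLen K) := by
  rw [dyadicPos, Finset.mem_filter, Finset.mem_range, Nat.div_lt_iff_lt_mul (blockLen_pos K),
    mul_comm]

theorem dyadicSeq_of_mem {K n : ℕ} (hn : n ∈ dyadicPos K) :
    dyadicSeq K n = ((2 : ℝ) ^ (n / blockLen K))⁻¹ := by
  rw [mem_dyadicPos] at hn
  rw [dyadicSeq, if_pos hn.1, balancedBlock, if_pos hn.2]
  push_cast
  rfl

theorem abs_dyadicSeq_le_of_notMem {K n : ℕ} (hn : n ∉ dyadicPos K) :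
    |dyadicSeq K n| ≤ ((2 : ℝ) ^ K)⁻¹ := by
  rw [mem_dyadicPos, not_and] at hn
  unfold dyadicSeq balancedBlock
  split_ifs with h1 h2 h3
  · exact absurd h2 (hn h1)
  · rw [abs_neg, abs_of_nonneg (by positivity)]
    push_cast
    gcongr
    · norm_num
    · exact Nat.le_add_right _ _
  · simp
  · simp

theorem le_dyadicSeq_of_mem {K n : ℕ} (hn : n ∈ dyadicPos K) :
    ((2 : ℝ) ^ K)⁻¹ ≤ dyadicSeq K n := by
  rw [dyadicSeq_of_mem hn]
  gcongr
  · norm_num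
  · exact (mem_dyadicPos.1 hn).1.le

theorem sum_dyadicSeq_mem (K L : ℕ) : 0 ≤ ∑ n ∈ Finset.range L, dyadicSeq K n ∧
    ∑ n ∈ Finset.range L, dyadicSeq K n ≤ 1 := by
  have h := sum_range_div_mod (W := blockLen K)
    (fun q i => if q < K then balancedBlock (2 ^ q) (2 ^ (K + q)) i else 0) (L / blockLen K)
    (L % blockLen K) (Nat.mod_lt _ (blockLen_pos K)).le
  rw [Nat.div_add_mod] at h
  have e : ∑ n ∈ Finset.range L, dyadicSeq K n = _ := h
  rw [e, Finset.sum_eq_zero fun q _ => ?_, zero_add]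
  · split_ifs
    · exact sum_balancedBlock_mem (by positivity) (by positivity) _
    · simp
  · split_ifs with hq
    · exact sum_balancedBlock_eq_zero (by positivity) (by positivity) (le_blockLen hq)
    · simp

theorem sum_dyadicSeq_eq_zero (K : ℕ) :
    ∑ n ∈ Finset.range (blockLen K * K), dyadicSeq K n = 0 := by
  have h := sum_range_div_mod (W := blockLen K)
    (fun q i => if q < K then balancedBlock (2 ^ q) (2 ^ (K + q)) i else 0) K 0 (Nat.zero_le _)
  rw [add_zero] at h
  have e : ∑ n ∈ Finset.range (blockLen K * K), dyadicSeq K n = _ := h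
  rw [e, Finset.sum_eq_zero fun q hq => ?_]
  · simp
  · simp only [if_pos (Finset.mem_range.1 hq)]
    exact sum_balancedBlock_eq_zero (by positivity) (by positivity)
      (le_blockLen (Finset.mem_range.1 hq))

theorem sum_dyadicPos (K : ℕ) : ∑ n ∈ Finset.range (blockLen K * K),
    (if n ∈ dyadicPos K then dyadicSeq K n else 0) = K := by
  have h := sum_range_div_mod (W := blockLen K)
    (fun q i => if i < 2 ^ q then ((2 : ℝ) ^ q)⁻¹ else 0) K 0 (Nat.zero_le _)
  rw [add_zero] at h
  refine (Eq.trans (Finset.sum_congr rfl fun n hn => ?_) h).trans ?_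
  · have hq : n / blockLen K < K := by
      rw [Nat.div_lt_iff_lt_mul (blockLen_pos K), mul_comm]
      exact Finset.mem_range.1 hn
    by_cases hm : n ∈ dyadicPos K
    · rw [if_pos hm, dyadicSeq_of_mem hm, if_pos (mem_dyadicPos.1 hm).2]
    · rw [if_neg hm, if_neg fun hlt => hm (mem_dyadicPos.2 ⟨hq, hlt⟩)]
  have hblock : ∀ q ∈ Finset.range K, ∑ i ∈ Finset.range (blockLen K),
      (if i < 2 ^ q then ((2 : ℝ) ^ q)⁻¹ else 0) = 1 := by
    intro q hq
    have e2 : (Finset.range (blockLen K)).filter (· < 2 ^ q) = Finset.range (2 ^ q) := by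
      have := (Nat.le_add_right _ _).trans (le_blockLen (Finset.mem_range.1 hq))
      ext i
      simp only [Finset.mem_filter, Finset.mem_range]
      omega
    rw [← Finset.sum_filter, e2, Finset.sum_const, Finset.card_range, nsmul_eq_mul]
    push_cast
    exact mul_inv_cancel₀ (by positivity)
  rw [Finset.sum_congr rfl hblock]
  simp

theorem dyadicRank_injOn (K : ℕ) : Set.InjOn (dyadicRank K) {n | dyadicSeq K n ≠ 0} := by
  intro n hn m hm h
  obtain ⟨hn1, hn2⟩ := dyadicSeq_ne_zero hn
  obtain ⟨hm1, hm2⟩ := dyadicSeq_ne_zero hm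
  suffices n / blockLen K = m / blockLen K ∧ n % blockLen K = m % blockLen K by
    rw [← Nat.div_add_mod n (blockLen K), this.1, this.2, Nat.div_add_mod]
  have p1 : 0 < 2 ^ (n / blockLen K) := by positivity
  have p2 : 0 < 2 ^ (m / blockLen K) := by positivity
  have p3 : 0 < 2 ^ (K + n / blockLen K) := by positivity
  have p4 : 0 < 2 ^ (K + m / blockLen K) := by positivity
  unfold dyadicRank at h
  split_ifs at h with h1 h2 h2
  · exact two_pow_add_inj h1 h2 (by omega)
  · have := (two_pow_add_inj h1 (show m % blockLen K - 2 ^ (m / blockLen K) <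
      2 ^ (K + m / blockLen K) by omega) (by omega)).1
    exact absurd this (hn1.trans_le (Nat.le_add_right K _)).ne
  · have := (two_pow_add_inj (show n % blockLen K - 2 ^ (n / blockLen K) <
      2 ^ (K + n / blockLen K) by omega) h2 (by omega)).1
    exact absurd this (hm1.trans_le (Nat.le_add_right K _)).ne'
  · have h3 := two_pow_add_inj (show n % blockLen K - 2 ^ (n / blockLen K) <
      2 ^ (K + n / blockLen K) by omega) (show m % blockLen K - 2 ^ (m / blockLen K) <
      2 ^ (K + m / blockLen K) by omega) (by omega)
    have h4 : n / blockLen K = m / blockLen K := by omega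
    refine ⟨h4, ?_⟩
    have h5 := h3.2
    rw [h4] at h1 h5
    omega

theorem dyadicRank_lt {K n : ℕ} (hn : dyadicSeq K n ≠ 0) : dyadicRank K n < 2 ^ (K + K) := by
  obtain ⟨hn1, hn2⟩ := dyadicSeq_ne_zero hn
  have p1 : 0 < 2 ^ (n / blockLen K) := by positivity
  have h1 : 2 ^ (n / blockLen K + 1) ≤ 2 ^ (K + K) :=
    Nat.pow_le_pow_right (by norm_num) (by omega)
  have h2 : 2 ^ (K + n / blockLen K + 1) ≤ 2 ^ (K + K) :=
    Nat.pow_le_pow_right (by norm_num) (by omega)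
  rw [pow_succ] at h1 h2
  unfold dyadicRank
  split_ifs <;> omega

theorem card_dyadicPos_lt (K : ℕ) : (dyadicPos K).card < 2 ^ K := by
  have h : (dyadicPos K).card ≤ (Finset.range (2 ^ K - 1)).card := by
    refine Finset.card_le_card_of_injOn (dyadicRank K) (fun n hn => ?_)
      ((dyadicRank_injOn K).mono fun n hn => ?_)
    · have hn' := mem_dyadicPos.1 hn
      have p1 : 0 < 2 ^ (n / blockLen K) := by positivity
      have h1 : 2 ^ (n / blockLen K + 1) ≤ 2 ^ K := Nat.pow_le_pow_right (by norm_num) (by omega)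
      rw [pow_succ] at h1
      rw [Finset.coe_range, Set.mem_Iio, dyadicRank, if_pos hn'.2]
      omega
    · exact (lt_of_lt_of_le (by positivity) (le_dyadicSeq_of_mem hn)).ne'
  rw [Finset.card_range] at h
  have : 0 < 2 ^ K := by positivity
  omega

theorem dyadicRank_mul_le {K n : ℕ} (hn : dyadicSeq K n ≠ 0) :
    ((dyadicRank K n : ℝ) + 1) * |dyadicSeq K n| ≤ 2 := by
  obtain ⟨hn1, hn2⟩ := dyadicSeq_ne_zero hn
  have key : ∀ {g i j : ℕ}, j + 1 = 2 ^ g + i → i ≤ 2 ^ g →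
      ((j : ℝ) + 1) * ((2 : ℝ) ^ g)⁻¹ ≤ 2 := by
    intro g i j hj hi
    rw [← div_eq_mul_inv, div_le_iff₀ (by positivity)]
    have : j + 1 ≤ 2 * 2 ^ g := by omega
    exact_mod_cast this
  have p1 : 0 < 2 ^ (n / blockLen K) := by positivity
  have p3 : 0 < 2 ^ (K + n / blockLen K) := by positivity
  unfold dyadicSeq balancedBlock dyadicRank
  rw [if_pos hn1]
  by_cases h1 : n % blockLen K < 2 ^ (n / blockLen K)
  · rw [if_pos h1, if_pos h1, abs_of_nonneg (by positivity)]
    push_cast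
    exact key (i := n % blockLen K) (by omega) h1.le
  · rw [if_neg h1, if_neg h1, if_pos hn2, abs_neg, abs_of_nonneg (by positivity)]
    push_cast
    exact key (i := n % blockLen K - 2 ^ (n / blockLen K)) (by omega) (by omega)

section

variable {𝕜 : Type*} [RCLike 𝕜] {E : Type*} [AddCommGroup E] [Module 𝕜 E]

/-- The vector with coordinates `dyadicSeq K`. -/
noncomputable def BiorthSystem.dyadicVec (S : BiorthSystem 𝕜 E) (K : ℕ) : E :=
  ∑ n ∈ Finset.range (blockLen K * K), (dyadicSeq K n : 𝕜) • S.vec n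

theorem BiorthSystem.coord_dyadicVec (S : BiorthSystem 𝕜 E) (K n : ℕ) :
    S.coord n (S.dyadicVec K) = (dyadicSeq K n : 𝕜) := by
  rw [BiorthSystem.dyadicVec, S.coord_sum _ fun n => (dyadicSeq K n : 𝕜)]
  simp only [Finset.mem_range]
  split_ifs with h
  · rfl
  · rw [dyadicSeq_eq_zero (not_lt.1 h), RCLike.ofReal_zero]

theorem BiorthSystem.isGreedySet_dyadicVec (S : BiorthSystem 𝕜 E) (K : ℕ) :
    S.IsGreedySet (S.dyadicVec K) (dyadicPos K).card (dyadicPos K) := by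
  refine ⟨rfl, fun n hn m hm => ?_⟩
  rw [S.coord_dyadicVec, S.coord_dyadicVec, RCLike.norm_ofReal, RCLike.norm_ofReal]
  exact (abs_dyadicSeq_le_of_notMem hm).trans ((le_dyadicSeq_of_mem hn).trans (le_abs_self _))

namespace IsKTSystem

variable {S : BiorthSystem 𝕜 E} {p : ℝ} {r : ℝ≥0∞} {ι : E →ₗ[𝕜] (ℕ → 𝕜)}

theorem nrm_dyadicVec_le (h : IsKTSystem S 1 r ι) (hr : 1 ≤ r) (K : ℕ) :
    S.nrm (S.dyadicVec K) ≤ 2 * harm (2 ^ (K + K)) ^ (r⁻¹).toReal := by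
  have hι : ∀ n, ι (S.dyadicVec K) n = (dyadicSeq K n : 𝕜) := fun n => by
    rw [← h.coord_eq, S.coord_dyadicVec]
  have hne : ∀ n, ι (S.dyadicVec K) n ≠ 0 ↔ dyadicSeq K n ≠ 0 := fun n => by
    rw [hι, Ne, RCLike.ofReal_eq_zero]
  rw [h.nrm_eq]
  refine max_le ?_ (iSup_le fun L => ?_)
  · refine lorentzNrm_le_of_injOn hr (φ := dyadicRank K) ?_
      (fun n hn => dyadicRank_lt ((hne n).1 hn)) (fun n hn => ?_) le_rfl
    · simp only [hne]
      exact dyadicRank_injOn K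
    · have h1 := ENNReal.ofReal_le_ofReal (dyadicRank_mul_le ((hne n).1 hn))
      rw [ENNReal.ofReal_mul (by positivity), ENNReal.ofReal_add (by positivity) zero_le_one,
        ENNReal.ofReal_natCast, ENNReal.ofReal_one, ENNReal.ofReal_ofNat] at h1
      rw [div_one, ENNReal.rpow_one, hι, ← ofReal_norm, RCLike.norm_ofReal]
      exact h1
  · have e : ∑ n ∈ Finset.range L,
        ι (S.dyadicVec K) n / ((((n : ℝ) + 1) ^ (1 - 1 / (1 : ℝ)) : ℝ) : 𝕜) =
        ((∑ n ∈ Finset.range L, dyadicSeq K n : ℝ) : 𝕜) := by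
      rw [RCLike.ofReal_sum]
      exact Finset.sum_congr rfl fun n _ => by rw [hι]; simp
    have h1 : (1 : ℝ≥0∞) ≤ harm (2 ^ (K + K)) ^ (r⁻¹).toReal := by
      simpa using ENNReal.rpow_le_rpow (one_le_harm (N := 2 ^ (K + K)) Nat.one_le_two_pow)
        (ENNReal.toReal_nonneg (a := r⁻¹))
    rw [e]
    have hb := sum_dyadicSeq_mem K L
    refine (enorm_le_one_of_norm_le ?_).trans (h1.trans (le_mul_of_one_le_left zero_le (by simp)))
    rw [RCLike.norm_ofReal, abs_of_nonneg hb.1]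
    exact hb.2

theorem le_nrm_proj_dyadicVec (h : IsKTSystem S 1 r ι) (K : ℕ) :
    (K : ℝ≥0∞) ≤ S.nrm (S.proj (dyadicPos K) (S.dyadicVec K)) := by
  refine le_trans (le_of_eq ?_) (h.enorm_sum_le _ (blockLen K * K))
  have e : ∑ n ∈ Finset.range (blockLen K * K), ι (S.proj (dyadicPos K) (S.dyadicVec K)) n /
      ((((n : ℝ) + 1) ^ (1 - 1 / (1 : ℝ)) : ℝ) : 𝕜) = ((K : ℝ) : 𝕜) := by
    rw [← sum_dyadicPos K, RCLike.ofReal_sum]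
    refine Finset.sum_congr rfl fun n _ => ?_
    rw [h.map_proj_apply, ← h.coord_eq, S.coord_dyadicVec]
    split_ifs <;> simp
  rw [e, ← ofReal_norm, RCLike.norm_ofReal, Nat.abs_cast, ENNReal.ofReal_natCast]

theorem le_nrm_sub_proj_dyadicVec (h : IsKTSystem S 1 r ι) (K : ℕ) :
    (K : ℝ≥0∞) ≤ S.nrm (S.dyadicVec K - S.proj (dyadicPos K) (S.dyadicVec K)) := by
  refine le_trans (le_of_eq ?_) (h.enorm_sum_le _ (blockLen K * K))
  have e : ∑ n ∈ Finset.range (blockLen K * K),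
      ι (S.dyadicVec K - S.proj (dyadicPos K) (S.dyadicVec K)) n /
      ((((n : ℝ) + 1) ^ (1 - 1 / (1 : ℝ)) : ℝ) : 𝕜) = ((-(K : ℝ) : ℝ) : 𝕜) := by
    rw [← zero_sub (K : ℝ), ← sum_dyadicSeq_eq_zero K, ← sum_dyadicPos K,
      ← Finset.sum_sub_distrib, RCLike.ofReal_sum]
    refine Finset.sum_congr rfl fun n _ => ?_
    rw [map_sub, Pi.sub_apply, h.map_proj_apply, ← h.coord_eq, S.coord_dyadicVec]
    split_ifs <;> simp
  rw [e, ← ofReal_norm, RCLike.norm_ofReal, abs_neg, Nat.abs_cast, ENNReal.ofReal_natCast]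

/-- The greedy operators of order `N` are tested on the dyadic vector with `K = ⌊log₂ (N + 1)⌋`
blocks. -/
theorem harmRate_le_of_dyadicVec (h : IsKTSystem S 1 r ι) (hr : 1 ≤ r) {N : ℕ} (hN : 1 ≤ N)
    {T : ℝ≥0∞} (hT : ∀ K, (dyadicPos K).card ≤ N → (K : ℝ≥0∞) ≤ T * S.nrm (S.dyadicVec K)) :
    harmRate r N ≤ (18 : ℝ≥0) * T := by
  obtain ⟨ht0, ht1⟩ := toReal_inv_nonneg_le_one hr
  set t := (r⁻¹).toReal with ht
  set K := Nat.log 2 (N + 1) with hK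
  have hK1 : 1 ≤ K := Nat.log_pos (by norm_num) (by omega)
  have hlow : 2 ^ K ≤ N + 1 := Nat.pow_log_le_self 2 (by omega)
  have hupp : N + 1 < 2 ^ (K + 1) := Nat.lt_pow_succ_log_self (by norm_num) _
  have hK1' : (1 : ℝ≥0∞) ≤ K := by exact_mod_cast hK1
  have hcard : (dyadicPos K).card ≤ N := by
    have := card_dyadicPos_lt K
    omega
  have h1 : harm N ≤ 3 * K := by
    refine (harm_mono (by omega : N ≤ 2 ^ (K + 1))).trans ((harm_two_pow_le _).trans ?_)
    exact_mod_cast (by omega : K + 1 + 1 ≤ 3 * K)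
  have h2 : harm (2 ^ (K + K)) ≤ 3 * K := by
    refine (harm_two_pow_le _).trans ?_
    exact_mod_cast (by omega : K + K + 1 ≤ 3 * K)
  have h3 : (K : ℝ≥0∞) ≤ (6 * T) * (K : ℝ≥0∞) ^ t := by
    calc (K : ℝ≥0∞) ≤ T * (2 * (3 * K) ^ t) := by
          refine (hT K hcard).trans ?_
          gcongr
          refine (h.nrm_dyadicVec_le hr K).trans ?_
          gcongr
      _ ≤ T * (2 * (3 * (K : ℝ≥0∞) ^ t)) := by
          gcongr
          exact mul_rpow_le_of_le_one _ (by norm_num) ht0 ht1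
      _ = _ := by ring
  have h4 := rpow_le_of_le_mul_rpow (zero_lt_one.trans_le hK1').ne' (ENNReal.natCast_ne_top K) h3
  calc harmRate r N ≤ (3 * (K : ℝ≥0∞)) ^ (1 - t) := ENNReal.rpow_le_rpow h1 (by linarith)
    _ ≤ 3 * (K : ℝ≥0∞) ^ (1 - t) :=
        mul_rpow_le_of_le_one _ (by norm_num) (by linarith) (by linarith)
    _ ≤ 3 * (6 * T) := by gcongr
    _ = _ := by push_cast; ring

theorem harmRate_le_quasiGreedyConst (h : IsKTSystem S 1 r ι) (hr : 1 ≤ r) {N : ℕ}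
    (hN : 1 ≤ N) : harmRate r N ≤ (18 : ℝ≥0) * S.quasiGreedyConst N :=
  h.harmRate_le_of_dyadicVec hr hN fun K hK => (h.le_nrm_proj_dyadicVec K).trans
    (S.nrm_proj_le_quasiGreedyConst hK (S.isGreedySet_dyadicVec K))

theorem harmRate_le_lebesgueExp (h : IsKTSystem S 1 r ι) (hr : 1 ≤ r) {N : ℕ}
    (hN : 1 ≤ N) : harmRate r N ≤ (18 : ℝ≥0) * S.lebesgueExp N :=
  h.harmRate_le_of_dyadicVec hr hN fun K hK => (h.le_nrm_sub_proj_dyadicVec K).trans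
    (S.nrm_sub_proj_le_lebesgueExp (M := blockLen K * K) (S.isGreedySet_dyadicVec K) hK
      fun n hn => by rw [S.coord_dyadicVec, dyadicSeq_eq_zero hn, RCLike.ofReal_zero])

/-! ### The asymptotics -/

theorem exists_lebesgue_le (h : IsKTSystem S p r ι) (hp : 1 ≤ p) (hr : 1 ≤ r) :
    ∃ C : ℝ≥0, ∀ N, 1 ≤ N → S.lebesgue N ≤ C * harmRate r N := by
  obtain ⟨Q, hQ⟩ := h.exists_hasDominationConst hp hr
  refine S.lebesgue_le_harmRate hr (h.nrm_proj_le_harmRate hp hr) ⟨Q, fun N hN => (hQ N).mono ?_⟩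
  refine le_mul_of_one_le_right zero_le ?_
  rw [← ENNReal.coe_le_coe, ENNReal.coe_toNNReal (harmRate_ne_top hr N)]
  exact one_le_harmRate hr hN

theorem exists_dual_lebesgue_le (h : IsKTSystem S p r ι) (hp : 1 ≤ p) (hr : 1 ≤ r) :
    ∃ C : ℝ≥0, ∀ N, 1 ≤ N → S.dual.lebesgue N ≤ C * harmRate r N := by
  refine S.dual.lebesgue_le_harmRate hr
    (fun N A hA => S.dual_nrm_proj_le (h.nrm_proj_le_harmRate hp hr N A hA)) ?_
  rcases eq_or_lt_of_le hp with rfl | hp1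
  · exact h.exists_hasDominationConst_dual_one hr
  · obtain ⟨Q, hQ⟩ := h.exists_hasDominationConst_dual hp1 hr
    refine ⟨Q, fun N hN => (hQ N).mono (le_mul_of_one_le_right zero_le ?_)⟩
    rw [← ENNReal.coe_le_coe, ENNReal.coe_toNNReal (harmRate_ne_top hr N)]
    exact one_le_harmRate hr hN

theorem comparable_lebesgue (h : IsKTSystem S p r ι) (hp : 1 ≤ p) (hr : 1 ≤ r) :
    Comparable S.lebesgue (logRate r) :=
  comparable_logRate hr ⟨4, fun _ hN => h.harmRate_le_lebesgue hp hr hN⟩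
    (h.exists_lebesgue_le hp hr)

theorem comparable_dual_lebesgue (h : IsKTSystem S p r ι) (hp : 1 ≤ p) (hr : 1 ≤ r) :
    Comparable S.dual.lebesgue (logRate r) :=
  comparable_logRate hr ⟨4, fun _ hN => h.harmRate_le_dual_lebesgue hp hr hN⟩
    (h.exists_dual_lebesgue_le hp hr)

theorem condConst_le_harmRate (h : IsKTSystem S p r ι) (hp : 1 ≤ p) (hr : 1 ≤ r) (N : ℕ) :
    S.condConst N ≤ harmRate r N :=
  S.condConst_le (h.nrm_proj_le_harmRate hp hr N)

theorem comparable_condConst (h : IsKTSystem S p r ι) (hp : 1 ≤ p) (hr : 1 ≤ r) :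
    Comparable S.condConst (logRate r) :=
  comparable_logRate hr ⟨4, fun _ hN => h.harmRate_le_condConst hp hr hN⟩
    ⟨1, fun N _ => by rw [ENNReal.coe_one, one_mul]; exact h.condConst_le_harmRate hp hr N⟩

theorem comparable_lebesgueExp_one (h : IsKTSystem S p r ι) (hp : 1 < p) (hr : 1 ≤ r) :
    Comparable S.lebesgueExp fun _ => 1 := by
  obtain ⟨C, hC1, hC⟩ := S.exists_one_le_nrm_add
  obtain ⟨G, hG⟩ := h.exists_nrm_proj_le hp hr
  obtain ⟨Q, hQ⟩ := h.exists_hasDominationConst hp.le hr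
  refine ⟨1, C * (C * (1 + G) + Q), one_pos, fun N _ => ⟨?_, ?_⟩⟩
  · simpa using S.one_le_lebesgueExp N
  · rw [mul_one]
    exact S.lebesgueExp_le hC1 hC hG (hQ N)

theorem comparable_dual_lebesgueExp_one (h : IsKTSystem S p r ι) (hp : 1 < p) (hr : 1 ≤ r) :
    Comparable S.dual.lebesgueExp fun _ => 1 := by
  obtain ⟨C, hC1, hC⟩ := S.dual.exists_one_le_nrm_add
  obtain ⟨G, hG⟩ := h.exists_dual_nrm_proj_le hp hr
  obtain ⟨Q, hQ⟩ := h.exists_hasDominationConst_dual hp hr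
  refine ⟨1, C * (C * (1 + G) + Q), one_pos, fun N _ => ⟨?_, ?_⟩⟩
  · simpa using S.dual.one_le_lebesgueExp N
  · rw [mul_one]
    exact S.dual.lebesgueExp_le hC1 hC hG (hQ N)

theorem isQuasiGreedy (h : IsKTSystem S p r ι) (hp : 1 < p) (hr : 1 ≤ r) : S.IsQuasiGreedy := by
  obtain ⟨G, hG⟩ := h.exists_nrm_proj_le hp hr
  exact ⟨G, fun N => S.quasiGreedyConst_le fun n _ => hG n⟩

theorem comparable_lebesgueExp (h : IsKTSystem S 1 r ι) (hr : 1 ≤ r) :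
    Comparable S.lebesgueExp (logRate r) := by
  obtain ⟨C, hC⟩ := h.exists_lebesgue_le le_rfl hr
  exact comparable_logRate hr ⟨18, fun _ hN => h.harmRate_le_lebesgueExp hr hN⟩
    ⟨C, fun N hN => (S.lebesgueExp_le_lebesgue N).trans (hC N hN)⟩

theorem comparable_dual_lebesgueExp (h : IsKTSystem S 1 r ι) (hr : 1 ≤ r) :
    Comparable S.dual.lebesgueExp (logRate r) := by
  obtain ⟨C, hC⟩ := h.exists_dual_lebesgue_le le_rfl hr
  exact comparable_logRate hr ⟨4, fun _ hN => h.harmRate_le_dual_lebesgueExp hr hN⟩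
    ⟨C, fun N hN => (S.dual.lebesgueExp_le_lebesgue N).trans (hC N hN)⟩

theorem comparable_quasiGreedyConst (h : IsKTSystem S 1 r ι) (hr : 1 ≤ r) :
    Comparable S.quasiGreedyConst (logRate r) := by
  refine comparable_logRate hr ⟨18, fun _ hN => h.harmRate_le_quasiGreedyConst hr hN⟩
    ⟨1, fun N _ => ?_⟩
  rw [ENNReal.coe_one, one_mul]
  exact S.quasiGreedyConst_le fun n hn x A hA =>
    h.nrm_proj_le_harmRate le_rfl hr N A (hA.1.trans_le hn) x

theorem asymptotics_of_one_lt (h : IsKTSystem S p r ι) (hr : 1 ≤ r) (hp : 1 < p) :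
    S.IsQuasiGreedy ∧ S.IsBidemocratic ∧
      Comparable S.lebesgue (logRate r) ∧ Comparable S.dual.lebesgue (logRate r) ∧
      Comparable S.condConst (logRate r) ∧
      Comparable S.lebesgueExp (fun _ => 1) ∧ Comparable S.dual.lebesgueExp (fun _ => 1) :=
  ⟨h.isQuasiGreedy hp hr, h.isBidemocratic hp hr, h.comparable_lebesgue hp.le hr,
    h.comparable_dual_lebesgue hp.le hr, h.comparable_condConst hp.le hr,
    h.comparable_lebesgueExp_one hp hr, h.comparable_dual_lebesgueExp_one hp hr⟩

theorem asymptotics_of_eq_one (h : IsKTSystem S p r ι) (hr : 1 ≤ r) (hp : p = 1) :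
    S.IsSuperdemocratic ∧
      Comparable (fun N => ENNReal.ofReal (S.overT N)) (logRate r) ∧
      Comparable S.lebesgue (logRate r) ∧ Comparable S.lebesgueExp (logRate r) ∧
      Comparable S.dual.lebesgue (logRate r) ∧ Comparable S.dual.lebesgueExp (logRate r) ∧
      Comparable S.condConst (logRate r) ∧ Comparable S.quasiGreedyConst (logRate r) ∧
      Comparable S.dual.superdemConst (logRate r) := by
  subst hp
  exact ⟨h.isSuperdemocratic hr, h.comparable_overT hr, h.comparable_lebesgue le_rfl hr,
    h.comparable_lebesgueExp hr, h.comparable_dual_lebesgue le_rfl hr,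
    h.comparable_dual_lebesgueExp hr, h.comparable_condConst le_rfl hr,
    h.comparable_quasiGreedyConst hr, h.comparable_dual_superdemConst hr⟩

end IsKTSystem

end

theorem theorem8p8 {𝕜 : Type*} [RCLike 𝕜] (p : ℝ) (r : ℝ≥0∞) (hp : 1 ≤ p) (hr : 1 ≤ r) :
    -- the space `KT(p, r)` with its canonical basis
    ((1 < p →
        (ktSystem 𝕜 p r hp hr).IsQuasiGreedy ∧
        (ktSystem 𝕜 p r hp hr).IsBidemocratic ∧
        Comparable (ktSystem 𝕜 p r hp hr).lebesgue (logRate r) ∧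
        Comparable (ktSystem 𝕜 p r hp hr).dual.lebesgue (logRate r) ∧
        Comparable (ktSystem 𝕜 p r hp hr).condConst (logRate r) ∧
        Comparable (ktSystem 𝕜 p r hp hr).lebesgueExp (fun _ => 1) ∧
        Comparable (ktSystem 𝕜 p r hp hr).dual.lebesgueExp (fun _ => 1)) ∧
      (p = 1 →
        (ktSystem 𝕜 p r hp hr).IsSuperdemocratic ∧
        Comparable (fun N => ENNReal.ofReal ((ktSystem 𝕜 p r hp hr).overT N)) (logRate r) ∧
        Comparable (ktSystem 𝕜 p r hp hr).lebesgue (logRate r) ∧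
        Comparable (ktSystem 𝕜 p r hp hr).lebesgueExp (logRate r) ∧
        Comparable (ktSystem 𝕜 p r hp hr).dual.lebesgue (logRate r) ∧
        Comparable (ktSystem 𝕜 p r hp hr).dual.lebesgueExp (logRate r) ∧
        Comparable (ktSystem 𝕜 p r hp hr).condConst (logRate r) ∧
        Comparable (ktSystem 𝕜 p r hp hr).quasiGreedyConst (logRate r) ∧
        Comparable (ktSystem 𝕜 p r hp hr).dual.superdemConst (logRate r))) ∧
    -- the closed linear span of the canonical basis in `KT(p, r)`
    ((1 < p →
        (ktSystem 𝕜 p r hp hr).restrict.IsQuasiGreedy ∧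
        (ktSystem 𝕜 p r hp hr).restrict.IsBidemocratic ∧
        Comparable (ktSystem 𝕜 p r hp hr).restrict.lebesgue (logRate r) ∧
        Comparable (ktSystem 𝕜 p r hp hr).restrict.dual.lebesgue (logRate r) ∧
        Comparable (ktSystem 𝕜 p r hp hr).restrict.condConst (logRate r) ∧
        Comparable (ktSystem 𝕜 p r hp hr).restrict.lebesgueExp (fun _ => 1) ∧
        Comparable (ktSystem 𝕜 p r hp hr).restrict.dual.lebesgueExp (fun _ => 1)) ∧
      (p = 1 →
        (ktSystem 𝕜 p r hp hr).restrict.IsSuperdemocratic ∧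
        Comparable (fun N => ENNReal.ofReal ((ktSystem 𝕜 p r hp hr).restrict.overT N))
          (logRate r) ∧
        Comparable (ktSystem 𝕜 p r hp hr).restrict.lebesgue (logRate r) ∧
        Comparable (ktSystem 𝕜 p r hp hr).restrict.lebesgueExp (logRate r) ∧
        Comparable (ktSystem 𝕜 p r hp hr).restrict.dual.lebesgue (logRate r) ∧
        Comparable (ktSystem 𝕜 p r hp hr).restrict.dual.lebesgueExp (logRate r) ∧
        Comparable (ktSystem 𝕜 p r hp hr).restrict.condConst (logRate r) ∧
        Comparable (ktSystem 𝕜 p r hp hr).restrict.quasiGreedyConst (logRate r) ∧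
        Comparable (ktSystem 𝕜 p r hp hr).restrict.dual.superdemConst (logRate r))) := by
  have h1 := isKTSystem_ktSystem (𝕜 := 𝕜) hp hr
  have h2 := isKTSystem_restrict (𝕜 := 𝕜) hp hr
  exact ⟨⟨h1.asymptotics_of_one_lt hr, h1.asymptotics_of_eq_one hr⟩,
    ⟨h2.asymptotics_of_one_lt hr, h2.asymptotics_of_eq_one hr⟩⟩
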